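/- Let $M$ be an oriented closed connected (topological) $n$-manifold with fundamental group $\Gamma$ and universal covering $\widetilde M\to M$, on which $\Gamma$ acts by deck transformations. Definitions. For an oriented closed connected $n$-manifold $N$ let $\|N\|_{\mathbb Z}$ be the infimum of the $\ell^1$-norms of all singular cycles in $C_n(N;\mathbb Z)$ representing the integral fundamental class $[N]_{\mathbb Z}$, and let $$\|M\|_{\mathbb Z}^\infty=\inf\Bigl\{\tfrac1d\,\|\overline M\|_{\mathbb Z}\Bigm| d\in\mathbb N_{\ge 1},\ \overline M\to M \text{ a } d\text{-sheeted connected covering}\Bigr\}.$$ A standard $\Gamma$-space is a standard Borel probability space $(X,\mu)$ with a measurable $\mu$-preserving left $\Gamma$-action $\alpha$; then $L^\infty(X,\mu;\mathbb Z)$ is a right $\Gamma$-module via $(f\cdot g)(x)=f(gx)$. Write $C_*(M;\alpha)=L^\infty(X,\mu;\mathbb Z)\otimes_{\mathbb Z\Gamma}C_*(\widetilde M;\mathbb Z)$. The $\ell^1$-norm of a chain $\sum_j f_j\otimes\sigma_j$ in which the $\sigma_j$ have pairwise distinct projections to $M$ is $\sum_j\int_X|f_j|\,d\mu$. Let $|M|^\alpha$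 be the infimum of the $\ell^1$-norms of all cycles in $C_n(M;\alpha)$ that represent the image of $[M]_{\mathbb Z}$ under the map induced by $C_*(M;\mathbb Z)\cong\mathbb Z\otimes_{\mathbb Z\Gamma}C_*(\widetilde M;\mathbb Z)\to C_*(M;\alpha)$, $1\otimes c\mapsto 1\otimes c$, and let $|M|=\inf_\alpha|M|^\alpha$ over all standard $\Gamma$-spaces $\alpha$. Let $|M|^{\widehat\Gamma}$ be $|M|^\alpha$ for the left translation action of $\Gamma$ on the profinite completion $\widehat\Gamma=\varprojlim\Gamma/\Lambda$ (the limit over all finite index subgroups $\Lambda\le\Gamma$) with its normalized Haar measure. Theorem. One has $$|M|\le |M|^{\widehat\Gamma}=\|M\|_{\mathbb Z}^\infty .$$ More specifically, let $\Gamma=\Gamma_0\ge\Gamma_1\ge\Gamma_2\ge\cdots$ be a descending sequence of finite index subgroups, let $\alpha$ be the left translation action of $\Gamma$ on $\varprojlim_i\Gamma/\Gamma_i$ with the probability measure whose push-forward to every $\Gamma/\Gamma_i$ is the normalized counting measure, and let $M_i=\Gamma_i\backslash\widetilde M\to M$ be the covering associated with $\Gamma_i$. Then $$|M|^\alpha=\lim_{i\to\infty}\frac{\|M_i\|_{\mathbb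 Z}}{[\Gamma:\Gamma_i]}.$$ -/

import Mathlib

open MeasureTheory Filter Topology
open scoped ENNReal TensorProduct

universe u v w

noncomputable section

/-! ### Singular chains with integral coefficients -/

/-- Singular `n`-simplices of `X`: continuous maps from the standard `n`-simplex to `X`. -/
abbrev SingularSimplex (n : ℕ) (X : Type u) [TopologicalSpace X] : Type u :=
  C(stdSimplex ℝ (Fin (n + 1)), X)

/-- The singular chain group `C_n(X; ℤ)`: the free abelian group on the singular `n`-simplices. -/
abbrev SingularChain (n : ℕ) (X : Type u) [TopologicalSpace X] : Type u :=
  SingularSimplex n X →₀ ℤ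

namespace SingularChain

variable {X : Type u} [TopologicalSpace X] {Y : Type v} [TopologicalSpace Y]

/-- The `i`-th face of a singular simplex. -/
def face {n : ℕ} (i : Fin (n + 2)) (σ : SingularSimplex (n + 1) X) : SingularSimplex n X :=
  σ.comp ⟨stdSimplex.map i.succAbove, stdSimplex.continuous_map _⟩

/-- The boundary operator `C_{n+1}(X; ℤ) → C_n(X; ℤ)`, `σ ↦ ∑ᵢ (-1)ⁱ ∂ᵢ σ`. -/
def boundary (n : ℕ) : SingularChain (n + 1) X →ₗ[ℤ] SingularChain n X :=
  Finsupp.linearCombination ℤ fun σ : SingularSimplex (n + 1) X =>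
    ∑ i : Fin (n + 2), Finsupp.single (face i σ) ((-1 : ℤ) ^ (i : ℕ))

/-- The boundary operator leaving degree `n`; it is zero for `n = 0`. -/
def boundaryFrom : (n : ℕ) → SingularChain n X →ₗ[ℤ] SingularChain (n - 1) X
  | 0 => 0
  | n + 1 => boundary n

/-- The chain map induced by a continuous map. -/
def map (n : ℕ) (f : C(X, Y)) : SingularChain n X →ₗ[ℤ] SingularChain n Y :=
  Finsupp.lmapDomain ℤ ℤ fun σ : SingularSimplex n X => f.comp σ

theorem boundary_map (n : ℕ) (f : C(X, Y)) (c : SingularChain (n + 1) X) :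
    boundary n (map (n + 1) f c) = map n f (boundary n c) := by
  induction c using Finsupp.induction_linear with
  | zero => simp
  | add a b ha hb => simp [ha, hb]
  | single σ a =>
    simp only [map, boundary, Finsupp.lmapDomain_apply, Finsupp.mapDomain_single,
      Finsupp.linearCombination_single, map_smul, map_sum]
    rfl

/-- The `ℓ¹`-norm of an integral chain with respect to the basis of singular simplices. -/
def l1Norm {n : ℕ} (c : SingularChain n X) : ℝ≥0∞ :=
  c.sum fun _ a => (a.natAbs : ℝ≥0∞)

/-- The chains of `X` all of whose simplices lie in the subset `A`. -/
def chainsIn (A : Set X) (n : ℕ) : Submodule ℤ (SingularChain n X) :=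
  Finsupp.supported ℤ ℤ {σ : SingularSimplex n X | Set.range σ ⊆ A}

/-- Relative cycles of the pair `(X, A)`. -/
def relCycles (A : Set X) (n : ℕ) : Submodule ℤ (SingularChain n X) :=
  (chainsIn A (n - 1)).comap (boundaryFrom n)

/-- Relative boundaries of the pair `(X, A)`, as chains of `X`. -/
def relBoundaries (A : Set X) (n : ℕ) : Submodule ℤ (SingularChain n X) :=
  LinearMap.range (boundary (X := X) n) ⊔ chainsIn A n

end SingularChain

open SingularChain

/-- Relative singular homology `H_n(X, A; ℤ)`. -/
abbrev RelHomology (n : ℕ) (X : Type u) [TopologicalSpace X] (A : Set X) : Type u :=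
  relCycles A n ⧸ (relBoundaries A n).submoduleOf (relCycles A n)

/-- The class in `H_n(X, A; ℤ)` of a relative cycle. -/
def relClass {n : ℕ} {X : Type u} [TopologicalSpace X] {A : Set X} (c : SingularChain n X)
    (hc : c ∈ relCycles A n) : RelHomology n X A :=
  Submodule.Quotient.mk ⟨c, hc⟩

/-! ### Orientations, fundamental cycles, integral simplicial volume -/

/-- An orientation of an `n`-manifold `N`: a choice of a generator of each local homology group
`H_n(N, N \ {x}; ℤ) ≅ ℤ` such that locally these generators are all restrictions of one class in
`H_n(N, N \ U; ℤ)` with `U` a neighbourhood. -/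
structure HomologicalOrientation (n : ℕ) (N : Type u) [TopologicalSpace N] where
  localClass : ∀ x : N, RelHomology n N {x}ᶜ
  generates : ∀ x, Submodule.span ℤ {localClass x} = ⊤
  locallyConsistent : ∀ x, ∃ U ∈ 𝓝 x, ∃ c ∈ relCycles Uᶜ n,
    ∀ y ∈ U, ∃ hc : c ∈ relCycles {y}ᶜ n, relClass c hc = localClass y

/-- Integral fundamental cycles of a closed oriented `n`-manifold: cycles that represent the
orientation in every local homology group. -/
def IsFundamentalCycle {n : ℕ} {N : Type u} [TopologicalSpace N] (o : HomologicalOrientation n N)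
    (c : SingularChain n N) : Prop :=
  boundaryFrom n c = 0 ∧
    ∀ x, ∃ hc : c ∈ relCycles {x}ᶜ n, relClass c hc = o.localClass x

/-- The integral simplicial volume `‖N‖_ℤ` of an orientable closed connected `n`-manifold `N`:
the infimum of the `ℓ¹`-norms of integral fundamental cycles.  A connected orientable manifold has
exactly two orientations, and `c ↦ -c` is a norm-preserving bijection between their fundamental
cycles; so no orientation has to be singled out. -/
def integralSimplicialVolume (n : ℕ) (N : Type u) [TopologicalSpace N] : ℝ≥0∞ :=
  ⨅ (o : HomologicalOrientation n N) (c : SingularChain n N) (_ : IsFundamentalCycle o c),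
    l1Norm c

/-- The stable integral simplicial volume `‖M‖_ℤ^∞`: the infimum of `‖N‖_ℤ / d` over all
`d`-sheeted (connected) coverings `N → M`, `d ≥ 1`. -/
def stableIntegralSimplicialVolume (n : ℕ) (M : Type u) [TopologicalSpace M] : ℝ≥0∞ :=
  ⨅ (d : ℕ) (_ : 0 < d) (N : Type u) (_ : TopologicalSpace N) (_ : ConnectedSpace N)
    (q : N → M) (_ : IsCoveringMap q) (_ : ∀ x : M, Nat.card (q ⁻¹' {x}) = d),
    integralSimplicialVolume n N / (d : ℝ≥0∞)

/-! ### Deck transformations -/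

/-- The group of deck transformations of `p : E → M`.  If `p` is the universal covering of a
connected manifold, this is the fundamental group of `M`, acting on `E` from the left. -/
def DeckGroup {E : Type u} {M : Type v} [TopologicalSpace E] (p : E → M) : Subgroup (E ≃ₜ E) where
  carrier := {f | ∀ x, p (f x) = p x}
  mul_mem' {f g} hf hg x := (hf (g x)).trans (hg x)
  one_mem' _ := rfl
  inv_mem' {f} hf x := by
    have h := hf (f.symm x)
    rw [f.apply_symm_apply] at h
    exact h.symm

namespace DeckGroup

variable {E : Type u} {M : Type v} [TopologicalSpace E] (p : E → M)

instance : MulAction (DeckGroup p) E where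
  smul g x := (g : E ≃ₜ E) x
  one_smul _ := rfl
  mul_smul _ _ _ := rfl

instance : ContinuousConstSMul (DeckGroup p) E where
  continuous_const_smul g := (g : E ≃ₜ E).continuous

end DeckGroup

/-! ### Chains with coefficients in `L^∞(X, μ; ℤ)` -/

section Parametrised

variable (Γ : Type u) [Group Γ]
variable (E : Type v) [TopologicalSpace E] [MulAction Γ E] [ContinuousConstSMul Γ E]
variable {X : Type w} [MeasurableSpace X] (μ : Measure X) [MulAction Γ X]
  [MeasurableConstSMul Γ X] [SMulInvariantMeasure Γ X μ]

variable {E} in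
/-- The left action of `g` on singular chains of `E`. -/
def chainTranslate (n : ℕ) (g : Γ) : SingularChain n E →ₗ[ℤ] SingularChain n E :=
  SingularChain.map n ⟨fun x => g • x, continuous_const_smul g⟩

/-- The right action of `g` on `L^∞(X, μ; ℤ)`, `(f · g)(x) = f (g • x)`. -/
def rightTranslate (g : Γ) : Lp ℤ ∞ μ →+ Lp ℤ ∞ μ :=
  Lp.compMeasurePreserving (fun x : X => g • x) (measurePreserving_smul g μ)

/-- The relations `(f · g) ⊗ c = f ⊗ (g · c)` of the tensor product over the group ring `ℤΓ`. -/
def balancingRelations (n : ℕ) : Submodule ℤ (Lp ℤ ∞ μ ⊗[ℤ] SingularChain n E) :=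
  Submodule.span ℤ {t | ∃ (g : Γ) (f : Lp ℤ ∞ μ) (c : SingularChain n E),
    t = rightTranslate Γ μ g f ⊗ₜ[ℤ] c - f ⊗ₜ[ℤ] chainTranslate Γ n g c}

/-- `L^∞(X, μ; ℤ) ⊗_{ℤΓ} C_n(E; ℤ)`; the tensor product over the noncommutative ring `ℤΓ` is
the quotient of the tensor product over `ℤ` by the balancing relations. -/
abbrev ParamChain (n : ℕ) : Type (max v w) :=
  (Lp ℤ ∞ μ ⊗[ℤ] SingularChain n E) ⧸ balancingRelations Γ E μ n

variable {E} {μ} in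
/-- The element `f ⊗ c` of `L^∞(X, μ; ℤ) ⊗_{ℤΓ} C_n(E; ℤ)`. -/
def ParamChain.tmul {n : ℕ} (f : Lp ℤ ∞ μ) (c : SingularChain n E) : ParamChain Γ E μ n :=
  Submodule.Quotient.mk (f ⊗ₜ[ℤ] c)

theorem balancingRelations_le_comap (n : ℕ) :
    balancingRelations Γ E μ (n + 1) ≤
      (balancingRelations Γ E μ n).comap
        (LinearMap.lTensor (Lp ℤ ∞ μ) (boundary (X := E) n)) := by
  refine Submodule.span_le.2 ?_
  rintro _ ⟨g, f, c, rfl⟩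
  refine Submodule.subset_span ⟨g, f, boundary n c, ?_⟩
  rw [map_sub, LinearMap.lTensor_tmul, LinearMap.lTensor_tmul]
  exact congrArg (fun t => _ - f ⊗ₜ[ℤ] t) (boundary_map n _ c)

/-- The boundary operator `id ⊗ ∂`. -/
def ParamChain.boundary (n : ℕ) : ParamChain Γ E μ (n + 1) →ₗ[ℤ] ParamChain Γ E μ n :=
  Submodule.mapQ _ _ (LinearMap.lTensor (Lp ℤ ∞ μ) (SingularChain.boundary (X := E) n))
    (balancingRelations_le_comap Γ E μ n)

/-- The boundary operator `id ⊗ ∂` leaving degree `n`; it is zero for `n = 0`. -/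
def ParamChain.boundaryFrom : (n : ℕ) → ParamChain Γ E μ n →ₗ[ℤ] ParamChain Γ E μ (n - 1)
  | 0 => 0
  | n + 1 => ParamChain.boundary Γ E μ n

variable {E} {μ} in
/-- The chain `∑ⱼ fⱼ ⊗ σⱼ` given by a finitely supported family of coefficients. -/
def ParamChain.ofFinsupp {n : ℕ} (s : SingularSimplex n E →₀ Lp ℤ ∞ μ) : ParamChain Γ E μ n :=
  s.sum fun σ f => ParamChain.tmul Γ f (Finsupp.single σ 1)

/-- `∑ⱼ fⱼ ⊗ σⱼ` is in reduced form with respect to `p : E → M`: the simplices `σⱼ` that occur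
have pairwise distinct images `p ∘ σⱼ`. -/
def IsReducedForm {E : Type v} [TopologicalSpace E] {X : Type w} [MeasurableSpace X] {μ : Measure X}
    {M : Type v} (p : E → M) {n : ℕ} (s : SingularSimplex n E →₀ Lp ℤ ∞ μ) : Prop :=
  ∀ σ ∈ s.support, ∀ τ ∈ s.support, p ∘ σ = p ∘ τ → σ = τ

variable {E} {μ} in
/-- The `ℓ¹`-norm of a parametrised chain: `∑ⱼ ∫ |fⱼ| dμ` for a reduced form `∑ⱼ fⱼ ⊗ σⱼ`.
Every chain has a reduced form and all its reduced forms give the same value. -/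
def ParamChain.l1Norm {M : Type v} (p : E → M) {n : ℕ} (c : ParamChain Γ E μ n) : ℝ≥0∞ :=
  ⨅ (s : SingularSimplex n E →₀ Lp ℤ ∞ μ) (_ : IsReducedForm p s)
    (_ : ParamChain.ofFinsupp Γ s = c), s.sum fun _ f => ∫⁻ x, ‖f x‖ₑ ∂μ

/-- `c` is a parametrised fundamental cycle of the oriented manifold `M`: a cycle homologous to the
image `1 ⊗ z̃` of an integral fundamental cycle of `M`, where `z̃` is a chain upstairs corresponding
to that fundamental cycle under `C_n(M; ℤ) ≅ ℤ ⊗_{ℤΓ} C_n(E; ℤ)`, i.e. projecting to it. -/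
def IsParamFundamentalCycle {M : Type v} [TopologicalSpace M] {n : ℕ}
    (o : HomologicalOrientation n M) (p : C(E, M)) [IsFiniteMeasure μ]
    (c : ParamChain Γ E μ n) : Prop :=
  ParamChain.boundaryFrom Γ E μ n c = 0 ∧
    ∃ z : SingularChain n E, IsFundamentalCycle o (SingularChain.map n p z) ∧
      c - ParamChain.tmul Γ (Lp.const ∞ μ 1) z ∈ LinearMap.range (ParamChain.boundary Γ E μ n)

end Parametrised

/-- The `α`-parametrised simplicial volume `|M|^α` of an oriented closed connected manifold with
universal covering `p : E → M`, for a measure preserving action `α` of the group `Γ` of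
deck transformations on the probability space `(X, μ)`. -/
def paramSimplicialVolume {n : ℕ} {M E : Type u} [TopologicalSpace M] [TopologicalSpace E]
    (o : HomologicalOrientation n M) (p : C(E, M))
    {X : Type w} [MeasurableSpace X] (μ : Measure X) [IsProbabilityMeasure μ]
    [MulAction (DeckGroup p) X] [MeasurableConstSMul (DeckGroup p) X]
    [SMulInvariantMeasure (DeckGroup p) X μ] : ℝ≥0∞ :=
  ⨅ (c : ParamChain (DeckGroup p) E μ n) (_ : IsParamFundamentalCycle (DeckGroup p) E μ o p c),
    ParamChain.l1Norm (DeckGroup p) p c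

/-- The integral foliated simplicial volume `|M|`: the infimum of `|M|^α` over all standard
`Γ`-spaces `α`, i.e. all measurable measure preserving `Γ`-actions on standard Borel
probability spaces. -/
def integralFoliatedSimplicialVolume {n : ℕ} {M E : Type u} [TopologicalSpace M]
    [TopologicalSpace E] (o : HomologicalOrientation n M) (p : C(E, M)) : ℝ≥0∞ :=
  ⨅ (X : Type) (_ : MeasurableSpace X) (_ : StandardBorelSpace X) (μ : Measure X)
    (_ : IsProbabilityMeasure μ) (_ : MulAction (DeckGroup p) X)
    (_ : MeasurableConstSMul (DeckGroup p) X) (_ : SMulInvariantMeasure (DeckGroup p) X μ),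
    paramSimplicialVolume o p μ

/-! ### Coset trees and the profinite completion -/

/-- The inverse limit of the coset spaces `Γ / S i`, for a family of subgroups of `Γ` ordered by
inclusion. -/
@[ext]
structure CosetLimit {Γ : Type u} [Group Γ] {ι : Type v} (S : ι → Subgroup Γ) : Type (max u v) where
  coord : ∀ i, Γ ⧸ S i
  compatible : ∀ i j (h : S j ≤ S i), Subgroup.quotientMapOfLE h (coord j) = coord i

namespace CosetLimit

variable {Γ : Type u} [Group Γ] {ι : Type v} (S : ι → Subgroup Γ)

/-- The σ-algebra generated by the projections to the discrete spaces `Γ / S i`.  This is the Borel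
σ-algebra of the inverse limit topology when the `S i` are countably many subgroups of finite index,
as for a chain, or for all finite index subgroups of a finitely generated group. -/
instance : MeasurableSpace (CosetLimit S) :=
  ⨆ i, MeasurableSpace.comap (fun x : CosetLimit S => x.coord i) ⊤

/-- The left translation action. -/
instance : MulAction Γ (CosetLimit S) where
  smul g x := ⟨fun i => g • x.coord i, fun i j h => by
    rw [← x.compatible i j h]
    induction x.coord j using QuotientGroup.induction_on with
    | H a => rfl⟩
  one_smul x := CosetLimit.ext (funext fun i => one_smul Γ (x.coord i))
  mul_smul g h x := CosetLimit.ext (funext fun i => mul_smul g h (x.coord i))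

theorem measurable_of_coord {Y : Type w} [MeasurableSpace Y] {f : Y → CosetLimit S}
    (hf : ∀ i (A : Set (Γ ⧸ S i)), MeasurableSet {y | (f y).coord i ∈ A}) : Measurable f := by
  refine measurable_iff_comap_le.2 ?_
  rw [instMeasurableSpace, MeasurableSpace.comap_iSup]
  refine iSup_le fun i => ?_
  rw [MeasurableSpace.comap_comp]
  rintro _ ⟨A, -, rfl⟩
  exact hf i A

theorem measurableSet_coord (i : ι) (A : Set (Γ ⧸ S i)) :
    MeasurableSet {x : CosetLimit S | x.coord i ∈ A} :=
  (le_iSup (fun i => MeasurableSpace.comap (fun x : CosetLimit S => x.coord i) ⊤) i) _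
    ⟨A, trivial, rfl⟩

instance : MeasurableConstSMul Γ (CosetLimit S) where
  measurable_const_smul g := measurable_of_coord S fun i A =>
    measurableSet_coord S i {y | g • y ∈ A}

/-- An invariant probability measure on the inverse limit pushes forward to the normalised counting
measures. -/
theorem measure_coord [∀ i, (S i).FiniteIndex] (μ : Measure (CosetLimit S))
    [IsProbabilityMeasure μ] [SMulInvariantMeasure Γ (CosetLimit S) μ] (i : ι) (y : Γ ⧸ S i) :
    μ {x | x.coord i = y} = ((S i).index : ℝ≥0∞)⁻¹ := by
  classical
  have hm : ∀ z : Γ ⧸ S i, MeasurableSet {x : CosetLimit S | x.coord i = z} := fun z =>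
    measurableSet_coord S i {z}
  have heq : ∀ z : Γ ⧸ S i, μ {x | x.coord i = z} = μ {x | x.coord i = y} := by
    intro z
    obtain ⟨g, rfl⟩ := MulAction.exists_smul_eq Γ z y
    rw [← measure_preimage_smul μ g {x : CosetLimit S | x.coord i = g • z}]
    congr 1
    ext x
    exact (smul_left_cancel_iff (α := Γ) (β := Γ ⧸ S i) g).symm
  have : Fintype (Γ ⧸ S i) := Fintype.ofFinite _
  have h1 : (1 : ℝ≥0∞) = ∑ z : Γ ⧸ S i, μ {x | x.coord i = z} := by
    rw [← measure_biUnion_finset (fun a _ b _ hab => ?_) (fun z _ => hm z)]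
    · rw [← measure_univ (μ := μ)]
      congr 1
      ext x
      simp
    · refine Set.disjoint_left.2 fun x (hx : x.coord i = a) (hx' : x.coord i = b) => ?_
      exact hab (hx.symm.trans hx')
  rw [Finset.sum_congr rfl (fun z _ => heq z), Finset.sum_const, Finset.card_univ,
    ← Nat.card_eq_fintype_card, nsmul_eq_mul] at h1
  rw [Subgroup.index]
  exact ENNReal.eq_inv_of_mul_eq_one_left (by rw [mul_comm]; exact h1.symm)

open ProfiniteGrp.ProfiniteCompletion in
theorem exists_invariant_measure [∀ i, (S i).FiniteIndex] :
    ∃ μ : Measure (CosetLimit S), IsProbabilityMeasure μ ∧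
      SMulInvariantMeasure Γ (CosetLimit S) μ := by
  let P := completion (GrpCat.of Γ)
  let : MeasurableSpace P := borel P
  have : BorelSpace P := ⟨rfl⟩
  let N : ι → FiniteIndexNormalSubgroup Γ := fun i =>
    FiniteIndexNormalSubgroup.ofSubgroup (S i).normalCore
  let φ : P → CosetLimit S := fun x =>
    { coord := fun i => Subgroup.quotientMapOfLE (Subgroup.normalCore_le (S i)) (x.1 (N i))
      compatible := fun i j h => by
        have hN : N j ≤ N i := Subgroup.normalCore_mono h
        have hx := x.2 hN.hom
        rw [← hx]
        generalize x.1 (N j) = q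
        induction q using QuotientGroup.induction_on with
        | H a => rfl }
  have hφ : Measurable φ := by
    refine measurable_of_coord S fun i A => ?_
    have hc : Continuous fun x : P => x.1 (N i) := (continuous_apply (N i)).comp continuous_subtype_val
    exact (@IsOpen.preimage P ((diagram (GrpCat.of Γ)).obj (N i)) _ _ _ hc
      (Subgroup.quotientMapOfLE (Subgroup.normalCore_le (S i)) ⁻¹' A) trivial).measurableSet
  have heq : ∀ (g : Γ) (x : P), φ (etaFn (GrpCat.of Γ) g * x) = g • φ x := by
    intro g x
    refine CosetLimit.ext (funext fun i => ?_)
    have key : ∀ q : Γ ⧸ (S i).normalCore,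
        Subgroup.quotientMapOfLE (Subgroup.normalCore_le (S i))
          ((QuotientGroup.mk g : Γ ⧸ (S i).normalCore) * q) =
        g • Subgroup.quotientMapOfLE (Subgroup.normalCore_le (S i)) q := fun q => by
      induction q using QuotientGroup.induction_on with
      | H a => rfl
    exact key (x.1 (N i))
  let μ₀ : Measure P := Measure.haarMeasure ⊤
  have : IsProbabilityMeasure μ₀ := ⟨Measure.haarMeasure_self⟩
  refine ⟨μ₀.map φ, Measure.isProbabilityMeasure_map hφ.aemeasurable, ⟨fun g A hA => ?_⟩⟩
  have hA' : MeasurableSet ((fun x : CosetLimit S => g • x) ⁻¹' A) := measurable_const_smul g hA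
  rw [Measure.map_apply hφ hA', Measure.map_apply hφ hA,
    ← measure_preimage_mul μ₀ (etaFn (GrpCat.of Γ) g) (φ ⁻¹' A)]
  congr 1
  ext x
  simp only [Set.mem_preimage, heq]

/-- The `Γ`-invariant probability measure on the inverse limit.  For a family of finite index
subgroups that is directed by inclusion it is unique: by `measure_coord` its push-forward to every
`Γ / S i` is the normalised counting measure. -/
def measure [∀ i, (S i).FiniteIndex] : Measure (CosetLimit S) :=
  (exists_invariant_measure S).choose

instance [∀ i, (S i).FiniteIndex] : IsProbabilityMeasure (measure S) :=
  (exists_invariant_measure S).choose_spec.1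

instance [∀ i, (S i).FiniteIndex] : SMulInvariantMeasure Γ (CosetLimit S) (measure S) :=
  (exists_invariant_measure S).choose_spec.2

end CosetLimit

/-- The directed system of all finite index subgroups of `Γ`.  The inverse limit of the coset spaces
over this system is the profinite completion of `Γ`, and its invariant probability measure is the
normalised Haar measure. -/
def finiteIndexSubgroups (Γ : Type u) [Group Γ] :
    {Λ : Subgroup Γ // Λ.FiniteIndex} → Subgroup Γ :=
  fun Λ => Λ.1

instance (Γ : Type u) [Group Γ] (Λ : {Λ : Subgroup Γ // Λ.FiniteIndex}) :
    (finiteIndexSubgroups Γ Λ).FiniteIndex :=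
  Λ.2

end

/-! Let `N` be the orbit space of the universal covering under a finite index subgroup `Λ`, and let
`X → Γ/Λ` be an equivariant map that pushes `μ` forward to the normalised counting measure
(`CosetFactor`). Sending a simplex of `N` to a lift, with coefficient the indicator function of the
fibre over the trivial coset, is a chain map `toParam` into the parametrised chains. It divides
norms by `[Γ : Λ]` (`l1Norm_toParam`), because all fibres have measure `1/[Γ : Λ]` and the simplices
of `N` correspond to pairs of an orbit of simplices upstairs and a coset. It sends the transfer of a
cycle of `M` to the image `1 ⊗ z` of that cycle, because the indicator functions of the fibres add
up to `1` (`toParam_sheetSum`). Hence `|M|^α ≤ ‖N‖_ℤ / [Γ : Λ]`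
(`OrbitCover.paramSimplicialVolume_le`).

Conversely, let `X` be the inverse limit of a directed system of coset spaces `Γ/S i`. Functions
that factor through one `Γ/S k` are `L¹`-dense (`exists_intNorm_step_sub_le`). If `c = 1 ⊗ z + ∂b`
is a parametrised fundamental cycle, replace the finitely many coefficients of `b` by step functions
on one `Γ/S k`. Since `∂` is bounded, `c` changes little in norm, and it becomes the image under
`toParam` of a cycle homologous to the transfer. So `|M|^α` is the infimum of the numbers `‖N i‖_ℤ /
[Γ : S i]` (`paramSimplicialVolume_cosetLimit_eq`).

The theorem follows by choosing the system. All finite index subgroups give the stable volume, since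
every finite connected covering is an orbit space (`exists_of_isCoveringMap`). A pair `Λ' ≤ Λ` gives
monotonicity under passage to smaller subgroups, so along a descending sequence the infimum is a
limit. Finally `|M|` is bounded by each term because the finite space `Γ/Λ` is itself a standard
`Γ`-space.

Both directions need that `‖N‖_ℤ` can be computed from the transfer of a fundamental cycle of `M`
(`OrbitCover.integralSimplicialVolume_eq`). The transfer generates all local homology groups
(`transfer_generates`), and on a closed connected manifold two cycles with this property are
homologous up to sign (`exists_boundary_eq_sub_or_add`). This rests on singular homology of
manifolds: small chains, Mayer–Vietoris, excision, the local homology of `ℝⁿ`, and detection of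
`H_n(X, X \ K)` at the points of a compact set `K`. -/

noncomputable section

open SingularChain

/-! ### Chains of tuples -/

/-- The free abelian group on the `(k + 1)`-tuples of points of `K`. -/
abbrev TupleChain (k : ℕ) (K : Type u) : Type u := (Fin (k + 1) → K) →₀ ℤ

namespace TupleChain

variable {K : Type u} {L : Type v} {J : Type w}

/-- The boundary operator on chains of tuples. -/
def boundary (k : ℕ) : TupleChain (k + 1) K →ₗ[ℤ] TupleChain k K :=
  Finsupp.linearCombination ℤ fun v : Fin (k + 2) → K =>
    ∑ i : Fin (k + 2), Finsupp.single (v ∘ i.succAbove) ((-1 : ℤ) ^ (i : ℕ))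

/-- The augmentation. -/
def augmentation : TupleChain 0 K →ₗ[ℤ] ℤ :=
  Finsupp.linearCombination ℤ fun _ => (1 : ℤ)

/-- The map induced by a map of vertices. -/
def map (k : ℕ) (f : K → L) : TupleChain k K →ₗ[ℤ] TupleChain k L :=
  Finsupp.lmapDomain ℤ ℤ fun v => f ∘ v

/-- The cone operator with apex `b`. -/
def cone (k : ℕ) (b : K) : TupleChain k K →ₗ[ℤ] TupleChain (k + 1) K :=
  Finsupp.lmapDomain ℤ ℤ fun v => (Fin.cons b v : Fin (k + 2) → K)

@[simp]
theorem map_single (k : ℕ) (f : K → L) (v : Fin (k + 1) → K) (a : ℤ) :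
    map k f (Finsupp.single v a) = Finsupp.single (f ∘ v) a := by
  simp [map, Finsupp.mapDomain_single]

@[simp]
theorem cone_single (k : ℕ) (b : K) (v : Fin (k + 1) → K) (a : ℤ) :
    cone k b (Finsupp.single v a) = Finsupp.single (Fin.cons b v : Fin (k + 2) → K) a := by
  simp [cone, Finsupp.mapDomain_single]

theorem boundary_single (k : ℕ) (v : Fin (k + 2) → K) (a : ℤ) :
    boundary k (Finsupp.single v a) =
      a • ∑ i : Fin (k + 2), Finsupp.single (v ∘ i.succAbove) ((-1 : ℤ) ^ (i : ℕ)) := by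
  simp [boundary]

@[simp]
theorem augmentation_single (v : Fin 1 → K) (a : ℤ) :
    augmentation (Finsupp.single v a) = a := by
  simp [augmentation]

theorem hom_ext {k : ℕ} {A : Type*} [AddCommGroup A] {f g : TupleChain k K →ₗ[ℤ] A}
    (h : ∀ v, f (Finsupp.single v 1) = g (Finsupp.single v 1)) : f = g :=
  Finsupp.lhom_ext' fun v => LinearMap.ext_ring (h v)

theorem map_map (k : ℕ) (f : K → L) (g : L → J) (c : TupleChain k K) :
    map k g (map k f c) = map k (g ∘ f) c := by
  rw [← LinearMap.comp_apply]
  refine congrArg (fun φ => φ c) (hom_ext (f := map k g ∘ₗ map k f) fun v => ?_)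
  simp [Function.comp_assoc]

theorem boundary_map (k : ℕ) (f : K → L) (c : TupleChain (k + 1) K) :
    boundary k (map (k + 1) f c) = map k f (boundary k c) := by
  have : boundary k ∘ₗ map (k + 1) f = map k f ∘ₗ boundary k := hom_ext fun v => by
    simp [boundary_single, Function.comp_assoc]
  exact LinearMap.congr_fun this c

theorem map_cone (k : ℕ) (f : K → L) (b : K) (c : TupleChain k K) :
    map (k + 1) f (cone k b c) = cone k (f b) (map k f c) := by
  have : map (k + 1) f ∘ₗ cone k b = cone k (f b) ∘ₗ map k f := hom_ext fun v => by
    simp [Fin.comp_cons]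
  exact LinearMap.congr_fun this c

theorem cons_comp_succAbove_succ {k : ℕ} (b : K) (v : Fin (k + 2) → K) (i : Fin (k + 2)) :
    (Fin.cons b v : Fin (k + 3) → K) ∘ i.succ.succAbove = Fin.cons b (v ∘ i.succAbove) := by
  funext j
  refine Fin.cases ?_ (fun j => ?_) j <;> simp

/-- Deleting the apex returns the tuple; deleting a later entry is the cone over a face, with the
sign shifted by one. -/
theorem boundary_cone (k : ℕ) (b : K) (c : TupleChain (k + 1) K) :
    boundary (k + 1) (cone (k + 1) b c) = c - cone k b (boundary k c) := by
  have : boundary (k + 1) ∘ₗ cone (k + 1) b =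
      LinearMap.id - cone k b ∘ₗ boundary k := hom_ext fun v => by
    simp only [LinearMap.comp_apply, LinearMap.sub_apply, LinearMap.id_apply, cone_single,
      boundary_single, one_smul]
    rw [Fin.sum_univ_succ]
    simp only [cons_comp_succAbove_succ, map_sum, cone_single, Fin.val_succ, pow_succ]
    simp [sub_eq_add_neg, Fin.cons_comp_succ]
  exact LinearMap.congr_fun this c

/-- In the lowest degree the face opposite to the old vertex is the apex itself, so the augmentation
takes the place of the missing boundary. -/
theorem boundary_cone_zero (b : K) (c : TupleChain 0 K) :
    boundary 0 (cone 0 b c) = c - Finsupp.single (fun _ => b) (augmentation c) := by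
  have : boundary 0 ∘ₗ cone 0 b =
      LinearMap.id - (Finsupp.lsingle (fun _ => b) : ℤ →ₗ[ℤ] TupleChain 0 K) ∘ₗ augmentation :=
    hom_ext fun v => by
      have h0 : (Fin.cons b v : Fin 2 → K) ∘ (Fin.succAbove 0) = v := by
        funext j; simp
      have h1 : (Fin.cons b v : Fin 2 → K) ∘ (Fin.succAbove 1) = fun _ => b := by
        funext j
        fin_cases j
        rfl
      rw [LinearMap.comp_apply, cone_single, boundary_single, one_smul]
      erw [Fin.sum_univ_two]
      rw [h0, h1]
      simp [sub_eq_add_neg]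
  exact LinearMap.congr_fun this c

theorem augmentation_boundary (c : TupleChain 1 K) : augmentation (boundary 0 c) = 0 := by
  have : augmentation ∘ₗ boundary 0 = (0 : TupleChain 1 K →ₗ[ℤ] ℤ) := hom_ext fun v => by
    simp [boundary_single, Fin.sum_univ_two]
  exact LinearMap.congr_fun this c

theorem augmentation_map (f : K → L) (c : TupleChain 0 K) :
    augmentation (map 0 f c) = augmentation c := by
  have : augmentation ∘ₗ map 0 f = (augmentation : TupleChain 0 K →ₗ[ℤ] ℤ) :=
    hom_ext fun v => by simp
  exact LinearMap.congr_fun this c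

theorem boundary_boundary (k : ℕ) (c : TupleChain (k + 2) K) :
    boundary k (boundary (k + 1) c) = 0 := by
  induction k with
  | zero =>
    have : boundary 0 ∘ₗ boundary 1 = (0 : TupleChain 2 K →ₗ[ℤ] _) := hom_ext fun v => by
      -- Every tuple is the cone from its first entry over the remaining ones, so the cone formula
      -- lowers the degree.
      have hv : (Finsupp.single v 1 : TupleChain 2 K) =
          cone 1 (v 0) (Finsupp.single (Fin.tail v) 1) := by simp
      rw [hv, LinearMap.comp_apply, boundary_cone, map_sub, boundary_cone_zero,
        augmentation_boundary]
      simp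
    exact LinearMap.congr_fun this c
  | succ k ih =>
    have : boundary (k + 1) ∘ₗ boundary (k + 2) = (0 : TupleChain (k + 3) K →ₗ[ℤ] _) :=
      hom_ext fun v => by
        have hv : (Finsupp.single v 1 : TupleChain (k + 3) K) =
            cone (k + 2) (v 0) (Finsupp.single (Fin.tail v) 1) := by simp
        rw [hv, LinearMap.comp_apply, boundary_cone, map_sub, boundary_cone, ih]
        simp
    exact LinearMap.congr_fun this c

/-- The homotopy between two chain maps `f`, `g` of tuples built by coning with apex `b v`. -/
def coneHomotopy (f g : ∀ k, TupleChain k K →ₗ[ℤ] TupleChain k L)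
    (b : ∀ k, (Fin (k + 1) → K) → L) : ∀ k, TupleChain k K →ₗ[ℤ] TupleChain (k + 1) L
  | 0 => Finsupp.linearCombination ℤ fun v =>
      cone 0 (b 0 v) (f 0 (Finsupp.single v 1) - g 0 (Finsupp.single v 1))
  | k + 1 => Finsupp.linearCombination ℤ fun v =>
      cone (k + 1) (b (k + 1) v) (f (k + 1) (Finsupp.single v 1) - g (k + 1) (Finsupp.single v 1) -
        coneHomotopy f g b k (boundary k (Finsupp.single v 1)))

section coneHomotopy

variable {f g : ∀ k, TupleChain k K →ₗ[ℤ] TupleChain k L} {b : ∀ k, (Fin (k + 1) → K) → L}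

theorem coneHomotopy_zero_single (v : Fin 1 → K) :
    coneHomotopy f g b 0 (Finsupp.single v 1) =
      cone 0 (b 0 v) (f 0 (Finsupp.single v 1) - g 0 (Finsupp.single v 1)) := by
  simp [coneHomotopy]

theorem coneHomotopy_succ_single (k : ℕ) (v : Fin (k + 2) → K) :
    coneHomotopy f g b (k + 1) (Finsupp.single v 1) =
      cone (k + 1) (b (k + 1) v) (f (k + 1) (Finsupp.single v 1) - g (k + 1) (Finsupp.single v 1) -
        coneHomotopy f g b k (boundary k (Finsupp.single v 1))) := by
  rw [coneHomotopy, Finsupp.linearCombination_single, one_smul]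

theorem boundary_coneHomotopy_zero
    (hε : ∀ c, augmentation (f 0 c) = augmentation (g 0 c)) (c : TupleChain 0 K) :
    boundary 0 (coneHomotopy f g b 0 c) = f 0 c - g 0 c := by
  have : boundary 0 ∘ₗ coneHomotopy f g b 0 = f 0 - g 0 := hom_ext fun v => by
    rw [LinearMap.comp_apply, coneHomotopy_zero_single, boundary_cone_zero, map_sub, hε, sub_self,
      Finsupp.single_zero, sub_zero, LinearMap.sub_apply]
  exact LinearMap.congr_fun this c

/-- The chain that is coned off, `f v - g v - h (∂ v)`, is a cycle by the formula one degree lower;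
the cone formula then has no second term. -/
theorem boundary_coneHomotopy
    (hε : ∀ c, augmentation (f 0 c) = augmentation (g 0 c))
    (hf : ∀ k c, boundary k (f (k + 1) c) = f k (boundary k c))
    (hg : ∀ k c, boundary k (g (k + 1) c) = g k (boundary k c)) (k : ℕ) :
    ∀ c : TupleChain (k + 1) K, boundary (k + 1) (coneHomotopy f g b (k + 1) c) =
      f (k + 1) c - g (k + 1) c - coneHomotopy f g b k (boundary k c) := by
  have main : ∀ k, (∀ v : Fin (k + 2) → K, boundary k (coneHomotopy f g b k
      (boundary k (Finsupp.single v 1))) = f k (boundary k (Finsupp.single v 1)) -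
      g k (boundary k (Finsupp.single v 1))) →
      ∀ c : TupleChain (k + 1) K, boundary (k + 1) (coneHomotopy f g b (k + 1) c) =
      f (k + 1) c - g (k + 1) c - coneHomotopy f g b k (boundary k c) := by
    intro k h c
    have : boundary (k + 1) ∘ₗ coneHomotopy f g b (k + 1) =
        f (k + 1) - g (k + 1) - coneHomotopy f g b k ∘ₗ boundary k := hom_ext fun v => by
      rw [LinearMap.comp_apply, coneHomotopy_succ_single, boundary_cone, map_sub (boundary k),
        map_sub (boundary k), hf, hg,
        h]
      simp only [LinearMap.sub_apply, LinearMap.comp_apply, sub_self, map_zero, sub_zero]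
    exact LinearMap.congr_fun this c
  induction k with
  | zero => exact main 0 fun v => boundary_coneHomotopy_zero hε _
  | succ k ih =>
    refine main (k + 1) fun v => ?_
    rw [ih, boundary_boundary, map_zero, sub_zero]

end coneHomotopy

/-- This naturality under maps of vertices is what allows homotopies constructed on affine chains to
be carried over to singular chains. -/
theorem map_coneHomotopy {K' : Type*} {L' : Type*}
    {f g : ∀ k, TupleChain k K →ₗ[ℤ] TupleChain k L} {b : ∀ k, (Fin (k + 1) → K) → L}
    {f' g' : ∀ k, TupleChain k K' →ₗ[ℤ] TupleChain k L'} {b' : ∀ k, (Fin (k + 1) → K') → L'}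
    (φ : K → K') (ψ : L → L')
    (hf : ∀ k c, map k ψ (f k c) = f' k (map k φ c))
    (hg : ∀ k c, map k ψ (g k c) = g' k (map k φ c))
    (hb : ∀ k v, ψ (b k v) = b' k (φ ∘ v)) (k : ℕ) (c : TupleChain k K) :
    map (k + 1) ψ (coneHomotopy f g b k c) = coneHomotopy f' g' b' k (map k φ c) := by
  induction k with
  | zero =>
    have : map 1 ψ ∘ₗ coneHomotopy f g b 0 = coneHomotopy f' g' b' 0 ∘ₗ map 0 φ :=
      hom_ext fun v => by
        simp only [LinearMap.comp_apply, coneHomotopy_zero_single, map_single, map_cone, map_sub,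
          hf, hg, hb]
    exact LinearMap.congr_fun this c
  | succ k ih =>
    have : map (k + 2) ψ ∘ₗ coneHomotopy f g b (k + 1) =
        coneHomotopy f' g' b' (k + 1) ∘ₗ map (k + 1) φ := hom_ext fun v => by
      simp only [LinearMap.comp_apply, coneHomotopy_succ_single, map_single, map_cone, map_sub,
        hf, hg, hb, ih, ← boundary_map]
    exact LinearMap.congr_fun this c

/-- Iterated coning from the points `b v`: the subdivision operator. -/
def subdivision (b : ∀ k, (Fin (k + 1) → K) → K) : ∀ k, TupleChain k K →ₗ[ℤ] TupleChain k K
  | 0 => LinearMap.id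
  | k + 1 => Finsupp.linearCombination ℤ fun v =>
      cone k (b (k + 1) v) (subdivision b k (boundary k (Finsupp.single v 1)))

section subdivision

variable {b : ∀ k, (Fin (k + 1) → K) → K}

theorem subdivision_succ_single (k : ℕ) (v : Fin (k + 2) → K) :
    subdivision b (k + 1) (Finsupp.single v 1) =
      cone k (b (k + 1) v) (subdivision b k (boundary k (Finsupp.single v 1))) := by
  rw [subdivision, Finsupp.linearCombination_single, one_smul]

/-- The boundary of the cone over `S (∂ v)` is `S (∂ v)` minus the cone over `∂ S (∂ v)`, and the
latter is `S (∂ ∂ v) = 0` by induction. -/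
theorem boundary_subdivision (k : ℕ) : ∀ c : TupleChain (k + 1) K,
    boundary k (subdivision b (k + 1) c) = subdivision b k (boundary k c) := by
  induction k with
  | zero =>
    intro c
    have : boundary 0 ∘ₗ subdivision b 1 = subdivision b 0 ∘ₗ boundary 0 := hom_ext fun v => by
      rw [LinearMap.comp_apply, subdivision_succ_single, boundary_cone_zero]
      simp [subdivision, augmentation_boundary]
    exact LinearMap.congr_fun this c
  | succ k ih =>
    intro c
    have : boundary (k + 1) ∘ₗ subdivision b (k + 2) = subdivision b (k + 1) ∘ₗ boundary (k + 1) :=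
      hom_ext fun v => by
        rw [LinearMap.comp_apply, subdivision_succ_single, boundary_cone, ih, boundary_boundary]
        simp
    exact LinearMap.congr_fun this c

theorem map_subdivision {b' : ∀ k, (Fin (k + 1) → L) → L} (φ : K → L)
    (hb : ∀ k v, φ (b k v) = b' k (φ ∘ v)) (k : ℕ) (c : TupleChain k K) :
    map k φ (subdivision b k c) = subdivision b' k (map k φ c) := by
  induction k with
  | zero => rfl
  | succ k ih =>
    have : map (k + 1) φ ∘ₗ subdivision b (k + 1) = subdivision b' (k + 1) ∘ₗ map (k + 1) φ :=
      hom_ext fun v => by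
        simp only [LinearMap.comp_apply, subdivision_succ_single, map_single, map_cone, hb, ih,
          ← boundary_map]
    exact LinearMap.congr_fun this c

end subdivision

end TupleChain

open SingularChain

/-! ### Affine simplices -/

/-- Spaces in which points can be combined with weights from a standard simplex. -/
class SimplexSpace (K : Type u) [TopologicalSpace K] where
  /-- The affine simplex with the given vertices. -/
  comb : ∀ {k : ℕ}, (Fin (k + 1) → K) → C(stdSimplex ℝ (Fin (k + 1)), K)
  comb_map : ∀ {j k : ℕ} (v : Fin (k + 1) → K) (f : Fin (j + 1) → Fin (k + 1))
    (t : stdSimplex ℝ (Fin (j + 1))), comb v (stdSimplex.map f t) = comb (v ∘ f) t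
  comb_const : ∀ {k : ℕ} (a : K) (t : stdSimplex ℝ (Fin (k + 1))), comb (fun _ => a) t = a

namespace SimplexSpace

theorem sum_map_smul {V : Type*} [AddCommGroup V] [Module ℝ V] {j k : ℕ}
    (v : Fin (k + 1) → V) (f : Fin (j + 1) → Fin (k + 1)) (t : stdSimplex ℝ (Fin (j + 1))) :
    ∑ i, stdSimplex.map f t i • v i = ∑ i, t i • v (f i) := by
  simp only [stdSimplex.map_coe, FunOnFinite.linearMap_apply_apply, Finset.sum_smul]
  rw [← Finset.sum_fiberwise Finset.univ f fun i => t i • v (f i)]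
  refine Finset.sum_congr rfl fun i _ => Finset.sum_congr rfl fun l hl => ?_
  rw [(Finset.mem_filter.1 hl).2]

instance (m : ℕ) : SimplexSpace (stdSimplex ℝ (Fin (m + 1))) where
  comb {k} v :=
    { toFun := fun t => ⟨∑ i, t i • (v i : Fin (m + 1) → ℝ),
        (convex_stdSimplex ℝ (Fin (m + 1))).sum_mem (fun i _ => t.2.1 i) t.2.2 fun i _ => (v i).2⟩
      continuous_toFun := by
        refine Continuous.subtype_mk (continuous_finsetSum _ fun i _ => ?_) _
        exact ((continuous_apply i).comp continuous_subtype_val).smul continuous_const }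
  comb_map v f t := Subtype.ext (sum_map_smul (fun i => (v i : Fin (m + 1) → ℝ)) f t)
  comb_const a t := Subtype.ext (by
    change ∑ i, t i • (a : Fin (m + 1) → ℝ) = a
    rw [← Finset.sum_smul, stdSimplex.sum_eq_one, one_smul])

instance {K : Type u} {L : Type v} [TopologicalSpace K] [TopologicalSpace L] [SimplexSpace K]
    [SimplexSpace L] : SimplexSpace (K × L) where
  comb v := (comb fun i => (v i).1).prodMk (comb fun i => (v i).2)
  comb_map _ f t := Prod.ext (comb_map _ f t) (comb_map _ f t)
  comb_const a t := Prod.ext (comb_const a.1 t) (comb_const a.2 t)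

section

variable {m : ℕ}

theorem coe_comb {k : ℕ} (v : Fin (k + 1) → stdSimplex ℝ (Fin (m + 1)))
    (t : stdSimplex ℝ (Fin (k + 1))) :
    (comb v t).1 = ∑ i, t i • (v i).1 := rfl

theorem comb_comb {j k : ℕ} (w : Fin (k + 1) → stdSimplex ℝ (Fin (m + 1)))
    (v : Fin (j + 1) → stdSimplex ℝ (Fin (k + 1))) (t : stdSimplex ℝ (Fin (j + 1))) :
    comb w (comb v t) = comb (comb w ∘ v) t := by
  refine Subtype.ext ?_
  rw [coe_comb, coe_comb]
  have : ∀ i, (comb v t : stdSimplex ℝ (Fin (k + 1))) i = ∑ l, t l • v l i := fun i => by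
    change (∑ l, t l • (v l : Fin (k + 1) → ℝ)) i = _
    simp only [Finset.sum_apply, Pi.smul_apply]
  simp only [this, Finset.sum_smul, Function.comp_apply, coe_comb, Finset.smul_sum]
  rw [Finset.sum_comm]
  simp only [smul_assoc]

theorem comb_vertex (t : stdSimplex ℝ (Fin (m + 1))) :
    comb (fun i => stdSimplex.vertex (S := ℝ) i) t = t := by
  refine Subtype.ext ?_
  rw [coe_comb]
  funext j
  simp [Finset.sum_apply, Pi.single_apply]
  rfl

theorem comb_apply_vertex {k : ℕ} (v : Fin (k + 1) → stdSimplex ℝ (Fin (m + 1))) (i : Fin (k + 1)) :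
    comb v (stdSimplex.vertex (S := ℝ) i) = v i := by
  refine Subtype.ext ?_
  rw [coe_comb, Finset.sum_eq_single i]
  · simp
  · intro j _ hj
    simp [hj]
  · simp

end

end SimplexSpace

open SimplexSpace

/-- The singular chain of affine simplices given by a chain of tuples. -/
def TupleChain.realize {K : Type u} [TopologicalSpace K] [SimplexSpace K] (k : ℕ) :
    TupleChain k K →ₗ[ℤ] SingularChain k K :=
  Finsupp.lmapDomain ℤ ℤ fun v => comb v

namespace TupleChain

variable {K : Type u} [TopologicalSpace K] [SimplexSpace K]
  {L : Type v} [TopologicalSpace L] [SimplexSpace L]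

@[simp]
theorem realize_single (k : ℕ) (v : Fin (k + 1) → K) (a : ℤ) :
    realize k (Finsupp.single v a) = Finsupp.single (comb v) a := by
  simp [realize, Finsupp.mapDomain_single]

theorem face_comb {k : ℕ} (v : Fin (k + 2) → K) (i : Fin (k + 2)) :
    SingularChain.face i (comb v) = comb (v ∘ i.succAbove) :=
  ContinuousMap.ext fun t => comb_map v _ t

theorem boundary_realize (k : ℕ) (c : TupleChain (k + 1) K) :
    SingularChain.boundary k (realize (k + 1) c) = realize k (boundary k c) := by
  have : SingularChain.boundary k ∘ₗ realize (k + 1) =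
      (realize k ∘ₗ boundary k : TupleChain (k + 1) K →ₗ[ℤ] _) := hom_ext fun v => by
    simp [boundary_single, SingularChain.boundary, face_comb]
  exact LinearMap.congr_fun this c

theorem map_realize (k : ℕ) (φ : C(K, L))
    (hφ : ∀ (v : Fin (k + 1) → K) t, φ (comb v t) = comb (φ ∘ v) t) (c : TupleChain k K) :
    SingularChain.map k φ (realize k c) = realize k (map k φ c) := by
  have : SingularChain.map k φ ∘ₗ realize k = realize k ∘ₗ map k φ := hom_ext fun v => by
    have h : φ.comp (comb v) = comb (φ ∘ v) := ContinuousMap.ext (hφ v)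
    simp [SingularChain.map, Finsupp.mapDomain_single, h]
  exact LinearMap.congr_fun this c

end TupleChain

/-! ### Natural operators on singular chains, defined on model simplices. -/

namespace SingularChain

variable {X : Type u} [TopologicalSpace X] {Y : Type v} [TopologicalSpace Y]
  {Z : Type w} [TopologicalSpace Z]

@[simp]
theorem map_single (k : ℕ) (f : C(X, Y)) (σ : SingularSimplex k X) (a : ℤ) :
    map k f (Finsupp.single σ a) = Finsupp.single (f.comp σ) a := by
  simp [map, Finsupp.mapDomain_single]

theorem boundary_single (k : ℕ) (σ : SingularSimplex (k + 1) X) (a : ℤ) :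
    boundary k (Finsupp.single σ a) =
      a • ∑ i : Fin (k + 2), Finsupp.single (face i σ) ((-1 : ℤ) ^ (i : ℕ)) := by
  simp [boundary]

theorem hom_ext {k : ℕ} {A : Type*} [AddCommGroup A] {f g : SingularChain k X →ₗ[ℤ] A}
    (h : ∀ σ, f (Finsupp.single σ 1) = g (Finsupp.single σ 1)) : f = g :=
  Finsupp.lhom_ext' fun v => LinearMap.ext_ring (h v)

theorem map_map (k : ℕ) (f : C(X, Y)) (g : C(Y, Z)) (c : SingularChain k X) :
    map k g (map k f c) = map k (g.comp f) c := by
  have : map k g ∘ₗ map k f = map k (g.comp f) := hom_ext fun v => by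
    simp [ContinuousMap.comp_assoc]
  exact LinearMap.congr_fun this c

theorem map_id (k : ℕ) (c : SingularChain k X) : map k (ContinuousMap.id X) c = c := by
  have : map k (ContinuousMap.id X) = LinearMap.id := hom_ext fun v => by simp
  exact LinearMap.congr_fun this c

/-- The fundamental tuple of vertices of the standard simplex. -/
def vertices (k : ℕ) : TupleChain k (stdSimplex ℝ (Fin (k + 1))) :=
  Finsupp.single (fun i => stdSimplex.vertex (S := ℝ) i) 1

/-- A singular simplex is its own image of the affine identity simplex. Identities between natural
operators therefore need to be checked on affine chains only. -/
theorem map_realize_vertices (k : ℕ) (σ : SingularSimplex k X) :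
    map k σ (TupleChain.realize k (vertices k)) = Finsupp.single σ 1 := by
  have : (comb fun i => stdSimplex.vertex (S := ℝ) i) =
      ContinuousMap.id (stdSimplex ℝ (Fin (k + 1))) := ContinuousMap.ext comb_vertex
  simp [vertices, this]

theorem boundary_boundary (k : ℕ) (c : SingularChain (k + 2) X) :
    boundary k (boundary (k + 1) c) = 0 := by
  have : boundary k ∘ₗ boundary (k + 1) = (0 : SingularChain (k + 2) X →ₗ[ℤ] _) :=
    hom_ext fun σ => by
      rw [LinearMap.comp_apply, ← map_realize_vertices, boundary_map, boundary_map,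
        TupleChain.boundary_realize, TupleChain.boundary_realize, TupleChain.boundary_boundary,
        map_zero, map_zero, LinearMap.zero_apply]
  exact LinearMap.congr_fun this c

/-- The operator on singular chains given by a chain in the model simplex. -/
def modelOperator {k l : ℕ} (q : TupleChain l (stdSimplex ℝ (Fin (k + 1)))) :
    SingularChain k X →ₗ[ℤ] SingularChain l X :=
  Finsupp.linearCombination ℤ fun σ => map l σ (TupleChain.realize l q)

theorem modelOperator_single {k l : ℕ} (q : TupleChain l (stdSimplex ℝ (Fin (k + 1))))
    (σ : SingularSimplex k X) :
    modelOperator q (Finsupp.single σ 1) = map l σ (TupleChain.realize l q) := by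
  simp [modelOperator]

/-- The affine simplex on `v` is the image of the model simplex under `comb v`, and `Q` commutes
with `comb v`. So the operator determined by the single value of `Q` on the vertices agrees with `Q`
on all affine chains inside a simplex. -/
theorem modelOperator_realize {k l m : ℕ}
    (Q : ∀ m, TupleChain k (stdSimplex ℝ (Fin (m + 1))) →ₗ[ℤ]
      TupleChain l (stdSimplex ℝ (Fin (m + 1))))
    (hQ : ∀ {m m' : ℕ} (v : Fin (m + 1) → stdSimplex ℝ (Fin (m' + 1))) c,
      TupleChain.map l (comb v) (Q m c) = Q m' (TupleChain.map k (comb v) c))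
    (τ : SingularSimplex m X) (c : TupleChain k (stdSimplex ℝ (Fin (m + 1)))) :
    modelOperator (Q k (vertices k)) (map k τ (TupleChain.realize k c)) =
      map l τ (TupleChain.realize l (Q m c)) := by
  have : modelOperator (Q k (vertices k)) ∘ₗ map k τ ∘ₗ TupleChain.realize k =
      map l τ ∘ₗ TupleChain.realize l ∘ₗ Q m := TupleChain.hom_ext fun v => by
    simp only [LinearMap.comp_apply, TupleChain.realize_single, map_single, modelOperator_single]
    rw [← map_map, TupleChain.map_realize l (comb v) (fun w t => comb_comb v w t), hQ]
    congr 4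
    rw [vertices, TupleChain.map_single]
    congr 1
    funext i
    exact comb_apply_vertex v i
  exact LinearMap.congr_fun this c

/-! ### Subdivision of singular chains -/

/-- Barycenters of tuples of points. -/
def tupleBarycenter {K : Type u} [TopologicalSpace K] [SimplexSpace K] (k : ℕ)
    (v : Fin (k + 1) → K) : K :=
  comb v stdSimplex.barycenter

/-- Barycentric subdivision of affine chains in a standard simplex. -/
abbrev affineSubdivision (k m : ℕ) : TupleChain k (stdSimplex ℝ (Fin (m + 1))) →ₗ[ℤ]
    TupleChain k (stdSimplex ℝ (Fin (m + 1))) :=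
  TupleChain.subdivision tupleBarycenter k

/-- The homotopy from the identity to barycentric subdivision for affine chains. -/
abbrev affineSubdivisionHomotopy (k m : ℕ) : TupleChain k (stdSimplex ℝ (Fin (m + 1))) →ₗ[ℤ]
    TupleChain (k + 1) (stdSimplex ℝ (Fin (m + 1))) :=
  TupleChain.coneHomotopy (fun _ => LinearMap.id) (TupleChain.subdivision tupleBarycenter)
    tupleBarycenter k

theorem comb_tupleBarycenter {m m' : ℕ} (v : Fin (m + 1) → stdSimplex ℝ (Fin (m' + 1))) (k : ℕ)
    (w : Fin (k + 1) → stdSimplex ℝ (Fin (m + 1))) :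
    comb v (tupleBarycenter k w) = tupleBarycenter k (comb v ∘ w) :=
  comb_comb _ _ _

theorem map_affineSubdivision {k m m' : ℕ} (v : Fin (m + 1) → stdSimplex ℝ (Fin (m' + 1)))
    (c : TupleChain k (stdSimplex ℝ (Fin (m + 1)))) :
    TupleChain.map k (comb v) (affineSubdivision k m c) =
      affineSubdivision k m' (TupleChain.map k (comb v) c) :=
  TupleChain.map_subdivision _ (comb_tupleBarycenter v) k c

theorem map_affineSubdivisionHomotopy {k m m' : ℕ}
    (v : Fin (m + 1) → stdSimplex ℝ (Fin (m' + 1)))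
    (c : TupleChain k (stdSimplex ℝ (Fin (m + 1)))) :
    TupleChain.map (k + 1) (comb v) (affineSubdivisionHomotopy k m c) =
      affineSubdivisionHomotopy k m' (TupleChain.map k (comb v) c) :=
  TupleChain.map_coneHomotopy (comb v) (comb v) (fun _ _ => rfl)
    (fun _ c => map_affineSubdivision v c) (comb_tupleBarycenter v) k c

/-- Barycentric subdivision of singular chains. -/
def subdivision (k : ℕ) : SingularChain k X →ₗ[ℤ] SingularChain k X :=
  modelOperator (affineSubdivision k k (vertices k))

/-- The homotopy from the identity to barycentric subdivision. -/
def subdivisionHomotopy (k : ℕ) : SingularChain k X →ₗ[ℤ] SingularChain (k + 1) X :=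
  modelOperator (affineSubdivisionHomotopy k k (vertices k))

theorem subdivision_realize {k m : ℕ} (τ : SingularSimplex m X)
    (c : TupleChain k (stdSimplex ℝ (Fin (m + 1)))) :
    subdivision k (map k τ (TupleChain.realize k c)) =
      map k τ (TupleChain.realize k (affineSubdivision k m c)) :=
  modelOperator_realize (fun m => affineSubdivision k m) map_affineSubdivision τ c

theorem subdivisionHomotopy_realize {k m : ℕ} (τ : SingularSimplex m X)
    (c : TupleChain k (stdSimplex ℝ (Fin (m + 1)))) :
    subdivisionHomotopy k (map k τ (TupleChain.realize k c)) =
      map (k + 1) τ (TupleChain.realize (k + 1) (affineSubdivisionHomotopy k m c)) :=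
  modelOperator_realize (fun m => affineSubdivisionHomotopy k m) map_affineSubdivisionHomotopy τ c

theorem boundary_subdivision (k : ℕ) (c : SingularChain (k + 1) X) :
    boundary k (subdivision (k + 1) c) = subdivision k (boundary k c) := by
  have : boundary k ∘ₗ subdivision (k + 1) = (subdivision k ∘ₗ boundary k :
      SingularChain (k + 1) X →ₗ[ℤ] _) := hom_ext fun σ => by
    rw [LinearMap.comp_apply, LinearMap.comp_apply, ← map_realize_vertices, subdivision_realize,
      boundary_map, boundary_map, TupleChain.boundary_realize, TupleChain.boundary_realize,
      subdivision_realize, TupleChain.boundary_subdivision]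
  exact LinearMap.congr_fun this c

theorem boundary_subdivisionHomotopy_zero (c : SingularChain 0 X) :
    boundary 0 (subdivisionHomotopy 0 c) = c - subdivision 0 c := by
  have : boundary 0 ∘ₗ subdivisionHomotopy 0 = (LinearMap.id - subdivision 0 :
      SingularChain 0 X →ₗ[ℤ] _) := hom_ext fun σ => by
    rw [LinearMap.comp_apply, LinearMap.sub_apply, LinearMap.id_apply, ← map_realize_vertices,
      subdivision_realize, subdivisionHomotopy_realize, boundary_map, TupleChain.boundary_realize,
      TupleChain.boundary_coneHomotopy_zero (f := fun _ => LinearMap.id) (fun _ => rfl),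
      map_sub, map_sub]
    rfl
  exact LinearMap.congr_fun this c

theorem boundary_subdivisionHomotopy (k : ℕ) (c : SingularChain (k + 1) X) :
    boundary (k + 1) (subdivisionHomotopy (k + 1) c) =
      c - subdivision (k + 1) c - subdivisionHomotopy k (boundary k c) := by
  have : boundary (k + 1) ∘ₗ subdivisionHomotopy (k + 1) =
      (LinearMap.id - subdivision (k + 1) - subdivisionHomotopy k ∘ₗ boundary k :
      SingularChain (k + 1) X →ₗ[ℤ] _) := hom_ext fun σ => by
    rw [LinearMap.comp_apply, LinearMap.sub_apply, LinearMap.sub_apply, LinearMap.id_apply,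
      LinearMap.comp_apply, ← map_realize_vertices,
      subdivision_realize, subdivisionHomotopy_realize, boundary_map, boundary_map,
      TupleChain.boundary_realize, TupleChain.boundary_realize, subdivisionHomotopy_realize,
      TupleChain.boundary_coneHomotopy (f := fun _ => LinearMap.id) (fun _ => rfl) (fun _ _ => rfl)
        (fun k c => TupleChain.boundary_subdivision k c), map_sub, map_sub, map_sub, map_sub]
    rfl
  exact LinearMap.congr_fun this c

/-! ### The prism operator -/

/-- The model of the unit interval used for homotopies. -/
abbrev _root_.SimplexInterval : Type := stdSimplex ℝ (Fin 2)

/-- The inclusion of an end of a cylinder. -/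
def cylinderEnd (X : Type u) [TopologicalSpace X] (i : Fin 2) : C(X, X × SimplexInterval) :=
  (ContinuousMap.id X).prodMk (ContinuousMap.const X (stdSimplex.vertex (S := ℝ) i))

/-- The prism operator for affine chains. -/
abbrev affinePrism (k m : ℕ) : TupleChain k (stdSimplex ℝ (Fin (m + 1))) →ₗ[ℤ]
    TupleChain (k + 1) (stdSimplex ℝ (Fin (m + 1)) × SimplexInterval) :=
  TupleChain.coneHomotopy (fun k => TupleChain.map k (cylinderEnd _ 1))
    (fun k => TupleChain.map k (cylinderEnd _ 0)) (fun _ v => cylinderEnd _ 0 (v 0)) k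

/-- The prism operator. -/
def prism (k : ℕ) : SingularChain k X →ₗ[ℤ] SingularChain (k + 1) (X × SimplexInterval) :=
  Finsupp.linearCombination ℤ fun σ : SingularSimplex k X =>
    map (k + 1) (σ.prodMap (ContinuousMap.id SimplexInterval))
      (TupleChain.realize (k + 1) (affinePrism k k (vertices k)))

theorem prism_single {k : ℕ} (σ : SingularSimplex k X) :
    prism k (Finsupp.single σ 1) = map (k + 1) (σ.prodMap (ContinuousMap.id SimplexInterval))
      (TupleChain.realize (k + 1) (affinePrism k k (vertices k))) := by
  simp [prism]

theorem map_affinePrism {k m m' : ℕ} (v : Fin (m + 1) → stdSimplex ℝ (Fin (m' + 1)))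
    (c : TupleChain k (stdSimplex ℝ (Fin (m + 1)))) :
    TupleChain.map (k + 1) ((comb v).prodMap (ContinuousMap.id SimplexInterval))
      (affinePrism k m c) = affinePrism k m' (TupleChain.map k (comb v) c) :=
  TupleChain.map_coneHomotopy (comb v) _
    (fun k c => by rw [TupleChain.map_map, TupleChain.map_map]; rfl)
    (fun k c => by rw [TupleChain.map_map, TupleChain.map_map]; rfl)
    (fun _ _ => rfl) k c

theorem prism_realize {k m : ℕ} (τ : SingularSimplex m X)
    (c : TupleChain k (stdSimplex ℝ (Fin (m + 1)))) :
    prism k (map k τ (TupleChain.realize k c)) =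
      map (k + 1) (τ.prodMap (ContinuousMap.id SimplexInterval))
        (TupleChain.realize (k + 1) (affinePrism k m c)) := by
  have : prism k ∘ₗ map k τ ∘ₗ TupleChain.realize k =
      map (k + 1) (τ.prodMap (ContinuousMap.id SimplexInterval)) ∘ₗ
        TupleChain.realize (k + 1) ∘ₗ affinePrism k m := TupleChain.hom_ext fun v => by
    simp only [LinearMap.comp_apply, TupleChain.realize_single, map_single, prism_single]
    have h : (τ.comp (comb v)).prodMap (ContinuousMap.id SimplexInterval) =
        (τ.prodMap (ContinuousMap.id SimplexInterval)).comp
          ((comb v).prodMap (ContinuousMap.id SimplexInterval)) := rfl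
    rw [h, ← map_map, TupleChain.map_realize, map_affinePrism]
    · congr 4
      rw [vertices, TupleChain.map_single]
      congr 1
      funext i
      exact comb_apply_vertex v i
    · exact fun w t => Prod.ext (comb_comb _ _ _) rfl
  exact LinearMap.congr_fun this c

theorem map_cylinderEnd_realize {k : ℕ} (i : Fin 2) (σ : SingularSimplex k X) :
    map k (σ.prodMap (ContinuousMap.id SimplexInterval))
      (TupleChain.realize k (TupleChain.map k (cylinderEnd _ i) (vertices k))) =
      map k (cylinderEnd X i) (Finsupp.single σ 1) := by
  rw [← TupleChain.map_realize, map_map, ← map_realize_vertices, map_map]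
  · rfl
  -- The inclusion of an end of the cylinder is affine because a constant tuple spans a constant
  -- simplex.
  · exact fun v t => Prod.ext rfl (comb_const _ _).symm

theorem boundary_prism_zero (c : SingularChain 0 X) :
    boundary 0 (prism 0 c) = map 0 (cylinderEnd X 1) c - map 0 (cylinderEnd X 0) c := by
  have : boundary 0 ∘ₗ prism 0 = map 0 (cylinderEnd X 1) - map 0 (cylinderEnd X 0) :=
    hom_ext fun σ => by
      rw [LinearMap.comp_apply, LinearMap.sub_apply, ← map_cylinderEnd_realize,
        ← map_cylinderEnd_realize, prism_single, boundary_map, TupleChain.boundary_realize,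
        TupleChain.boundary_coneHomotopy_zero, map_sub, map_sub]
      intro c
      rw [TupleChain.augmentation_map, TupleChain.augmentation_map]
  exact LinearMap.congr_fun this c

theorem boundary_prism (k : ℕ) (c : SingularChain (k + 1) X) :
    boundary (k + 1) (prism (k + 1) c) =
      map (k + 1) (cylinderEnd X 1) c - map (k + 1) (cylinderEnd X 0) c -
        prism k (boundary k c) := by
  have : boundary (k + 1) ∘ₗ prism (k + 1) =
      map (k + 1) (cylinderEnd X 1) - map (k + 1) (cylinderEnd X 0) - prism k ∘ₗ boundary k :=
    hom_ext fun σ => by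
      have h2 : prism k (boundary k (Finsupp.single σ 1)) =
          map (k + 1) (σ.prodMap (ContinuousMap.id SimplexInterval))
            (TupleChain.realize (k + 1) (affinePrism k (k + 1)
              (TupleChain.boundary k (vertices (k + 1))))) := by
        rw [← prism_realize, ← TupleChain.boundary_realize, ← boundary_map, map_realize_vertices]
      rw [LinearMap.comp_apply, LinearMap.sub_apply, LinearMap.sub_apply, LinearMap.comp_apply, h2,
        ← map_cylinderEnd_realize, ← map_cylinderEnd_realize, prism_single, boundary_map,
        TupleChain.boundary_realize, TupleChain.boundary_coneHomotopy, map_sub, map_sub, map_sub,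
        map_sub]
      · intro c
        rw [TupleChain.augmentation_map, TupleChain.augmentation_map]
      · exact fun k c => TupleChain.boundary_map k _ c
      · exact fun k c => TupleChain.boundary_map k _ c
  exact LinearMap.congr_fun this c

end SingularChain

open SingularChain SimplexSpace

/-! ### Small chains -/

theorem Finsupp.apply_mem_of_mem_supported {α : Type*} {A : Type*} [AddCommGroup A]
    (f : (α →₀ ℤ) →ₗ[ℤ] A) (P : Submodule ℤ A) {s : Set α}
    (h : ∀ a ∈ s, f (Finsupp.single a 1) ∈ P) {c : α →₀ ℤ} (hc : c ∈ Finsupp.supported ℤ ℤ s) :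
    f c ∈ P := by
  rw [Finsupp.supported_eq_span_single] at hc
  have : Submodule.span ℤ ((fun i => Finsupp.single i (1 : ℤ)) '' s) ≤ P.comap f := by
    rw [Submodule.span_le]
    rintro _ ⟨a, ha, rfl⟩
    exact h a ha
  exact this hc

namespace SingularChain

variable {X : Type u} [TopologicalSpace X] {Y : Type v} [TopologicalSpace Y]

theorem single_mem_chainsIn {A : Set X} {k : ℕ} {σ : SingularSimplex k X} (h : Set.range σ ⊆ A)
    (a : ℤ) : (Finsupp.single σ a : SingularChain k X) ∈ chainsIn A k :=
  Finsupp.single_mem_supported ℤ a h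

theorem chainsIn_mono {A B : Set X} (h : A ⊆ B) (k : ℕ) : chainsIn A k ≤ chainsIn B k :=
  Finsupp.supported_mono fun _ hσ => hσ.trans h

theorem chainsIn_univ (k : ℕ) : chainsIn (Set.univ : Set X) k = ⊤ := by
  simp [chainsIn]

theorem mem_chainsIn_inter {A B : Set X} {k : ℕ} {c : SingularChain k X} (hA : c ∈ chainsIn A k)
    (hB : c ∈ chainsIn B k) : c ∈ chainsIn (A ∩ B) k := by
  rw [chainsIn, Finsupp.mem_supported] at *
  exact fun σ hσ => Set.subset_inter (hA hσ) (hB hσ)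

theorem boundary_mem_chainsIn {A : Set X} {k : ℕ} {c : SingularChain (k + 1) X}
    (hc : c ∈ chainsIn A (k + 1)) : boundary k c ∈ chainsIn A k := by
  refine Finsupp.apply_mem_of_mem_supported _ _ (fun σ hσ => ?_) hc
  rw [boundary_single, one_smul]
  refine Submodule.sum_mem _ fun i _ => single_mem_chainsIn ?_ _
  rintro _ ⟨t, rfl⟩
  exact hσ ⟨_, rfl⟩

theorem boundaryFrom_mem_chainsIn {A : Set X} {k : ℕ} {c : SingularChain k X}
    (hc : c ∈ chainsIn A k) : boundaryFrom k c ∈ chainsIn A (k - 1) := by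
  cases k with
  | zero => exact Submodule.zero_mem _
  | succ k => exact boundary_mem_chainsIn hc

theorem map_mem_chainsIn {A : Set X} {B : Set Y} {k : ℕ} {f : C(X, Y)} (hf : Set.MapsTo f A B)
    {c : SingularChain k X} (hc : c ∈ chainsIn A k) : map k f c ∈ chainsIn B k := by
  refine Finsupp.apply_mem_of_mem_supported _ _ (fun σ hσ => ?_) hc
  rw [map_single]
  refine single_mem_chainsIn ?_ _
  rintro _ ⟨t, rfl⟩
  exact hf (hσ ⟨t, rfl⟩)

theorem modelOperator_mem_chainsIn {A : Set X} {k l : ℕ}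
    (q : TupleChain l (stdSimplex ℝ (Fin (k + 1)))) {c : SingularChain k X}
    (hc : c ∈ chainsIn A k) : modelOperator q c ∈ chainsIn A l := by
  refine Finsupp.apply_mem_of_mem_supported _ _ (fun σ hσ => ?_) hc
  rw [modelOperator_single]
  refine map_mem_chainsIn (A := Set.univ) (fun t _ => hσ ⟨t, rfl⟩) ?_
  rw [chainsIn_univ]
  trivial

theorem prism_mem_chainsIn {A : Set X} {k : ℕ} {c : SingularChain k X} (hc : c ∈ chainsIn A k) :
    prism k c ∈ chainsIn (A ×ˢ Set.univ) (k + 1) := by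
  refine Finsupp.apply_mem_of_mem_supported _ _ (fun σ hσ => ?_) hc
  rw [prism_single]
  refine map_mem_chainsIn (A := Set.univ) (B := A ×ˢ Set.univ)
    (fun t _ => Set.mk_mem_prod (hσ ⟨t.1, rfl⟩) (Set.mem_univ _)) ?_
  rw [chainsIn_univ]
  trivial

theorem boundaryFrom_boundary (k : ℕ) (c : SingularChain (k + 1) X) :
    boundaryFrom k (boundary k c) = 0 := by
  cases k with
  | zero => rfl
  | succ k => exact boundary_boundary k c

theorem boundaryFrom_map (k : ℕ) (f : C(X, Y)) (c : SingularChain k X) :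
    boundaryFrom k (map k f c) = map (k - 1) f (boundaryFrom k c) := by
  cases k with
  | zero => simp [boundaryFrom]
  | succ k => exact boundary_map k f c

/-- Sums of a chain in `U` and a chain in `V`. -/
def smallChains (U V : Set X) (k : ℕ) : Submodule ℤ (SingularChain k X) :=
  chainsIn U k ⊔ chainsIn V k

theorem smallChains_le_chainsIn (U V : Set X) (k : ℕ) :
    smallChains U V k ≤ chainsIn (U ∪ V) k :=
  sup_le (chainsIn_mono Set.subset_union_left k) (chainsIn_mono Set.subset_union_right k)

theorem modelOperator_mem_smallChains {U V : Set X} {k l : ℕ}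
    (q : TupleChain l (stdSimplex ℝ (Fin (k + 1)))) {c : SingularChain k X}
    (hc : c ∈ smallChains U V k) : modelOperator q c ∈ smallChains U V l := by
  obtain ⟨a, ha, b, hb, rfl⟩ := Submodule.mem_sup.1 hc
  rw [map_add]
  exact Submodule.add_mem_sup (modelOperator_mem_chainsIn q ha) (modelOperator_mem_chainsIn q hb)

end SingularChain

/-! ### The mesh of a subdivision -/

section Mesh

variable {m : ℕ}

/-- Closed balls are convex. -/
theorem dist_comb_le {k : ℕ} (v : Fin (k + 1) → stdSimplex ℝ (Fin (m + 1)))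
    (x : stdSimplex ℝ (Fin (m + 1))) {r : ℝ} (h : ∀ i, dist x (v i) ≤ r)
    (t : stdSimplex ℝ (Fin (k + 1))) : dist x (comb v t) ≤ r := by
  have : (comb v t).1 ∈ Metric.closedBall x.1 r :=
    (convex_closedBall x.1 r).sum_mem (fun i _ => t.2.1 i) t.2.2 fun i _ => by
      rw [Metric.mem_closedBall, dist_comm]
      exact h i
  rw [Metric.mem_closedBall, dist_comm] at this
  exact this

/-- The difference of the barycenter and `v j` is the mean of the `k + 2` differences `v i - v j`,
one of which is zero; this produces the factor `(k + 1) / (k + 2)`. -/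
theorem dist_tupleBarycenter_le {k : ℕ} (v : Fin (k + 2) → stdSimplex ℝ (Fin (m + 1))) {δ : ℝ}
    (h : ∀ i j, dist (v i) (v j) ≤ δ) (j : Fin (k + 2)) :
    dist (tupleBarycenter (k + 1) v) (v j) ≤ (k + 1) / (k + 2) * δ := by
  have hk : (0 : ℝ) < k + 2 := by positivity
  have h1 : (tupleBarycenter (k + 1) v).1 - (v j).1 =
      ∑ i, ((k : ℝ) + 2)⁻¹ • ((v i).1 - (v j).1) := by
    have : (tupleBarycenter (k + 1) v).1 = ∑ i, ((k : ℝ) + 2)⁻¹ • (v i).1 := by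
      rw [tupleBarycenter, coe_comb]
      refine Finset.sum_congr rfl fun i _ => ?_
      congr 1
      change (stdSimplex.barycenter (𝕜 := ℝ) (X := Fin (k + 2))).val i = _
      rw [stdSimplex.barycenter_apply, Fintype.card_fin]
      push_cast
      rfl
    rw [this]
    simp only [smul_sub, Finset.sum_sub_distrib, Finset.sum_const, Finset.card_univ,
      Fintype.card_fin]
    congr 1
    rw [← Nat.cast_smul_eq_nsmul ℝ, smul_smul]
    push_cast
    rw [mul_inv_cancel₀ hk.ne', one_smul]
  rw [Subtype.dist_eq, dist_eq_norm, h1]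
  calc ‖∑ i, ((k : ℝ) + 2)⁻¹ • ((v i).1 - (v j).1)‖
      ≤ ∑ i, ((k : ℝ) + 2)⁻¹ * dist (v i) (v j) := by
        refine (norm_sum_le _ _).trans (Finset.sum_le_sum fun i _ => ?_)
        rw [norm_smul, Real.norm_of_nonneg (by positivity), Subtype.dist_eq, dist_eq_norm]
    _ = ((k : ℝ) + 2)⁻¹ * ∑ i : Fin (k + 1), dist (v (j.succAbove i)) (v j) := by
        rw [← Finset.mul_sum, Fin.sum_univ_succAbove _ j, dist_self, zero_add]
    _ ≤ ((k : ℝ) + 2)⁻¹ * ∑ i : Fin (k + 1), δ := by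
        gcongr with i
        exact h _ _
    _ = _ := by
        simp only [Finset.sum_const, Finset.card_univ, Fintype.card_fin, nsmul_eq_mul]
        push_cast
        field_simp

/-- The new apex is within `(k + 1) / (k + 2) * δ` of the whole hull of `v`, which is why the
induction also records that the vertices stay in the hull. Edges not meeting the apex come from a
face and satisfy a better bound, as `k / (k + 1)` increases with `k`. -/
theorem affineSubdivision_single_mem (k : ℕ) (v : Fin (k + 1) → stdSimplex ℝ (Fin (m + 1)))
    {δ : ℝ} (h : ∀ i j, dist (v i) (v j) ≤ δ) :
    affineSubdivision k m (Finsupp.single v 1) ∈ Finsupp.supported ℤ ℤ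
      {w | (∀ i, ∃ t, w i = comb v t) ∧ ∀ i j, dist (w i) (w j) ≤ (k : ℝ) / (k + 1) * δ} := by
  induction k with
  | zero =>
    refine Finsupp.single_mem_supported ℤ _ ⟨fun i => ⟨_, (comb_apply_vertex v i).symm⟩, ?_⟩
    intro i j
    rw [show i = j from Fin.ext (by omega)]
    simp
  | succ k ih =>
    have hδ : 0 ≤ δ := dist_nonneg.trans (h 0 0)
    rw [affineSubdivision, TupleChain.subdivision_succ_single, TupleChain.boundary_single, one_smul,
      map_sum, map_sum]
    refine Submodule.sum_mem _ fun i _ => ?_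
    rw [show (Finsupp.single (v ∘ i.succAbove) ((-1 : ℤ) ^ (i : ℕ)) : TupleChain k _) =
      (-1 : ℤ) ^ (i : ℕ) • Finsupp.single (v ∘ i.succAbove) 1 by simp, map_smul, map_smul]
    refine Submodule.smul_mem _ _ (Finsupp.apply_mem_of_mem_supported _ _ ?_
      (ih (v ∘ i.succAbove) fun a b => h _ _))
    rintro w ⟨hw1, hw2⟩
    rw [TupleChain.cone_single]
    have hull : ∀ a, ∃ t, w a = comb v t := fun a => by
      obtain ⟨t, ht⟩ := hw1 a
      exact ⟨_, ht.trans (comb_map v i.succAbove t).symm⟩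
    have hb : ∀ a, dist (tupleBarycenter (k + 1) v) (w a) ≤ (k + 1) / (k + 2) * δ := fun a => by
      obtain ⟨t, ht⟩ := hull a
      rw [ht]
      exact dist_comb_le v _ (dist_tupleBarycenter_le v h) t
    have h2 : (((k + 1 : ℕ) : ℝ) / ((k + 1 : ℕ) + 1) * δ) = (k + 1) / (k + 2) * δ := by
      push_cast
      ring
    refine Finsupp.single_mem_supported ℤ _ ⟨fun a => ?_, fun a b => ?_⟩
    · refine Fin.cases ⟨_, rfl⟩ (fun a => ?_) a
      simpa using hull a
    · rw [h2]
      have hnn : 0 ≤ ((k : ℝ) + 1) / (k + 2) * δ := by positivity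
      refine Fin.cases (Fin.cases ?_ (fun b => ?_) b) (fun a => Fin.cases ?_ (fun b => ?_) b) a
      · simpa using hnn
      · simpa using hb b
      · simpa [dist_comm] using hb a
      · refine (by simpa using hw2 a b : _ ≤ (k : ℝ) / (k + 1) * δ).trans ?_
        refine mul_le_mul_of_nonneg_right ?_ hδ
        rw [div_le_div_iff₀ (by positivity) (by positivity)]
        nlinarith

theorem affineSubdivision_pow_mem (k : ℕ) (v : Fin (k + 1) → stdSimplex ℝ (Fin (m + 1)))
    {δ : ℝ} (h : ∀ i j, dist (v i) (v j) ≤ δ) (n : ℕ) :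
    ((affineSubdivision k m) ^ n) (Finsupp.single v 1) ∈ Finsupp.supported ℤ ℤ
      {w | ∀ i j, dist (w i) (w j) ≤ ((k : ℝ) / (k + 1)) ^ n * δ} := by
  induction n with
  | zero => exact Finsupp.single_mem_supported ℤ _ (by simpa using h)
  | succ n ih =>
    rw [pow_succ' (affineSubdivision k m), Module.End.mul_apply]
    refine Finsupp.apply_mem_of_mem_supported _ _ (fun w hw => ?_) ih
    refine Finsupp.supported_mono ?_ (affineSubdivision_single_mem k w hw)
    intro w' hw' i j
    rw [pow_succ', mul_assoc]
    exact hw'.2 i j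

end Mesh

/-! ### Iterated subdivision makes chains small. -/

namespace SingularChain

variable {X : Type u} [TopologicalSpace X]

theorem subdivision_pow_realize {k m : ℕ} (τ : SingularSimplex m X) (n : ℕ)
    (c : TupleChain k (stdSimplex ℝ (Fin (m + 1)))) :
    ((subdivision k) ^ n) (map k τ (TupleChain.realize k c)) =
      map k τ (TupleChain.realize k (((affineSubdivision k m) ^ n) c)) := by
  induction n with
  | zero => rfl
  | succ n ih =>
    rw [pow_succ', Module.End.mul_apply, ih, subdivision_realize, pow_succ', Module.End.mul_apply]

/-- The preimages of `U` and `V` cover the compact model simplex and so have a Lebesgue number; the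
mesh of the iterated subdivision decays geometrically and falls below it. -/
theorem eventually_subdivision_pow_single_mem {U V : Set X} (hU : IsOpen U) (hV : IsOpen V) {k : ℕ}
    (σ : SingularSimplex k X) (hσ : Set.range σ ⊆ U ∪ V) :
    ∀ᶠ n in atTop, ((subdivision k) ^ n) (Finsupp.single σ 1) ∈ smallChains U V k := by
  obtain ⟨δ, hδ, hball⟩ := lebesgue_number_lemma_of_metric (s := Set.univ)
    (c := fun b : Bool => σ ⁻¹' (if b then U else V)) isCompact_univ
    (fun b => by cases b <;> simp [hU.preimage σ.continuous, hV.preimage σ.continuous])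
    (fun t _ => by
      rcases hσ ⟨t, rfl⟩ with h | h
      · exact Set.mem_iUnion.2 ⟨true, by simpa using h⟩
      · exact Set.mem_iUnion.2 ⟨false, by simpa using h⟩)
  have hlim : Tendsto (fun n : ℕ => ((k : ℝ) / (k + 1)) ^ n *
      Metric.diam (Set.univ : Set (stdSimplex ℝ (Fin (k + 1))))) atTop (𝓝 0) := by
    rw [← zero_mul (Metric.diam (Set.univ : Set (stdSimplex ℝ (Fin (k + 1)))))]
    refine (tendsto_pow_atTop_nhds_zero_of_lt_one (by positivity) ?_).mul_const _
    rw [div_lt_one (by positivity)]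
    linarith
  filter_upwards [hlim.eventually (gt_mem_nhds hδ)] with n hn
  rw [← map_realize_vertices, subdivision_pow_realize]
  have hmem := affineSubdivision_pow_mem (m := k) k (fun i => stdSimplex.vertex (S := ℝ) i)
    (fun i j => Metric.dist_le_diam_of_mem (isCompact_univ.isBounded) (Set.mem_univ _)
      (Set.mem_univ _)) n
  refine Finsupp.apply_mem_of_mem_supported (map k σ ∘ₗ TupleChain.realize k) _ (fun w hw => ?_)
    hmem
  rw [LinearMap.comp_apply, TupleChain.realize_single, map_single]
  obtain ⟨b, hb⟩ := hball (w 0) trivial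
  have hrange : Set.range (σ.comp (comb w)) ⊆ if b then U else V := by
    rintro _ ⟨t, rfl⟩
    refine hb ?_
    rw [Metric.mem_ball, dist_comm]
    exact (dist_comb_le w (w 0) (fun i => hw 0 i) t).trans_lt hn
  cases b
  · exact Submodule.mem_sup_right (single_mem_chainsIn hrange _)
  · exact Submodule.mem_sup_left (single_mem_chainsIn hrange _)

/-- The required number of subdivisions depends on the simplex; the form "for all large `n`" is what
survives finite sums. -/
theorem eventually_subdivision_pow_mem {U V : Set X} (hU : IsOpen U) (hV : IsOpen V) {k : ℕ}
    {c : SingularChain k X} (hc : c ∈ chainsIn (U ∪ V) k) :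
    ∀ᶠ n in atTop, ((subdivision k) ^ n) c ∈ smallChains U V k := by
  rw [chainsIn, Finsupp.supported_eq_span_single] at hc
  induction hc using Submodule.span_induction with
  | mem x hx =>
    obtain ⟨σ, hσ, rfl⟩ := hx
    exact eventually_subdivision_pow_single_mem hU hV σ hσ
  | zero => exact Eventually.of_forall fun n => by simp
  | add x y _ _ hx hy =>
    filter_upwards [hx, hy] with n h1 h2
    rw [map_add]
    exact Submodule.add_mem _ h1 h2
  | smul a x _ hx =>
    filter_upwards [hx] with n h1
    rw [map_smul]
    exact Submodule.smul_mem _ _ h1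

theorem boundaryFrom_subdivision (k : ℕ) (c : SingularChain k X) :
    boundaryFrom k (subdivision k c) = subdivision (k - 1) (boundaryFrom k c) := by
  cases k with
  | zero => simp [boundaryFrom]
  | succ k => exact boundary_subdivision k c

/-- The homotopy formula leaves only the homotopy applied to the boundary, and operators defined on
model simplices preserve small chains. -/
theorem sub_subdivision_sub_mem {U V : Set X} {k : ℕ} {c : SingularChain k X}
    (h : boundaryFrom k c ∈ smallChains U V (k - 1)) :
    c - subdivision k c - boundary k (subdivisionHomotopy k c) ∈ smallChains U V k := by
  cases k with
  | zero =>
    rw [boundary_subdivisionHomotopy_zero, sub_self]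
    exact Submodule.zero_mem _
  | succ k =>
    rw [boundary_subdivisionHomotopy, sub_sub_cancel]
    exact modelOperator_mem_smallChains _ h

/-- A chain in `U ∪ V` whose boundary is small is homologous to a small chain. -/
theorem exists_eq_add_add_boundary {U V : Set X} (hU : IsOpen U) (hV : IsOpen V) {k : ℕ}
    {c : SingularChain k X} (hc : c ∈ chainsIn (U ∪ V) k)
    (h : boundaryFrom k c ∈ smallChains U V (k - 1)) :
    ∃ u ∈ chainsIn U k, ∃ v ∈ chainsIn V k, ∃ d ∈ chainsIn (U ∪ V) (k + 1),
      c = u + v + boundary k d := by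
  -- One more subdivision preserves the first two conditions, and its homotopy is added to `d`.
  have key : ∀ n, ((subdivision k) ^ n) c ∈ chainsIn (U ∪ V) k ∧
      boundaryFrom k (((subdivision k) ^ n) c) ∈ smallChains U V (k - 1) ∧
      ∃ d ∈ chainsIn (U ∪ V) (k + 1),
        c - ((subdivision k) ^ n) c - boundary k d ∈ smallChains U V k := by
    intro n
    induction n with
    | zero => exact ⟨hc, h, 0, Submodule.zero_mem _, by simp⟩
    | succ n ih =>
      obtain ⟨h1, h2, d, hd, h3⟩ := ih
      rw [pow_succ', Module.End.mul_apply]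
      refine ⟨modelOperator_mem_chainsIn _ h1, ?_,
        d + subdivisionHomotopy k ((subdivision k ^ n) c),
        Submodule.add_mem _ hd (modelOperator_mem_chainsIn _ h1), ?_⟩
      · rw [boundaryFrom_subdivision]
        exact modelOperator_mem_smallChains _ h2
      · convert Submodule.add_mem _ h3 (sub_subdivision_sub_mem h2) using 1
        rw [map_add]
        abel
  obtain ⟨n, hn⟩ := (eventually_subdivision_pow_mem hU hV hc).exists
  obtain ⟨-, -, d, hd, h3⟩ := key n
  obtain ⟨u, hu, v, hv, huv⟩ := Submodule.mem_sup.1 (Submodule.add_mem _ h3 hn)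
  refine ⟨u, hu, v, hv, d, hd, ?_⟩
  rw [huv]
  abel

end SingularChain

open SingularChain SimplexSpace

/-! ### Relative cycles and boundaries -/

namespace SingularChain

variable {X : Type u} [TopologicalSpace X] {Y : Type v} [TopologicalSpace Y] {k : ℕ}
  {A B U V : Set X}

theorem mem_relCycles {c : SingularChain k X} :
    c ∈ relCycles A k ↔ boundaryFrom k c ∈ chainsIn A (k - 1) := Iff.rfl

theorem mem_relCycles_succ {c : SingularChain (k + 1) X} :
    c ∈ relCycles A (k + 1) ↔ boundary k c ∈ chainsIn A k := Iff.rfl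

theorem mem_relBoundaries {c : SingularChain k X} :
    c ∈ relBoundaries A k ↔ ∃ d, ∃ w ∈ chainsIn A k, c = boundary k d + w := by
  rw [relBoundaries, Submodule.mem_sup]
  constructor
  · rintro ⟨_, ⟨d, rfl⟩, w, hw, rfl⟩
    exact ⟨d, w, hw, rfl⟩
  · rintro ⟨d, w, hw, rfl⟩
    exact ⟨_, ⟨d, rfl⟩, w, hw, rfl⟩

theorem boundary_mem_relBoundaries (d : SingularChain (k + 1) X) :
    boundary k d ∈ relBoundaries A k :=
  Submodule.mem_sup_left ⟨d, rfl⟩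

theorem chainsIn_le_relBoundaries : chainsIn A k ≤ relBoundaries A k := le_sup_right

theorem relCycles_mono (h : A ⊆ B) : relCycles A k ≤ relCycles B k :=
  fun _ hc => chainsIn_mono h _ hc

theorem relBoundaries_mono (h : A ⊆ B) : relBoundaries A k ≤ relBoundaries B k :=
  sup_le_sup_left (chainsIn_mono h _) _

theorem relBoundaries_le_relCycles : relBoundaries A k ≤ relCycles A k := by
  intro c hc
  obtain ⟨d, w, hw, rfl⟩ := mem_relBoundaries.1 hc
  rw [mem_relCycles, map_add, boundaryFrom_boundary, zero_add]
  exact boundaryFrom_mem_chainsIn hw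

theorem mem_relCycles_of_sub_mem {a b : SingularChain k X} (ha : a ∈ relCycles A k)
    (h : a - b ∈ relBoundaries A k) : b ∈ relCycles A k := by
  simpa using Submodule.sub_mem _ ha (relBoundaries_le_relCycles h)

theorem relClass_eq_iff {a b : SingularChain k X} (ha : a ∈ relCycles A k)
    (hb : b ∈ relCycles A k) : relClass a ha = relClass b hb ↔ a - b ∈ relBoundaries A k :=
  (Submodule.Quotient.eq _).trans Iff.rfl

theorem map_mem_relCycles {f : C(X, Y)} {C : Set Y} (hf : Set.MapsTo f A C)
    {c : SingularChain k X} (hc : c ∈ relCycles A k) : map k f c ∈ relCycles C k := by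
  rw [mem_relCycles, boundaryFrom_map]
  exact map_mem_chainsIn hf hc

theorem map_mem_relBoundaries {f : C(X, Y)} {C : Set Y} (hf : Set.MapsTo f A C)
    {c : SingularChain k X} (hc : c ∈ relBoundaries A k) : map k f c ∈ relBoundaries C k := by
  obtain ⟨d, w, hw, rfl⟩ := mem_relBoundaries.1 hc
  exact mem_relBoundaries.2 ⟨map _ f d, map k f w, map_mem_chainsIn hf hw, by
    rw [map_add, boundary_map]⟩

/-- Homotopic maps of pairs induce the same map in relative homology. -/
theorem map_sub_map_mem_relBoundaries {C : Set Y} (F : C(X × SimplexInterval, Y))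
    (hF : ∀ x ∈ A, ∀ t, F (x, t) ∈ C) {c : SingularChain k X} (hc : c ∈ relCycles A k) :
    map k (F.comp (cylinderEnd X 1)) c - map k (F.comp (cylinderEnd X 0)) c ∈
      relBoundaries C k := by
  rw [← map_map, ← map_map, ← map_sub]
  cases k with
  | zero =>
    rw [← boundary_prism_zero, ← boundary_map]
    exact boundary_mem_relBoundaries _
  | succ k =>
    -- The prism over the boundary is the only term that is not a boundary; it is carried into `C`
    -- since the boundary of `c` lies in `A`.
    have h : map (k + 1) F (prism k (boundary k c)) ∈ chainsIn C (k + 1) :=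
      map_mem_chainsIn (fun x hx => hF x.1 hx.1 x.2) (prism_mem_chainsIn hc)
    refine mem_relBoundaries.2 ⟨map _ F (prism (k + 1) c), _, h, ?_⟩
    rw [boundary_map, boundary_prism, ← map_add, sub_add_cancel]

theorem relHomotopy_id {A : Set X} (F : C(X × SimplexInterval, X))
    (hF : ∀ x ∈ A, ∀ t, F (x, t) ∈ A) (h0 : ∀ x, F (x, stdSimplex.vertex 0) = x)
    {c : SingularChain k X} (hc : c ∈ relCycles A k) :
    map k (F.comp (cylinderEnd X 1)) c - c ∈ relBoundaries A k := by
  have := map_sub_map_mem_relBoundaries F hF hc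
  rwa [show F.comp (cylinderEnd X 0) = ContinuousMap.id X from ContinuousMap.ext h0, map_id]
    at this

/-- The relative homology of `(X, A)` vanishes in degree `k`. -/
def RelAcyclic (A : Set X) (k : ℕ) : Prop := relCycles A k ≤ relBoundaries A k

/-- The relative homology of `(X, A)` is torsion-free in degree `k`. -/
def RelTorsionFree (A : Set X) (k : ℕ) : Prop :=
  ∀ a : ℤ, a ≠ 0 → ∀ c ∈ relCycles A k, a • c ∈ relBoundaries A k → c ∈ relBoundaries A k

/-- At time one every chain lies in `A` and is trivial relative to `A`. -/
theorem relAcyclic_of_homotopy {A : Set X} (F : C(X × SimplexInterval, X))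
    (hF : ∀ x ∈ A, ∀ t, F (x, t) ∈ A) (h0 : ∀ x, F (x, stdSimplex.vertex 0) = x)
    (h1 : ∀ x, F (x, stdSimplex.vertex 1) ∈ A) : RelAcyclic A k := by
  intro c hc
  have h2 : map k (F.comp (cylinderEnd X 1)) c ∈ relBoundaries A k :=
    chainsIn_le_relBoundaries (map_mem_chainsIn (A := Set.univ) (fun x _ => h1 x) (by
      rw [chainsIn_univ]; trivial))
  simpa using Submodule.sub_mem _ h2 (relHomotopy_id F hF h0 hc)

/-! ### Mayer–Vietoris -/

/-- Exactness of the relative Mayer–Vietoris sequence at `H_k(X, U ∩ V)` when the preceding term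
`H_{k+1}(X, U ∪ V)` vanishes. Primitives `a` and `b` of `c` relative to `U` and `V` differ by a
relative cycle of `U ∪ V`, hence up to a boundary by a chain `w` in `U ∪ V`, which is then split
into a part in `U` and a part in `V`. -/
theorem mem_relBoundaries_inter (hU : IsOpen U) (hV : IsOpen V)
    (h : RelAcyclic (U ∪ V) (k + 1)) {c : SingularChain k X} (hcU : c ∈ relBoundaries U k)
    (hcV : c ∈ relBoundaries V k) : c ∈ relBoundaries (U ∩ V) k := by
  obtain ⟨a, u, hu, hau⟩ := mem_relBoundaries.1 hcU
  obtain ⟨b, v, hv, hbv⟩ := mem_relBoundaries.1 hcV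
  have hab : boundary k (a - b) = v - u := by
    rw [map_sub, sub_eq_sub_iff_add_eq_add, ← hau, hbv, add_comm]
  have hsmall : v - u ∈ smallChains U V k := by
    rw [← neg_add_eq_sub]
    exact Submodule.add_mem_sup (Submodule.neg_mem _ hu) hv
  have hcyc : a - b ∈ relCycles (U ∪ V) (k + 1) := by
    rw [mem_relCycles_succ, hab]
    exact smallChains_le_chainsIn U V k hsmall
  obtain ⟨e, w, hw, hew⟩ := mem_relBoundaries.1 (h hcyc)
  have hbw : boundary k w = v - u := by
    rw [← hab, hew, map_add, boundary_boundary, zero_add]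
  obtain ⟨wU, hwU, wV, hwV, d, -, hd⟩ := exists_eq_add_add_boundary hU hV hw
    (show boundary k w ∈ smallChains U V k from hbw ▸ hsmall)
  have hbw' : boundary k wU + boundary k wV = v - u := by
    rw [← hbw, hd, map_add, map_add, boundary_boundary, add_zero]
  have hz : u + boundary k wU = v - boundary k wV := by
    rw [eq_sub_iff_add_eq, add_assoc, hbw', add_sub_cancel]
  -- The remainder visibly lies in `U`, and by `hz` it also lies in `V`.
  refine mem_relBoundaries.2 ⟨a - wU, u + boundary k wU, mem_chainsIn_inter ?_ ?_, ?_⟩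
  · exact Submodule.add_mem _ hu (boundary_mem_chainsIn hwU)
  · rw [hz]
    exact Submodule.sub_mem _ hv (boundary_mem_chainsIn hwV)
  · rw [hau, map_sub]
    abel

theorem RelAcyclic.inter (hU : IsOpen U) (hV : IsOpen V)
    (h : RelAcyclic (U ∪ V) (k + 1)) (h1 : RelAcyclic U k) (h2 : RelAcyclic V k) :
    RelAcyclic (U ∩ V) k := fun _ hc =>
  mem_relBoundaries_inter hU hV h (h1 (relCycles_mono Set.inter_subset_left hc))
    (h2 (relCycles_mono Set.inter_subset_right hc))

/-- Exactness at the middle term: write `a - b` as a boundary plus a chain in `U ∪ V`, split the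
latter as `wU + wV` up to a boundary, and move `wU` to the side of `a`. -/
theorem exists_relCycle_glue (hU : IsOpen U) (hV : IsOpen V) {a b : SingularChain k X}
    (ha : a ∈ relCycles U k) (hb : b ∈ relCycles V k) (hab : a - b ∈ relBoundaries (U ∪ V) k) :
    ∃ c ∈ relCycles (U ∩ V) k, c - a ∈ relBoundaries U k ∧ c - b ∈ relBoundaries V k := by
  obtain ⟨e, w, hw, hew⟩ := mem_relBoundaries.1 hab
  have hbw : boundaryFrom k w = boundaryFrom k a - boundaryFrom k b := by
    rw [← map_sub, hew, map_add, boundaryFrom_boundary, zero_add]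
  obtain ⟨wU, hwU, wV, hwV, d, -, hd⟩ := exists_eq_add_add_boundary hU hV hw (by
    rw [hbw, sub_eq_add_neg]
    exact Submodule.add_mem_sup ha (Submodule.neg_mem _ hb))
  have hz : a - wU = b + wV + boundary k (e + d) := by
    have : a = boundary k e + (wU + wV + boundary k d) + b := by
      rw [← hd, ← hew, sub_add_cancel]
    rw [this, map_add]
    abel
  refine ⟨a - wU, mem_chainsIn_inter ?_ ?_, ?_, ?_⟩
  · rw [map_sub]
    exact Submodule.sub_mem _ ha (boundaryFrom_mem_chainsIn hwU)
  · rw [hz, map_add, boundaryFrom_boundary, add_zero, map_add]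
    exact Submodule.add_mem _ hb (boundaryFrom_mem_chainsIn hwV)
  · rw [sub_sub_cancel_left]
    exact Submodule.neg_mem _ (chainsIn_le_relBoundaries hwU)
  · rw [hz, add_assoc, add_sub_cancel_left]
    exact Submodule.add_mem _ (chainsIn_le_relBoundaries hwV) (boundary_mem_relBoundaries _)

/-- The Mayer–Vietoris boundary of a relative cycle. -/
theorem exists_suspension (hU : IsOpen U) (hV : IsOpen V) (h1 : RelAcyclic U (k + 1))
    (h2 : RelAcyclic V (k + 1)) {e : SingularChain (k + 1) X}
    (he : e ∈ relCycles (U ∪ V) (k + 1)) :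
    ∃ u ∈ relCycles (U ∩ V) k,
      (u ∈ relBoundaries (U ∩ V) k → e ∈ relBoundaries (U ∪ V) (k + 1)) ∧
      ∀ a : ℤ, a • e ∈ relBoundaries (U ∪ V) (k + 1) → a • u ∈ relBoundaries (U ∩ V) k := by
  obtain ⟨u, hu, v, hv, d, hd, hed⟩ := exists_eq_add_add_boundary hU hV
    (mem_relCycles_succ.1 he) (by rw [boundaryFrom_boundary]; exact Submodule.zero_mem _)
  have huv : boundaryFrom k u = - boundaryFrom k v := by
    have := congrArg (boundaryFrom k) hed
    rw [boundaryFrom_boundary, map_add, map_add, boundaryFrom_boundary, add_zero] at this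
    exact eq_neg_of_add_eq_zero_left this.symm
  have hed' : boundary k (e - d) = u + v := by
    rw [map_sub, hed, add_sub_cancel_right]
  -- `u` represents the image of `e` under the connecting homomorphism: its boundary lies in `U`,
  -- and in `V` since it equals the negative of the boundary of `v`.
  refine ⟨u, mem_chainsIn_inter (boundaryFrom_mem_chainsIn hu) ?_, fun hub => ?_, fun a ha => ?_⟩
  · rw [huv]
    exact Submodule.neg_mem _ (boundaryFrom_mem_chainsIn hv)
  -- If `s` bounds `u` relative to `U ∩ V`, then `e - d` is the sum of `s`, a relative cycle of `U`,
  -- and `e - d - s`, a relative cycle of `V`; both are relative boundaries by acyclicity.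
  · obtain ⟨s, t, ht, hst⟩ := mem_relBoundaries.1 hub
    have hs : s ∈ relCycles U (k + 1) := by
      rw [mem_relCycles_succ, ← sub_eq_iff_eq_add.2 hst]
      exact Submodule.sub_mem _ hu (chainsIn_mono Set.inter_subset_left _ ht)
    have hes : e - d - s ∈ relCycles V (k + 1) := by
      rw [mem_relCycles_succ, map_sub, hed', hst, show boundary k s + t + v - boundary k s = t + v
        by abel]
      exact Submodule.add_mem _ (chainsIn_mono Set.inter_subset_right _ ht) hv
    have := Submodule.add_mem _ (Submodule.add_mem _
      (relBoundaries_mono Set.subset_union_right (h2 hes))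
      (relBoundaries_mono Set.subset_union_left (h1 hs))) (chainsIn_le_relBoundaries hd)
    simpa using this
  -- The chain `w - a • d` in `U ∪ V` has boundary `a • u + a • v`; after splitting it, `a • u` is
  -- the boundary of its `U`-part up to a chain that lies in both sets.
  · obtain ⟨r, w, hw, hrw⟩ := mem_relBoundaries.1 ha
    have hw' : w - a • d ∈ chainsIn (U ∪ V) (k + 1) :=
      Submodule.sub_mem _ hw (Submodule.smul_mem _ _ hd)
    have hbw : boundary k (w - a • d) = a • u + a • v := by
      rw [← smul_add, ← hed', ← map_smul, smul_sub, hrw, map_sub, map_sub, map_add,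
        boundary_boundary, zero_add]
    obtain ⟨wU, hwU, wV, hwV, d', -, hd'⟩ := exists_eq_add_add_boundary hU hV hw'
      (show boundary k (w - a • d) ∈ smallChains U V k by
        rw [hbw]
        exact Submodule.add_mem_sup (Submodule.smul_mem _ _ hu) (Submodule.smul_mem _ _ hv))
    have hz : a • u - boundary k wU = boundary k wV - a • v := by
      rw [hd', map_add, map_add, boundary_boundary, add_zero] at hbw
      rw [sub_eq_iff_eq_add, sub_add_eq_add_sub, eq_sub_iff_add_eq, ← hbw, add_comm]
    refine mem_relBoundaries.2 ⟨wU, a • u - boundary k wU, mem_chainsIn_inter ?_ ?_, by abel⟩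
    · exact Submodule.sub_mem _ (Submodule.smul_mem _ _ hu) (boundary_mem_chainsIn hwU)
    · rw [hz]
      exact Submodule.sub_mem _ (boundary_mem_chainsIn hwV) (Submodule.smul_mem _ _ hv)

theorem RelAcyclic.suspension (hU : IsOpen U) (hV : IsOpen V) (h1 : RelAcyclic U (k + 1))
    (h2 : RelAcyclic V (k + 1)) (h : RelAcyclic (U ∩ V) k) : RelAcyclic (U ∪ V) (k + 1) := by
  intro e he
  obtain ⟨u, hu, hue, -⟩ := exists_suspension hU hV h1 h2 he
  exact hue (h hu)

theorem RelTorsionFree.suspension (hU : IsOpen U) (hV : IsOpen V) (h1 : RelAcyclic U (k + 1))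
    (h2 : RelAcyclic V (k + 1)) (h : RelTorsionFree (U ∩ V) k) :
    RelTorsionFree (U ∪ V) (k + 1) := by
  intro a ha e he hae
  obtain ⟨u, hu, hue, hau⟩ := exists_suspension hU hV h1 h2 he
  exact hue (h a ha u hu (hau a hae))

/-! ### Excision -/

theorem exists_map_eq_of_mem_chainsIn {φ : C(Y, X)} (hφ : IsEmbedding φ)
    {c : SingularChain k X} (hc : c ∈ chainsIn (Set.range φ) k) : ∃ y, map k φ y = c := by
  have : c ∈ LinearMap.range (map k φ) := by
    refine Finsupp.apply_mem_of_mem_supported LinearMap.id _ (fun σ hσ => ?_) hc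
    choose τ hτ using fun t => hσ ⟨t, rfl⟩
    have hcont : Continuous τ := by
      rw [hφ.continuous_iff]
      exact σ.continuous.congr fun t => (hτ t).symm
    refine ⟨Finsupp.single ⟨τ, hcont⟩ 1, ?_⟩
    rw [map_single]
    congr 1
    exact ContinuousMap.ext hτ
  exact this

theorem map_mem_chainsIn_iff {φ : C(Y, X)} (hφ : Function.Injective φ) {y : SingularChain k Y} :
    map k φ y ∈ chainsIn A k ↔ y ∈ chainsIn (φ ⁻¹' A) k := by
  refine ⟨fun h => ?_, map_mem_chainsIn fun _ hx => hx⟩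
  have hinj : Function.Injective fun σ : SingularSimplex k Y => φ.comp σ := fun σ τ h =>
    ContinuousMap.ext fun t => hφ (DFunLike.congr_fun h t)
  rw [chainsIn, Finsupp.mem_supported] at *
  intro σ hσ
  have : φ.comp σ ∈ (map k φ y).support := by
    rw [Finsupp.mem_support_iff, map, Finsupp.lmapDomain_apply, Finsupp.mapDomain_apply hinj]
    exact Finsupp.mem_support_iff.1 hσ
  rintro _ ⟨t, rfl⟩
  exact h this ⟨t, rfl⟩

theorem map_mem_relCycles_iff {φ : C(Y, X)} (hφ : Function.Injective φ) {y : SingularChain k Y} :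
    map k φ y ∈ relCycles A k ↔ y ∈ relCycles (φ ⁻¹' A) k := by
  rw [mem_relCycles, mem_relCycles, boundaryFrom_map, map_mem_chainsIn_iff hφ]

/-- Surjectivity of excision: up to a boundary, `c` splits into a chain in the range of `φ`, which
pulls back, and a chain in `A`, which is trivial. -/
theorem exists_excision {φ : C(Y, X)} (hφ : IsOpenEmbedding φ) (hA : IsOpen A)
    (hcover : Set.range φ ∪ A = Set.univ) {c : SingularChain k X} (hc : c ∈ relCycles A k) :
    ∃ y ∈ relCycles (φ ⁻¹' A) k, c - map k φ y ∈ relBoundaries A k := by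
  obtain ⟨u, hu, v, hv, d, -, hd⟩ := exists_eq_add_add_boundary hφ.isOpen_range hA
    (c := c) (by rw [hcover, chainsIn_univ]; trivial) (Submodule.mem_sup_right hc)
  obtain ⟨y, rfl⟩ := exists_map_eq_of_mem_chainsIn hφ.isEmbedding hu
  have hmem : c - map k φ y ∈ relBoundaries A k :=
    mem_relBoundaries.2 ⟨d, v, hv, by rw [hd]; abel⟩
  exact ⟨y, (map_mem_relCycles_iff hφ.injective).1 (mem_relCycles_of_sub_mem hc hmem), hmem⟩

/-- Injectivity of excision: the same splitting is applied to a primitive of the image, whose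
boundary is already small; the part in the range of `φ` pulls back to a primitive of `y`. -/
theorem mem_relBoundaries_of_map {φ : C(Y, X)} (hφ : IsOpenEmbedding φ) (hA : IsOpen A)
    (hcover : Set.range φ ∪ A = Set.univ) {y : SingularChain k Y}
    (h : map k φ y ∈ relBoundaries A k) : y ∈ relBoundaries (φ ⁻¹' A) k := by
  obtain ⟨r, w, hw, hrw⟩ := mem_relBoundaries.1 h
  have hy : map k φ y ∈ chainsIn (Set.range φ) k :=
    map_mem_chainsIn (A := Set.univ) (B := Set.range φ) (fun x _ => ⟨x, rfl⟩)
      (by rw [chainsIn_univ]; trivial)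
  obtain ⟨rU, hrU, rV, hrV, d, -, hd⟩ := exists_eq_add_add_boundary hφ.isOpen_range hA
    (c := r) (by rw [hcover, chainsIn_univ]; trivial)
    (show boundary k r ∈ smallChains _ _ k by
      rw [← sub_eq_iff_eq_add.2 hrw, sub_eq_add_neg]
      exact Submodule.add_mem_sup hy (Submodule.neg_mem _ hw))
  obtain ⟨s, rfl⟩ := exists_map_eq_of_mem_chainsIn hφ.isEmbedding hrU
  have hys : map k φ (y - boundary k s) ∈ chainsIn A k := by
    have : map k φ (y - boundary k s) = boundary k rV + w := by
      rw [map_sub, hrw, hd, map_add, map_add, boundary_boundary, ← boundary_map]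
      abel
    rw [this]
    exact Submodule.add_mem _ (boundary_mem_chainsIn hrV) hw
  exact mem_relBoundaries.2 ⟨s, y - boundary k s, (map_mem_chainsIn_iff hφ.injective).1 hys,
    by abel⟩

end SingularChain

open SingularChain SimplexSpace

/-! ### Local homology of Euclidean space -/

namespace SingularChain

variable {X : Type u} [TopologicalSpace X] {Y : Type v} [TopologicalSpace Y] {k : ℕ}

/-- Only one of the two composites has to act as the identity: vanishing, and likewise
torsion-freeness, passes to retracts. -/
theorem RelAcyclic.of_retract {A : Set X} {C : Set Y} {f : C(X, Y)} {g : C(Y, X)}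
    (hf : Set.MapsTo f A C) (hg : Set.MapsTo g C A)
    (hgf : ∀ c ∈ relCycles A k, map k (g.comp f) c - c ∈ relBoundaries A k)
    (h : RelAcyclic C k) : RelAcyclic A k := by
  intro c hc
  have h1 := map_mem_relBoundaries hg (h (map_mem_relCycles hf hc))
  rw [map_map] at h1
  simpa using Submodule.sub_mem _ h1 (hgf c hc)

theorem RelTorsionFree.of_retract {A : Set X} {C : Set Y} {f : C(X, Y)} {g : C(Y, X)}
    (hf : Set.MapsTo f A C) (hg : Set.MapsTo g C A)
    (hgf : ∀ c ∈ relCycles A k, map k (g.comp f) c - c ∈ relBoundaries A k)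
    (h : RelTorsionFree C k) : RelTorsionFree A k := by
  intro a ha c hc hac
  have h1 := map_mem_relBoundaries hg (h a ha _ (map_mem_relCycles hf hc) (by
    rw [← map_smul]
    exact map_mem_relBoundaries hf hac))
  rw [map_map] at h1
  simpa using Submodule.sub_mem _ h1 (hgf c hc)

theorem map_comp_sub_mem {A : Set X} {f : C(X, Y)} {g : C(Y, X)} (h : ∀ x, g (f x) = x)
    (c : SingularChain k X) : map k (g.comp f) c - c ∈ relBoundaries A k := by
  rw [show g.comp f = ContinuousMap.id X from ContinuousMap.ext h, map_id, sub_self]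
  exact Submodule.zero_mem _

theorem chainsIn_empty : chainsIn (∅ : Set X) k = ⊥ := by
  have : {σ : SingularSimplex k X | Set.range σ ⊆ ∅} = ∅ := by
    ext σ
    simp only [Set.mem_ofPred_eq, Set.subset_empty_iff, Set.range_eq_empty_iff,
      Set.mem_empty_iff_false, iff_false, not_isEmpty_iff]
    infer_instance
  rw [chainsIn, this, Finsupp.supported_empty]

/-- All `k + 2` faces coincide, so the alternating sum of signs is `0` or `1` according to parity.
-/
theorem boundary_of_subsingleton [Subsingleton X] (σ : SingularSimplex (k + 1) X)
    (τ : SingularSimplex k X) (a : ℤ) :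
    boundary k (Finsupp.single σ a) =
      Finsupp.single τ (if Even (k + 2) then 0 else a) := by
  have : ∀ i, face i σ = τ := fun i => ContinuousMap.ext fun t => Subsingleton.elim _ _
  rw [boundary_single]
  simp only [this]
  rw [← Finsupp.single_finsetSum, Fin.sum_neg_one_pow, Finsupp.smul_single]
  split_ifs <;> simp

theorem eq_single_of_subsingleton [Subsingleton X] (c : SingularChain k X)
    (σ : SingularSimplex k X) : c = Finsupp.single σ (c σ) := by
  have : ∀ τ, τ = σ := fun τ => ContinuousMap.ext fun t => Subsingleton.elim _ _
  ext τ
  rw [this τ, Finsupp.single_eq_same]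

/-- The boundary maps of a point alternate between zero and isomorphisms. If the outgoing map is
zero, the incoming one is onto; otherwise zero is the only cycle. -/
theorem relAcyclic_of_subsingleton [Unique X] : RelAcyclic (∅ : Set X) (k + 1) := by
  intro c hc
  let σ (j : ℕ) : SingularSimplex j X := ContinuousMap.const _ default
  rw [mem_relCycles_succ, chainsIn_empty, Submodule.mem_bot, eq_single_of_subsingleton c (σ _),
    boundary_of_subsingleton _ (σ k)] at hc
  rw [eq_single_of_subsingleton c (σ _)]
  by_cases h : Even (k + 2)
  · have h' : ¬ Even (k + 1 + 2) := by
      rw [show k + 1 + 2 = (k + 2) + 1 by ring, Nat.even_add_one]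
      exact not_not.2 h
    have := boundary_mem_relBoundaries (A := (∅ : Set X))
      (Finsupp.single (σ (k + 1 + 1)) (c (σ (k + 1))))
    rwa [boundary_of_subsingleton _ (σ (k + 1)), if_neg h'] at this
  · rw [if_neg h, Finsupp.single_eq_zero] at hc
    rw [hc, Finsupp.single_zero]
    exact Submodule.zero_mem _

theorem relTorsionFree_of_subsingleton [Unique X] : RelTorsionFree (∅ : Set X) 0 := by
  have h0 : relBoundaries (∅ : Set X) 0 = ⊥ := by
    rw [relBoundaries, chainsIn_empty, sup_bot_eq, LinearMap.range_eq_bot]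
    ext σ
    rw [LinearMap.comp_apply, Finsupp.lsingle_apply,
      boundary_of_subsingleton _ (ContinuousMap.const _ default)]
    simp
  intro a ha c _ hac
  rw [h0, Submodule.mem_bot] at *
  exact (smul_eq_zero.1 hac).resolve_left ha

/-- The weight of the second endpoint in a point of the interval. -/
def _root_.SimplexInterval.weight : C(SimplexInterval, ℝ) :=
  ⟨fun t => t.1 1, (continuous_apply 1).comp continuous_subtype_val⟩

open SimplexInterval

theorem weight_nonneg (t : SimplexInterval) : 0 ≤ weight t := t.2.1 1

@[simp]
theorem weight_vertex_zero : weight (stdSimplex.vertex (S := ℝ) (0 : Fin 2)) = 0 := by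
  simp [weight]

@[simp]
theorem weight_vertex_one : weight (stdSimplex.vertex (S := ℝ) (1 : Fin 2)) = 1 := by
  simp [weight]

/-- Relative homology of `(V, V \ {x})` vanishes above degree `n` and is torsion-free in
degree `n`. -/
def LocalHomologyBound (X : Type u) [TopologicalSpace X] (n : ℕ) : Prop :=
  ∀ x : X, (∀ i, n < i → RelAcyclic {x}ᶜ i) ∧ RelTorsionFree {x}ᶜ n

/-- The two sets are the complements of the closed half-lines below and above the origin of `V × ℝ`.
They meet in the complement of the whole line and their union is the complement of the origin, so
Mayer–Vietoris raises the dimension by one. -/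
theorem rays_inter {V : Type u} [Zero V] :
    {x : V × ℝ | x.1 ≠ 0 ∨ 0 < 1 * x.2} ∩ {x : V × ℝ | x.1 ≠ 0 ∨ 0 < -1 * x.2} =
    {x : V × ℝ | x.1 ≠ 0} := by
  ext ⟨v, s⟩
  simp only [Set.mem_inter_iff, Set.mem_ofPred_eq, ← or_and_left]
  refine ⟨fun h => h.resolve_right fun h' => ?_, Or.inl⟩
  linarith [h'.1, h'.2]

theorem rays_union {V : Type u} [Zero V] :
    {x : V × ℝ | x.1 ≠ 0 ∨ 0 < 1 * x.2} ∪ {x : V × ℝ | x.1 ≠ 0 ∨ 0 < -1 * x.2} =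
    {0}ᶜ := by
  ext ⟨v, s⟩
  simp only [Set.mem_union, Set.mem_ofPred_eq, Set.mem_compl_iff, Set.mem_singleton_iff,
    Prod.mk_eq_zero, not_and_or]
  constructor
  · rintro ((h | h) | (h | h))
    · exact Or.inl h
    · exact Or.inr (by rintro rfl; simp at h)
    · exact Or.inl h
    · exact Or.inr (by rintro rfl; simp at h)
  · rintro (h | h)
    · exact Or.inl (Or.inl h)
    · rcases lt_or_gt_of_ne h with h | h
      · exact Or.inr (Or.inr (by linarith))
      · exact Or.inl (Or.inr (by linarith))

section Suspension

variable {V : Type u} [TopologicalSpace V] [Zero V]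

/-- Push in the direction `ε` along the last coordinate. The distance `1 + |s|` suffices to make `ε`
times the last coordinate positive for every point, and the motion never enters the ray. -/
theorem relAcyclic_compl_ray (ε : ℝ) (hε : ε = 1 ∨ ε = -1) :
    RelAcyclic {x : V × ℝ | x.1 ≠ 0 ∨ 0 < ε * x.2} k := by
  have hε' : ε * ε = 1 := by rcases hε with rfl | rfl <;> norm_num
  let F : C((V × ℝ) × SimplexInterval, V × ℝ) :=
    ⟨fun z => (z.1.1, z.1.2 + ε * (weight z.2 * (1 + |z.1.2|))), by fun_prop⟩
  refine relAcyclic_of_homotopy F ?_ ?_ ?_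
  · rintro ⟨v, s⟩ (h | h) t
    · exact Or.inl h
    · refine Or.inr ?_
      change 0 < ε * (s + ε * (weight t * (1 + |s|)))
      rw [mul_add, ← mul_assoc, hε', one_mul]
      have := weight_nonneg t
      have h' : 0 < ε * s := h
      positivity
  · rintro ⟨v, s⟩
    change (v, s + ε * (weight (stdSimplex.vertex (S := ℝ) (0 : Fin 2)) * (1 + |s|))) = _
    rw [weight_vertex_zero]
    simp
  · rintro ⟨v, s⟩
    refine Or.inr ?_
    change 0 < ε * (s + ε * (weight (stdSimplex.vertex (S := ℝ) (1 : Fin 2)) * (1 + |s|)))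
    rw [weight_vertex_one, mul_add, ← mul_assoc, hε', one_mul, one_mul]
    have h1 := neg_abs_le s
    have h2 := le_abs_self s
    rcases hε with rfl | rfl <;> linarith

/-- Contract the last coordinate linearly to zero; the first component does not move. -/
theorem cylinder_retract {c : SingularChain k (V × ℝ)}
    (hc : c ∈ relCycles {x : V × ℝ | x.1 ≠ 0} k) :
    map k ((⟨fun v => (v, 0), by fun_prop⟩ : C(V, V × ℝ)).comp ⟨Prod.fst, continuous_fst⟩) c - c ∈
      relBoundaries {x : V × ℝ | x.1 ≠ 0} k := by
  let F : C((V × ℝ) × SimplexInterval, V × ℝ) :=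
    ⟨fun z => (z.1.1, (1 - weight z.2) * z.1.2), by fun_prop⟩
  have h0 : ∀ x, F (x, stdSimplex.vertex 0) = x := fun x => by
    change (x.1, (1 - weight (stdSimplex.vertex (S := ℝ) (0 : Fin 2))) * x.2) = x
    rw [weight_vertex_zero, sub_zero, one_mul]
  have := relHomotopy_id F (fun x hx t => hx) h0 hc
  convert this using 3
  congr 1
  refine ContinuousMap.ext fun x => ?_
  change (x.1, (0 : ℝ)) = (x.1, (1 - weight (stdSimplex.vertex (S := ℝ) (1 : Fin 2))) * x.2)
  rw [weight_vertex_one, sub_self, zero_mul]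

theorem relAcyclic_compl_line (h : RelAcyclic ({0}ᶜ : Set V) k) :
    RelAcyclic {x : V × ℝ | x.1 ≠ 0} k :=
  h.of_retract (f := ⟨Prod.fst, continuous_fst⟩) (g := ⟨fun v => (v, 0), by fun_prop⟩)
    (fun _ hx => hx) (fun _ hx => hx) fun _ hc => cylinder_retract hc

theorem relTorsionFree_compl_line (h : RelTorsionFree ({0}ᶜ : Set V) k) :
    RelTorsionFree {x : V × ℝ | x.1 ≠ 0} k :=
  h.of_retract (f := ⟨Prod.fst, continuous_fst⟩) (g := ⟨fun v => (v, 0), by fun_prop⟩)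
    (fun _ hx => hx) (fun _ hx => hx) fun _ hc => cylinder_retract hc

theorem isOpen_compl_ray [T1Space V] (ε : ℝ) : IsOpen {x : V × ℝ | x.1 ≠ 0 ∨ 0 < ε * x.2} :=
  (isOpen_compl_singleton.preimage continuous_fst).union
    (isOpen_lt continuous_const (continuous_const.mul continuous_snd))

theorem relAcyclic_prod_real [T1Space V] (h : RelAcyclic ({0}ᶜ : Set V) k) :
    RelAcyclic ({0}ᶜ : Set (V × ℝ)) (k + 1) := by
  rw [← rays_union]
  refine RelAcyclic.suspension (isOpen_compl_ray _) (isOpen_compl_ray _)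
    (relAcyclic_compl_ray _ (Or.inl rfl)) (relAcyclic_compl_ray _ (Or.inr rfl)) ?_
  rw [rays_inter]
  exact relAcyclic_compl_line h

theorem relTorsionFree_prod_real [T1Space V] (h : RelTorsionFree ({0}ᶜ : Set V) k) :
    RelTorsionFree ({0}ᶜ : Set (V × ℝ)) (k + 1) := by
  rw [← rays_union]
  refine RelTorsionFree.suspension (isOpen_compl_ray _) (isOpen_compl_ray _)
    (relAcyclic_compl_ray _ (Or.inl rfl)) (relAcyclic_compl_ray _ (Or.inr rfl)) ?_
  rw [rays_inter]
  exact relTorsionFree_compl_line h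

end Suspension

theorem localHomology_pi (n : ℕ) : (∀ i, n < i → RelAcyclic ({0}ᶜ : Set (Fin n → ℝ)) i) ∧
    RelTorsionFree ({0}ᶜ : Set (Fin n → ℝ)) n := by
  induction n with
  | zero =>
    have : ({0}ᶜ : Set (Fin 0 → ℝ)) = ∅ := by
      ext x
      simp [Subsingleton.elim x 0]
    rw [this]
    refine ⟨fun i hi => ?_, relTorsionFree_of_subsingleton⟩
    obtain ⟨i, rfl⟩ := Nat.exists_eq_succ_of_ne_zero hi.ne'
    exact relAcyclic_of_subsingleton
  | succ n ih =>
    let f : C(Fin (n + 1) → ℝ, (Fin n → ℝ) × ℝ) :=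
      ⟨fun x => (fun i => x i.succ, x 0), by fun_prop⟩
    let g : C((Fin n → ℝ) × ℝ, Fin (n + 1) → ℝ) :=
      ⟨fun x => Fin.cons x.2 x.1, continuous_pi fun i => by
        refine Fin.cases ?_ (fun i => ?_) i
        · exact continuous_snd
        · simp only [Fin.cons_succ]
          fun_prop⟩
    have hgf : ∀ x, g (f x) = x := fun x => by
      funext i
      refine Fin.cases rfl (fun i => rfl) i
    have hf : Set.MapsTo f {0}ᶜ {0}ᶜ := fun x hx h => hx (by
      rw [Set.mem_singleton_iff] at h ⊢
      rw [← hgf x, h]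
      funext i
      refine Fin.cases rfl (fun i => rfl) i)
    have hg : Set.MapsTo g {0}ᶜ {0}ᶜ := fun x hx h => hx (by
      rw [Set.mem_singleton_iff] at h ⊢
      refine Prod.ext (funext fun i => congrFun h i.succ) (congrFun h 0))
    refine ⟨fun i hi => ?_, ?_⟩
    · obtain ⟨i, rfl⟩ := Nat.exists_eq_succ_of_ne_zero (Nat.ne_zero_of_lt hi)
      exact (relAcyclic_prod_real (ih.1 i (by omega))).of_retract hf hg
        fun c _ => map_comp_sub_mem hgf c
    · exact (relTorsionFree_prod_real ih.2).of_retract hf hg fun c _ => map_comp_sub_mem hgf c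

theorem localHomologyBound_euclideanSpace (n : ℕ) :
    LocalHomologyBound (EuclideanSpace ℝ (Fin n)) n := by
  intro a
  let f : C(EuclideanSpace ℝ (Fin n), Fin n → ℝ) :=
    ⟨fun x => WithLp.ofLp (x - a), by fun_prop⟩
  let g : C(Fin n → ℝ, EuclideanSpace ℝ (Fin n)) :=
    ⟨fun x => WithLp.toLp 2 x + a, by fun_prop⟩
  have hgf : ∀ x, g (f x) = x := fun x => sub_add_cancel x a
  have hf : Set.MapsTo f {a}ᶜ {0}ᶜ := fun x hx h => hx (by
    rw [Set.mem_singleton_iff] at h ⊢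
    rw [← hgf x, h]
    exact zero_add a)
  have hg : Set.MapsTo g {0}ᶜ {a}ᶜ := fun x hx h => hx (by
    rw [Set.mem_singleton_iff] at h ⊢
    have : WithLp.toLp 2 x + a = a := h
    simpa using this)
  exact ⟨fun i hi => ((localHomology_pi n).1 i hi).of_retract hf hg
    fun c _ => map_comp_sub_mem hgf c,
    (localHomology_pi n).2.of_retract hf hg fun c _ => map_comp_sub_mem hgf c⟩

/-! ### Radial deformations -/

/-- A chain involves finitely many simplices, each with compact image. -/
theorem exists_isCompact_mem_chainsIn {U : Set X} {c : SingularChain k X} (hc : c ∈ chainsIn U k) :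
    ∃ L, IsCompact L ∧ L ⊆ U ∧ c ∈ chainsIn L k := by
  refine ⟨⋃ σ ∈ c.support, Set.range σ, ?_, ?_, ?_⟩
  · exact c.support.finite_toSet.isCompact_biUnion fun σ _ => isCompact_range σ.continuous
  · exact Set.iUnion₂_subset fun σ hσ => (Finsupp.mem_supported ℤ c).1 hc hσ
  · exact (Finsupp.mem_supported ℤ c).2 fun σ hσ => by
      rintro _ ⟨t, rfl⟩
      exact Set.mem_biUnion hσ ⟨t, rfl⟩

/-- Up to a boundary, `c` is a chain `w` off `x`, and by compactness `w` avoids a ball around `x`. A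
radial push away from `x` moves `w` out of the bounded set `K`, and star-convexity keeps the
complement of `K` invariant meanwhile. -/
theorem mem_relBoundaries_compl_of_starConvex {V : Type u} [NormedAddCommGroup V] [NormedSpace ℝ V]
    {K : Set V} {x : V} (hK : StarConvex ℝ x K) (hb : Bornology.IsBounded K)
    {c : SingularChain k V} (hc : c ∈ relCycles Kᶜ k) (hx : c ∈ relBoundaries {x}ᶜ k) :
    c ∈ relBoundaries Kᶜ k := by
  obtain ⟨r, hr0, hr⟩ := hb.subset_closedBall_lt 0 x
  obtain ⟨a, w, hw, hcw⟩ := mem_relBoundaries.1 hx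
  obtain ⟨L, hL, hLx, hwL⟩ := exists_isCompact_mem_chainsIn hw
  obtain ⟨ε, hε, hball⟩ := Metric.isOpen_iff.1 hL.isClosed.isOpen_compl x fun h => hLx h rfl
  have hwc : w ∈ relCycles Kᶜ k := by
    rw [mem_relCycles, ← zero_add (boundaryFrom k w), ← boundaryFrom_boundary k a, ← map_add, ← hcw]
    exact hc
  -- At time one a point at distance at least `ε` from `x` has its distance increased by `r + 1`, so
  -- it leaves the ball of radius `r` containing `K`. The maximum with `ε` keeps the formula
  -- continuous at `x`.
  let F : C(V × SimplexInterval, V) :=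
    ⟨fun z => x + (1 + weight z.2 * ((r + 1) / max ‖z.1 - x‖ ε)) • (z.1 - x), by
      refine continuous_const.add (Continuous.smul ?_ (by fun_prop))
      refine continuous_const.add (Continuous.mul (by fun_prop) ?_)
      refine continuous_const.div (by fun_prop) fun z => ?_
      exact (lt_max_of_lt_right hε).ne'⟩
  have hF : ∀ y ∈ Kᶜ, ∀ t, F (y, t) ∈ Kᶜ := by
    intro y hy t hmem
    have hpos : 0 ≤ weight t * ((r + 1) / max ‖y - x‖ ε) := by
      have := weight_nonneg t
      have : 0 < max ‖y - x‖ ε := lt_max_of_lt_right hε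
      positivity
    set s := 1 + weight t * ((r + 1) / max ‖y - x‖ ε) with hs
    have hs1 : 1 ≤ s := by linarith
    refine hy ?_
    -- The point lies on the segment from `x` to its image, so an image in `K` would force it into
    -- `K`.
    have hy' : y = x + s⁻¹ • ((x + s • (y - x)) - x) := by
      rw [add_sub_cancel_left, smul_smul, inv_mul_cancel₀ (by linarith), one_smul,
        add_sub_cancel]
    rw [hy']
    exact hK.add_smul_sub_mem hmem (by positivity) (inv_le_one_of_one_le₀ hs1)
  have h0 : ∀ y, F (y, stdSimplex.vertex 0) = y := fun y => by
    change x + (1 + weight (stdSimplex.vertex (S := ℝ) (0 : Fin 2)) * _) • (y - x) = y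
    rw [weight_vertex_zero, zero_mul, add_zero, one_smul, add_sub_cancel]
  have h1 : map k (F.comp (cylinderEnd V 1)) w ∈ chainsIn Kᶜ k := by
    refine map_mem_chainsIn (A := L) (B := Kᶜ) (fun y hy hmem => ?_) hwL
    have hyε : ε ≤ ‖y - x‖ := by
      by_contra hlt
      refine hball ?_ hy
      rw [Metric.mem_ball, dist_eq_norm]
      exact not_le.1 hlt
    have hmem' : x + (1 + weight (stdSimplex.vertex (S := ℝ) (1 : Fin 2)) *
        ((r + 1) / max ‖y - x‖ ε)) • (y - x) ∈ K := hmem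
    rw [weight_vertex_one, one_mul, max_eq_left hyε] at hmem'
    have := hr hmem'
    have hpos : 0 < ‖y - x‖ := hε.trans_le hyε
    rw [Metric.mem_closedBall, dist_eq_norm, add_sub_cancel_left, norm_smul,
      Real.norm_of_nonneg (by positivity), add_mul, div_mul_cancel₀ _ hpos.ne'] at this
    linarith
  have h2 := Submodule.sub_mem _ (chainsIn_le_relBoundaries h1) (relHomotopy_id F hF h0 hwc)
  rw [sub_sub_cancel] at h2
  rw [hcw]
  exact Submodule.add_mem _ (boundary_mem_relBoundaries _) h2

end SingularChain

open SingularChain SimplexSpace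

/-! ### Homology of manifolds -/

/-- Every point has an open neighbourhood homeomorphic to `ℝⁿ`. -/
def LocallyEuclidean (n : ℕ) (X : Type u) [TopologicalSpace X] : Prop :=
  ∀ x : X, ∃ φ : C(EuclideanSpace ℝ (Fin n), X), IsOpenEmbedding φ ∧ φ 0 = x

namespace SingularChain

variable {n k : ℕ} {X : Type u} [TopologicalSpace X]

theorem range_union_compl_image {X : Type u} {Y : Type v} {φ : Y → X} (B : Set Y) :
    Set.range φ ∪ (φ '' B)ᶜ = Set.univ :=
  Set.eq_univ_of_forall fun x => by
    by_cases h : x ∈ Set.range φ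
    · exact Or.inl h
    · exact Or.inr fun ⟨y, _, hy⟩ => h ⟨y, hy⟩

theorem preimage_compl_image {X : Type u} {Y : Type v} {φ : Y → X} (hφ : Function.Injective φ)
    (B : Set Y) :
    φ ⁻¹' (φ '' B)ᶜ = Bᶜ := by
  rw [Set.preimage_compl, Set.preimage_image_eq _ hφ]

theorem preimage_compl_singleton {X : Type u} {Y : Type v} {φ : Y → X} (hφ : Function.Injective φ)
    (y : Y) :
    φ ⁻¹' {φ y}ᶜ = {y}ᶜ := by
  rw [← Set.image_singleton, preimage_compl_image hφ]

theorem LocallyEuclidean.localHomologyBound [T2Space X] (hX : LocallyEuclidean n X) :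
    LocalHomologyBound X n := by
  intro x
  obtain ⟨φ, hφ, rfl⟩ := hX x
  have hcover : Set.range φ ∪ {φ 0}ᶜ = Set.univ := by
    rw [← Set.image_singleton]
    exact range_union_compl_image _
  have hbound := localHomologyBound_euclideanSpace n 0
  have hpre := preimage_compl_singleton hφ.injective 0
  refine ⟨fun i hi c hc => ?_, fun a ha c hc hac => ?_⟩
  · obtain ⟨y, hy, hcy⟩ := exists_excision hφ isOpen_compl_singleton hcover hc
    rw [hpre] at hy
    have := map_mem_relBoundaries (f := φ) (C := {φ 0}ᶜ) (by
      rw [← hpre]; exact Set.mapsTo_preimage _ _) (hbound.1 i hi hy)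
    simpa using Submodule.add_mem _ hcy this
  · obtain ⟨y, hy, hcy⟩ := exists_excision hφ isOpen_compl_singleton hcover hc
    rw [hpre] at hy
    have h1 : map n φ (a • y) ∈ relBoundaries {φ 0}ᶜ n := by
      have := Submodule.sub_mem _ hac (Submodule.smul_mem _ a hcy)
      rwa [smul_sub, sub_sub_cancel, ← map_smul] at this
    have h2 := mem_relBoundaries_of_map hφ isOpen_compl_singleton hcover h1
    rw [hpre] at h2
    have := map_mem_relBoundaries (f := φ) (C := {φ 0}ᶜ) (by
      rw [← hpre]; exact Set.mapsTo_preimage _ _) (hbound.2 a ha y hy h2)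
    simpa using Submodule.add_mem _ hcy this

section Chart

variable [T2Space X] {φ : C(EuclideanSpace ℝ (Fin n), X)} (hφ : IsOpenEmbedding φ)
  {B : Set (EuclideanSpace ℝ (Fin n))} (hB : IsCompact B)
include hφ hB

/-- Excision moves the problem into the chart, where the radial push from `b` applies. -/
theorem mem_relBoundaries_image_of_convex (hBc : Convex ℝ B)
    {b : EuclideanSpace ℝ (Fin n)} (hb : b ∈ B) {c : SingularChain k X}
    (hc : c ∈ relCycles (φ '' B)ᶜ k) (hx : c ∈ relBoundaries {φ b}ᶜ k) :
    c ∈ relBoundaries (φ '' B)ᶜ k := by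
  have hopen : IsOpen (φ '' B)ᶜ := (hB.image φ.continuous).isClosed.isOpen_compl
  obtain ⟨y, hy, hcy⟩ := exists_excision hφ hopen (range_union_compl_image B) hc
  have hsub : (φ '' B)ᶜ ⊆ {φ b}ᶜ :=
    Set.compl_subset_compl.2 (Set.singleton_subset_iff.2 ⟨b, hb, rfl⟩)
  have h1 : map k φ y ∈ relBoundaries {φ b}ᶜ k := by
    simpa using Submodule.sub_mem _ hx (relBoundaries_mono hsub hcy)
  have h2 := mem_relBoundaries_of_map hφ isOpen_compl_singleton (by
    rw [← Set.image_singleton]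
    exact range_union_compl_image _) h1
  rw [preimage_compl_singleton hφ.injective] at h2
  rw [preimage_compl_image hφ.injective] at hy
  have h3 := mem_relBoundaries_compl_of_starConvex (hBc.starConvex hb) hB.isBounded hy h2
  have h4 := map_mem_relBoundaries (f := φ) (C := (φ '' B)ᶜ) (by
    rw [← preimage_compl_image hφ.injective B]; exact Set.mapsTo_preimage _ _) h3
  simpa using Submodule.add_mem _ hcy h4

end Chart

/-- `H_i(X, X \ K)` vanishes for `i > n`, and `H_n(X, X \ K)` is detected at the points of `K`. -/
def DetectedAtPoints (n : ℕ) (K : Set X) : Prop :=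
  (∀ i, n < i → RelAcyclic Kᶜ i) ∧
    ∀ c ∈ relCycles Kᶜ n, (∀ x ∈ K, c ∈ relBoundaries {x}ᶜ n) → c ∈ relBoundaries Kᶜ n

theorem DetectedAtPoints.empty : DetectedAtPoints n (∅ : Set X) := by
  have : ∀ i, ∀ c : SingularChain i X, c ∈ relBoundaries ∅ᶜ i := fun i c =>
    chainsIn_le_relBoundaries (by rw [Set.compl_empty, chainsIn_univ]; trivial)
  exact ⟨fun i _ c _ => this i c, fun c _ _ => this n c⟩

/-- Mayer–Vietoris for the complements. The vanishing for `K ∩ L` one degree higher makes both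
conclusions pass from `K` and `L` to the union; this is why vanishing above degree `n` is carried
along with detection. -/
theorem DetectedAtPoints.union {K L : Set X} (hK : IsClosed K) (hL : IsClosed L)
    (h1 : DetectedAtPoints n K) (h2 : DetectedAtPoints n L) (h3 : DetectedAtPoints n (K ∩ L)) :
    DetectedAtPoints n (K ∪ L) := by
  have h3' := h3.1
  rw [Set.compl_inter] at h3'
  refine ⟨fun i hi => ?_, fun c hc hx => ?_⟩
  · rw [Set.compl_union]
    exact RelAcyclic.inter hK.isOpen_compl hL.isOpen_compl (h3' _ (by omega)) (h1.1 i hi)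
      (h2.1 i hi)
  · have hcK : c ∈ relCycles Kᶜ n :=
      relCycles_mono (Set.compl_subset_compl.2 Set.subset_union_left) hc
    have hcL : c ∈ relCycles Lᶜ n :=
      relCycles_mono (Set.compl_subset_compl.2 Set.subset_union_right) hc
    rw [Set.compl_union]
    exact mem_relBoundaries_inter hK.isOpen_compl hL.isOpen_compl (h3' _ (Nat.lt_succ_self n))
      (h1.2 c hcK fun x hx' => hx x (Or.inl hx')) (h2.2 c hcL fun x hx' => hx x (Or.inr hx'))

section Chart

variable [T2Space X] (hX : LocallyEuclidean n X) {φ : C(EuclideanSpace ℝ (Fin n), X)}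
  (hφ : IsOpenEmbedding φ)
include hX hφ

theorem DetectedAtPoints.image_of_convex {B : Set (EuclideanSpace ℝ (Fin n))} (hB : IsCompact B)
    (hBc : Convex ℝ B) : DetectedAtPoints n (φ '' B) := by
  rcases B.eq_empty_or_nonempty with rfl | ⟨b, hb⟩
  · rw [Set.image_empty]
    exact .empty
  have hsub : (φ '' B)ᶜ ⊆ {φ b}ᶜ :=
    Set.compl_subset_compl.2 (Set.singleton_subset_iff.2 ⟨b, hb, rfl⟩)
  exact ⟨fun i hi c hc => mem_relBoundaries_image_of_convex hφ hB hBc hb hc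
      ((LocallyEuclidean.localHomologyBound hX (φ b)).1 i hi (relCycles_mono hsub hc)),
    fun c hc hx => mem_relBoundaries_image_of_convex hφ hB hBc hb hc (hx _ ⟨b, hb, rfl⟩)⟩

theorem DetectedAtPoints.image_biUnion {ι : Type*} (s : Finset ι)
    (B : ι → Set (EuclideanSpace ℝ (Fin n))) (hB : ∀ i, IsCompact (B i))
    (hBc : ∀ i, Convex ℝ (B i)) : DetectedAtPoints n (φ '' ⋃ i ∈ s, B i) := by
  classical
  induction s using Finset.induction_on generalizing B with
  | empty =>
    simpa using DetectedAtPoints.empty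
  | insert a s ha ih =>
    have h1 : IsClosed (φ '' B a) := ((hB a).image φ.continuous).isClosed
    have h2 : IsClosed (φ '' ⋃ i ∈ s, B i) :=
      ((s.finite_toSet.isCompact_biUnion fun i _ => hB i).image φ.continuous).isClosed
    rw [Finset.set_biUnion_insert, Set.image_union]
    refine DetectedAtPoints.union h1 h2 (.image_of_convex hX hφ (hB a) (hBc a)) (ih B hB hBc) ?_
    -- The intersection with the union is again a union of compact convex sets indexed by `s`, which
    -- is covered because the induction generalises over `B`.
    rw [← Set.image_inter hφ.injective, Set.inter_iUnion₂]
    exact ih (fun i => B a ∩ B i) (fun i => (hB a).inter (hB i)) fun i => (hBc a).inter (hBc i)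

/-- A relative cycle of the complement of `C` has its boundary in a compact set disjoint from `C`,
hence is still a relative cycle for a slightly larger finite union of closed balls, where the
previous lemma applies. -/
theorem DetectedAtPoints.image {C : Set (EuclideanSpace ℝ (Fin n))} (hC : IsCompact C) :
    DetectedAtPoints n (φ '' C) := by
  have key : ∀ i, ∀ c ∈ relCycles (φ '' C)ᶜ i,
      ∃ (t : Finset (EuclideanSpace ℝ (Fin n))) (ε : EuclideanSpace ℝ (Fin n) → ℝ),
        (∀ b ∈ t, b ∈ C ∧ 0 < ε b) ∧ C ⊆ ⋃ b ∈ t, Metric.closedBall b (ε b) ∧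
        c ∈ relCycles (φ '' ⋃ b ∈ t, Metric.closedBall b (ε b))ᶜ i := by
    intro i c hc
    obtain ⟨L, hL, hLC, hcL⟩ := exists_isCompact_mem_chainsIn (mem_relCycles.1 hc)
    have hopen : IsOpen (φ ⁻¹' Lᶜ) := hL.isClosed.isOpen_compl.preimage φ.continuous
    have hex : ∀ b, ∃ ε, 0 < ε ∧ (b ∈ C → Metric.closedBall b ε ⊆ φ ⁻¹' Lᶜ) := by
      intro b
      by_cases hb : b ∈ C
      · obtain ⟨ε, hε, h⟩ := Metric.nhds_basis_closedBall.mem_iff.1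
          (hopen.mem_nhds fun hbL => hLC hbL ⟨b, hb, rfl⟩)
        exact ⟨ε, hε, fun _ => h⟩
      · exact ⟨1, one_pos, fun h => absurd h hb⟩
    choose ε hε hεL using hex
    obtain ⟨t, htC, ht⟩ := hC.elim_nhds_subcover (fun b => Metric.closedBall b (ε b))
      fun b _ => Metric.closedBall_mem_nhds b (hε b)
    refine ⟨t, ε, fun b hb => ⟨htC b hb, hε b⟩, ht, chainsIn_mono ?_ _ hcL⟩
    rintro y hy ⟨b, hb, rfl⟩
    obtain ⟨a, ha, hba⟩ := Set.mem_iUnion₂.1 hb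
    exact hεL a (htC a ha) hba hy
  have hdet : ∀ (t : Finset (EuclideanSpace ℝ (Fin n))) (ε : EuclideanSpace ℝ (Fin n) → ℝ),
      DetectedAtPoints n (φ '' ⋃ b ∈ t, Metric.closedBall b (ε b)) := fun t ε =>
    .image_biUnion hX hφ t _ (fun b => isCompact_closedBall b _) fun b => convex_closedBall b _
  refine ⟨fun i hi c hc => ?_, fun c hc hx => ?_⟩
  · obtain ⟨t, ε, -, hCt, hct⟩ := key i c hc
    exact relBoundaries_mono (Set.compl_subset_compl.2 (Set.image_mono hCt))
      ((hdet t ε).1 i hi hct)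
  · obtain ⟨t, ε, htC, hCt, hct⟩ := key n c hc
    refine relBoundaries_mono (Set.compl_subset_compl.2 (Set.image_mono hCt))
      ((hdet t ε).2 c hct ?_)
    rintro _ ⟨y, hy, rfl⟩
    obtain ⟨b, hb, hyb⟩ := Set.mem_iUnion₂.1 hy
    have hsub : φ '' Metric.closedBall b (ε b) ⊆ φ '' ⋃ b ∈ t, Metric.closedBall b (ε b) :=
      Set.image_mono (Set.subset_biUnion_of_mem (u := fun b => Metric.closedBall b (ε b)) hb)
    -- A point of the enlarged set need not belong to `C`, but the centre of its ball does;
    -- triviality at the centre spreads over the ball by convexity.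
    have h1 := mem_relBoundaries_image_of_convex hφ (isCompact_closedBall b (ε b))
      (convex_closedBall b _) (Metric.mem_closedBall_self (htC b hb).2.le)
      (relCycles_mono (Set.compl_subset_compl.2 hsub) hct) (hx _ ⟨b, (htC b hb).1, rfl⟩)
    exact relBoundaries_mono (Set.compl_subset_compl.2
      (Set.singleton_subset_iff.2 (Set.mem_image_of_mem φ hyb))) h1

end Chart

/-! ### Compact subsets of manifolds and closed manifolds. -/

variable [T2Space X] (hX : LocallyEuclidean n X)
include hX

/-- Compactness reduces to sets inside charts. The property proved by induction speaks of all
compact subsets of a closed set, so that it also covers the intersections that arise when two pieces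
are joined. -/
theorem DetectedAtPoints.of_isCompact {K : Set X} (hK : IsCompact K) : DetectedAtPoints n K := by
  suffices ∃ s, IsClosed s ∧ K ⊆ s ∧ ∀ L, IsCompact L → L ⊆ s → DetectedAtPoints n L by
    obtain ⟨s, -, hKs, h⟩ := this
    exact h K hK hKs
  refine hK.induction_on (p := fun K => ∃ s, IsClosed s ∧ K ⊆ s ∧
    ∀ L, IsCompact L → L ⊆ s → DetectedAtPoints n L) ?_ ?_ ?_ ?_
  · refine ⟨∅, isClosed_empty, subset_rfl, fun L _ hL => ?_⟩
    rw [Set.subset_empty_iff.1 hL]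
    exact .empty
  · rintro s t hst ⟨s', h1, h2, h3⟩
    exact ⟨s', h1, hst.trans h2, h3⟩
  · rintro s t ⟨s', h1, h2, h3⟩ ⟨t', h1', h2', h3'⟩
    refine ⟨s' ∪ t', h1.union h1', Set.union_subset_union h2 h2', fun L hL hLst => ?_⟩
    have hs : IsCompact (L ∩ s') := hL.inter_right h1
    have ht : IsCompact (L ∩ t') := hL.inter_right h1'
    have := DetectedAtPoints.union hs.isClosed ht.isClosed (h3 _ hs Set.inter_subset_right)
      (h3' _ ht Set.inter_subset_right)
      (h3 _ (hs.inter ht) (Set.inter_subset_left.trans Set.inter_subset_right))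
    rwa [← Set.inter_union_distrib_left, Set.inter_eq_left.2 hLst] at this
  · intro x _
    obtain ⟨φ, hφ, rfl⟩ := hX x
    have hcb : IsCompact (φ '' Metric.closedBall 0 1) :=
      (isCompact_closedBall 0 1).image φ.continuous
    refine ⟨φ '' Metric.closedBall 0 1, mem_nhdsWithin_of_mem_nhds
      (hφ.isOpenMap.image_mem_nhds (Metric.closedBall_mem_nhds 0 one_pos)), _, hcb.isClosed,
      subset_rfl, fun L hL hLs => ?_⟩
    have hpre : IsCompact (Metric.closedBall 0 1 ∩ φ ⁻¹' L) :=
      (isCompact_closedBall _ _).inter_right (hL.isClosed.preimage φ.continuous)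
    have hLeq : L = φ '' (Metric.closedBall 0 1 ∩ φ ⁻¹' L) := by
      rw [Set.image_inter_preimage, Set.inter_eq_right.2 hLs]
    rw [hLeq]
    exact .image hX hφ hpre

/-- Inside a closed ball of a chart, triviality at one point is equivalent to triviality at any
other, through the convex case. -/
theorem mem_relBoundaries_locally (c : SingularChain n X) (hc : boundaryFrom n c = 0) (x : X) :
    ∃ U ∈ 𝓝 x, ∀ y ∈ U, c ∈ relBoundaries {y}ᶜ n ↔ c ∈ relBoundaries {x}ᶜ n := by
  obtain ⟨φ, hφ, rfl⟩ := hX x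
  have hcyc : ∀ A : Set X, c ∈ relCycles A n := fun A => by
    rw [mem_relCycles, hc]; exact Submodule.zero_mem _
  have key : ∀ a ∈ Metric.closedBall (0 : EuclideanSpace ℝ (Fin n)) 1,
      ∀ b ∈ Metric.closedBall (0 : EuclideanSpace ℝ (Fin n)) 1,
      c ∈ relBoundaries {φ a}ᶜ n → c ∈ relBoundaries {φ b}ᶜ n := fun a ha b hb h =>
    relBoundaries_mono (Set.compl_subset_compl.2
      (Set.singleton_subset_iff.2 (Set.mem_image_of_mem φ hb)))
      (mem_relBoundaries_image_of_convex hφ (isCompact_closedBall _ _) (convex_closedBall _ _) ha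
        (hcyc _) h)
  have h0 := Metric.mem_closedBall_self (x := (0 : EuclideanSpace ℝ (Fin n))) zero_le_one
  refine ⟨φ '' Metric.closedBall 0 1,
    hφ.isOpenMap.image_mem_nhds (Metric.closedBall_mem_nhds 0 one_pos), ?_⟩
  rintro _ ⟨a, ha, rfl⟩
  exact ⟨key a ha 0 h0, key 0 h0 a ha⟩

theorem isClopen_relBoundaries (c : SingularChain n X) (hc : boundaryFrom n c = 0) :
    IsClopen {x : X | c ∈ relBoundaries {x}ᶜ n} := by
  constructor
  · rw [← isOpen_compl_iff, isOpen_iff_mem_nhds]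
    intro x hx
    obtain ⟨U, hU, h⟩ := mem_relBoundaries_locally hX c hc x
    exact mem_of_superset hU fun y hy hy' => hx ((h y hy).1 hy')
  · rw [isOpen_iff_mem_nhds]
    intro x hx
    obtain ⟨U, hU, h⟩ := mem_relBoundaries_locally hX c hc x
    exact mem_of_superset hU fun y hy => (h y hy).2 hx

/-- Detection at points for the whole compact space: its complement is empty, so relative boundaries
are boundaries. -/
theorem exists_boundary_eq_of_forall [CompactSpace X] (c : SingularChain n X)
    (hc : boundaryFrom n c = 0) (h : ∀ x, c ∈ relBoundaries {x}ᶜ n) :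
    ∃ d, boundary n d = c := by
  have := (DetectedAtPoints.of_isCompact hX isCompact_univ).2 c (by
    rw [mem_relCycles, hc]; exact Submodule.zero_mem _) fun x _ => h x
  rw [Set.compl_univ, relBoundaries, chainsIn_empty, sup_bot_eq] at this
  exact this

/-- On a closed connected manifold, two cycles that generate all local homology groups agree up
to sign in homology. -/
theorem exists_boundary_eq_sub_or_add [CompactSpace X] [ConnectedSpace X] {c t : SingularChain n X}
    (hc : boundaryFrom n c = 0) (ht : boundaryFrom n t = 0)
    (hct : ∀ x, ∃ a : ℤ, c - a • t ∈ relBoundaries {x}ᶜ n)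
    (htc : ∀ x, ∃ a : ℤ, t - a • c ∈ relBoundaries {x}ᶜ n) :
    (∃ d, boundary n d = c - t) ∨ ∃ d, boundary n d = c + t := by
  have hcyc : ∀ A : Set X, t ∈ relCycles A n := fun A => by
    rw [mem_relCycles, ht]; exact Submodule.zero_mem _
  have key : ∀ x, c - t ∈ relBoundaries {x}ᶜ n ∨ c + t ∈ relBoundaries {x}ᶜ n := by
    intro x
    obtain ⟨a, ha⟩ := hct x
    obtain ⟨b, hb⟩ := htc x
    -- Locally `c = a t` and `t = b c`, so `1 - b a` annihilates the class of `t`.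
    have hab : (1 - b * a) • t ∈ relBoundaries {x}ᶜ n := by
      convert Submodule.add_mem _ hb (Submodule.smul_mem _ b ha) using 1
      rw [smul_sub, smul_smul, sub_smul, one_smul]
      abel
    by_cases h1 : 1 - b * a = 0
    · rcases Int.eq_one_or_neg_one_of_mul_eq_one' (show b * a = 1 by linarith) with h | h
      · left
        simpa [h.2] using ha
      · right
        simpa [h.2] using ha
    · left
      -- If the factor is nonzero, torsion-freeness makes the classes of `t` and `c` vanish at this
      -- point, so either sign would do.
      have h2 := (LocallyEuclidean.localHomologyBound hX x).2 _ h1 t (hcyc _) hab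
      have h3 : c ∈ relBoundaries {x}ᶜ n := by
        simpa using Submodule.add_mem _ ha (Submodule.smul_mem _ a h2)
      exact Submodule.sub_mem _ h3 h2
  -- Connectedness makes one sign work at every point.
  rcases isClopen_iff.1 (isClopen_relBoundaries hX (c - t) (by rw [map_sub, hc, ht, sub_zero]))
    with h | h
  · right
    refine exists_boundary_eq_of_forall hX _ (by rw [map_add, hc, ht, add_zero]) fun x => ?_
    refine (key x).resolve_left fun hx => ?_
    have : x ∈ {x : X | c - t ∈ relBoundaries {x}ᶜ n} := hx
    rw [h] at this
    exact this
  · left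
    refine exists_boundary_eq_of_forall hX _ (by rw [map_sub, hc, ht, sub_zero]) fun x => ?_
    have : x ∈ {x : X | c - t ∈ relBoundaries {x}ᶜ n} := by
      rw [h]; trivial
    exact this

/-- A closed oriented manifold has an integral fundamental cycle. -/
theorem exists_isFundamentalCycle [CompactSpace X] (o : HomologicalOrientation n X) :
    ∃ c, IsFundamentalCycle o c := by
  have hrep : ∀ x, ∃ r : SingularChain n X, ∃ hr : r ∈ relCycles {x}ᶜ n,
      relClass r hr = o.localClass x := fun x => by
    obtain ⟨⟨r, hr⟩, h⟩ := Submodule.Quotient.mk_surjective _ (o.localClass x)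
    exact ⟨r, hr, h⟩
  choose r hr hro using hrep
  have main : ∃ K, IsCompact K ∧ Set.univ ⊆ K ∧
      ∃ c ∈ relCycles Kᶜ n, ∀ x ∈ K, c - r x ∈ relBoundaries {x}ᶜ n := by
    refine isCompact_univ.induction_on (p := fun s => ∃ K, IsCompact K ∧ s ⊆ K ∧
      ∃ c ∈ relCycles Kᶜ n, ∀ x ∈ K, c - r x ∈ relBoundaries {x}ᶜ n) ?_ ?_ ?_ ?_
    · refine ⟨∅, isCompact_empty, subset_rfl, 0, Submodule.zero_mem _, fun x hx => hx.elim⟩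
    · rintro s t hst ⟨K, h1, h2, h3⟩
      exact ⟨K, h1, hst.trans h2, h3⟩
    · rintro s t ⟨K, hK, hsK, a, ha, hax⟩ ⟨L, hL, htL, b, hb, hbx⟩
      have hmono : ∀ {S T : Set X}, S ⊆ T → Tᶜ ⊆ Sᶜ := fun h => Set.compl_subset_compl.2 h
      -- The two local cycles agree over `K ∩ L` since they agree at each of its points; this is the
      -- condition for gluing.
      have hab : a - b ∈ relBoundaries (Kᶜ ∪ Lᶜ) n := by
        rw [← Set.compl_inter]
        refine (DetectedAtPoints.of_isCompact hX (hK.inter hL)).2 _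
          (Submodule.sub_mem _ (relCycles_mono (hmono Set.inter_subset_left) ha)
            (relCycles_mono (hmono Set.inter_subset_right) hb)) fun x hx => ?_
        simpa using Submodule.sub_mem _ (hax x hx.1) (hbx x hx.2)
      obtain ⟨c, hc, hca, hcb⟩ := exists_relCycle_glue hK.isClosed.isOpen_compl
        hL.isClosed.isOpen_compl ha hb hab
      rw [← Set.compl_union] at hc
      refine ⟨K ∪ L, hK.union hL, Set.union_subset_union hsK htL, c, hc, ?_⟩
      rintro x (hx | hx)
      · simpa using Submodule.add_mem _
          (relBoundaries_mono (hmono (Set.singleton_subset_iff.2 hx)) hca) (hax x hx)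
      · simpa using Submodule.add_mem _
          (relBoundaries_mono (hmono (Set.singleton_subset_iff.2 hx)) hcb) (hbx x hx)
    · intro x _
      obtain ⟨U, hU, c, hc, hcU⟩ := o.locallyConsistent x
      obtain ⟨K, hKx, hKU, hK⟩ := local_compact_nhds hU
      refine ⟨K, mem_nhdsWithin_of_mem_nhds hKx, K, hK, subset_rfl, c,
        relCycles_mono (Set.compl_subset_compl.2 hKU) hc, fun y hy => ?_⟩
      obtain ⟨hcy, h⟩ := hcU y (hKU hy)
      rw [← hro, relClass_eq_iff] at h
      exact h
  obtain ⟨K, -, hK, c, hc, hcx⟩ := main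
  have hc0 : boundaryFrom n c = 0 := by
    rw [mem_relCycles, Set.univ_subset_iff.1 hK, Set.compl_univ, chainsIn_empty] at hc
    exact hc
  refine ⟨c, hc0, fun x => ⟨?_, ?_⟩⟩
  · rw [mem_relCycles, hc0]
    exact Submodule.zero_mem _
  · rw [← hro, relClass_eq_iff]
    exact hcx x (hK trivial)

end SingularChain

open SingularChain SimplexSpace

/-! ### Locally Euclidean spaces and local homeomorphisms -/

section LocallyEuclidean

variable {n : ℕ} {X : Type u} [TopologicalSpace X] {Y : Type v} [TopologicalSpace Y]

theorem locallyEuclidean_of_openPartialHomeomorph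
    (h : ∀ x : X, ∃ e : OpenPartialHomeomorph X (EuclideanSpace ℝ (Fin n)), x ∈ e.source) :
    LocallyEuclidean n X := by
  intro x
  obtain ⟨e, he⟩ := h x
  obtain ⟨r, hr, hball⟩ := Metric.isOpen_iff.1 e.open_target (e x) (e.map_source he)
  -- A small ball in the target of the chart is itself homeomorphic to the whole Euclidean space.
  let ψ := (OpenPartialHomeomorph.univBall (e x) r).trans e.symm
  have hsource : ψ.source = Set.univ := by
    rw [OpenPartialHomeomorph.trans_source, OpenPartialHomeomorph.univBall_source, Set.univ_inter]
    refine Set.eq_univ_of_forall fun y => hball ?_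
    rw [← OpenPartialHomeomorph.univBall_target (e x) hr]
    exact OpenPartialHomeomorph.map_source _ (by simp)
  have hemb := ψ.isOpenEmbedding hsource
  refine ⟨⟨ψ, hemb.continuous⟩, hemb, ?_⟩
  change e.symm (OpenPartialHomeomorph.univBall (e x) r 0) = x
  rw [OpenPartialHomeomorph.univBall_apply_zero, e.left_inv he]

theorem LocallyEuclidean.exists_openPartialHomeomorph (h : LocallyEuclidean n X) (x : X) :
    ∃ e : OpenPartialHomeomorph X (EuclideanSpace ℝ (Fin n)), x ∈ e.source := by
  obtain ⟨φ, hφ, rfl⟩ := h x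
  exact ⟨(hφ.toOpenPartialHomeomorph φ).symm, by simp⟩

theorem LocallyEuclidean.of_isLocalHomeomorph (h : LocallyEuclidean n X) {q : Y → X}
    (hq : IsLocalHomeomorph q) : LocallyEuclidean n Y := by
  refine locallyEuclidean_of_openPartialHomeomorph fun y => ?_
  obtain ⟨e, he⟩ := h.exists_openPartialHomeomorph (q y)
  obtain ⟨e', he', rfl⟩ := hq y
  exact ⟨e'.trans e, by simp [he, he']⟩

theorem locallyEuclidean_of_chartedSpace [ChartedSpace (EuclideanSpace ℝ (Fin n)) X] :
    LocallyEuclidean n X :=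
  locallyEuclidean_of_openPartialHomeomorph fun x => ⟨chartAt _ x, mem_chart_source _ x⟩

theorem LocallyEuclidean.locallyPathConnectedSpace (h : LocallyEuclidean n X) :
    LocallyPathConnectedSpace X := by
  choose e he using h.exists_openPartialHomeomorph
  let _ : ChartedSpace (EuclideanSpace ℝ (Fin n)) X :=
    { atlas := Set.univ
      chartAt := e
      mem_chart_source := he
      chart_mem_atlas := fun _ => trivial }
  exact ChartedSpace.locallyPathConnectedSpace (EuclideanSpace ℝ (Fin n)) X

end LocallyEuclidean

instance (m : ℕ) : LocallyPathConnectedSpace (stdSimplex ℝ (Fin (m + 1))) :=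
  (convex_stdSimplex ℝ (Fin (m + 1))).locallyPathConnectedSpace

instance (m : ℕ) : ContractibleSpace (stdSimplex ℝ (Fin (m + 1))) :=
  (convex_stdSimplex ℝ (Fin (m + 1))).contractibleSpace ⟨_, (stdSimplex.vertex 0).2⟩

/-! ### Deck transformations of the universal covering -/

/-- Fibres of a covering map may be empty, so connectedness is needed: emptiness of the fibre is
locally constant, and the range is clopen. -/
theorem IsCoveringMap.surjective_of_connectedSpace {E : Type u} {M : Type v} [TopologicalSpace E]
    [TopologicalSpace M] [Nonempty E] [ConnectedSpace M] {p : E → M} (hp : IsCoveringMap p) :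
    Function.Surjective p := by
  rw [← Set.range_eq_univ]
  refine IsClopen.eq_univ ⟨?_, hp.isOpenMap.isOpen_range⟩ (Set.range_nonempty p)
  rw [← isOpen_compl_iff, isOpen_iff_mem_nhds]
  intro x hx
  obtain ⟨-, U, hxU, hU, -, H, hH⟩ := hp x
  refine mem_of_superset (hU.mem_nhds hxU) ?_
  rintro _ hyU ⟨e, rfl⟩
  exact hx ⟨_, (H ⟨e, hyU⟩).2.2⟩

theorem IsLocalHomeomorph.exists_isOpen_injOn {E : Type u} {M : Type v} [TopologicalSpace E]
    [TopologicalSpace M] {p : E → M} (hp : IsLocalHomeomorph p) (x : E) :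
    ∃ U, IsOpen U ∧ x ∈ U ∧ Set.InjOn p U := by
  obtain ⟨e, he, hpe⟩ := hp x
  exact ⟨e.source, e.open_source, he, hpe ▸ e.injOn⟩

theorem exists_lift_simplex {E : Type u} {M : Type v} [TopologicalSpace E] [TopologicalSpace M]
    {p : C(E, M)} (hp : IsCoveringMap p) (hsurj : Function.Surjective p) {k : ℕ}
    (σ : SingularSimplex k M) : ∃ τ : SingularSimplex k E, p.comp τ = σ := by
  obtain ⟨e, he⟩ := hsurj (σ (stdSimplex.vertex 0))
  obtain ⟨τ, ⟨-, h⟩, -⟩ := hp.existsUnique_continuousMap_lifts σ (stdSimplex.vertex 0) e he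
  exact ⟨τ, ContinuousMap.ext fun t => congrFun h t⟩

/-- The action of a group element as a continuous map. -/
def smulMap {Γ : Type u} [Group Γ] {E : Type v} [TopologicalSpace E] [MulAction Γ E]
    [ContinuousConstSMul Γ E] (g : Γ) : C(E, E) :=
  ⟨fun x => g • x, continuous_const_smul g⟩

namespace DeckGroup

variable {E : Type u} {M : Type v} [TopologicalSpace E] [TopologicalSpace M] {p : C(E, M)}

theorem apply_smul (g : DeckGroup p) (x : E) : p (g • x) = p x := g.2 x

theorem eq_of_smul_eq [PreconnectedSpace E] (hp : IsCoveringMap p) {g h : DeckGroup p} {x : E}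
    (hgh : g • x = h • x) : g = h := by
  have : (fun x : E => g • x) = fun x => h • x :=
    hp.eq_of_comp_eq (continuous_const_smul g) (continuous_const_smul h)
      (funext fun y => (apply_smul g y).trans (apply_smul h y).symm) x hgh
  exact Subtype.ext (Homeomorph.ext fun y => congrFun this y)

/-- Lift `p` through itself in both directions; uniqueness of lifts makes the two lifts mutually
inverse. -/
theorem exists_smul_eq [SimplyConnectedSpace E] [LocallyPathConnectedSpace E]
    (hp : IsCoveringMap p) {x y : E} (hxy : p x = p y) : ∃ g : DeckGroup p, g • x = y := by
  obtain ⟨f, ⟨hfx, hf⟩, -⟩ := hp.existsUnique_continuousMap_lifts p x y hxy.symm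
  obtain ⟨f', ⟨hfy, hf'⟩, -⟩ := hp.existsUnique_continuousMap_lifts p y x hxy
  have h1 : f' ∘ f = id := hp.eq_of_comp_eq (f'.continuous.comp f.continuous) continuous_id
    (by rw [← Function.comp_assoc, hf', hf, Function.comp_id]) x (by simp [hfx, hfy])
  have h2 : f ∘ f' = id := hp.eq_of_comp_eq (f.continuous.comp f'.continuous) continuous_id
    (by rw [← Function.comp_assoc, hf, hf', Function.comp_id]) y (by simp [hfx, hfy])
  let F : E ≃ₜ E :=
    { toFun := f
      invFun := f'
      left_inv := congrFun h1
      right_inv := congrFun h2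
      continuous_toFun := f.continuous
      continuous_invFun := f'.continuous }
  exact ⟨⟨F, congrFun hf⟩, hfx⟩

theorem exists_smulMap_comp_eq [SimplyConnectedSpace E] [LocallyPathConnectedSpace E]
    (hp : IsCoveringMap p) {k : ℕ} {σ τ : SingularSimplex k E} (h : p.comp σ = p.comp τ) :
    ∃ g : DeckGroup p, (smulMap g).comp σ = τ := by
  obtain ⟨g, hg⟩ := exists_smul_eq hp (DFunLike.congr_fun h (stdSimplex.vertex 0))
  refine ⟨g, DFunLike.coe_injective (hp.eq_of_comp_eq (map_continuous _) (map_continuous _)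
    (funext fun t => ?_) (stdSimplex.vertex 0) hg)⟩
  exact (apply_smul g _).trans (DFunLike.congr_fun h t)

theorem eq_of_smulMap_comp_eq [PreconnectedSpace E] (hp : IsCoveringMap p) {k : ℕ}
    {σ : SingularSimplex k E} {g h : DeckGroup p} (hgh : (smulMap g).comp σ = (smulMap h).comp σ) :
    g = h :=
  eq_of_smul_eq hp (DFunLike.congr_fun hgh (stdSimplex.vertex 0))

end DeckGroup

/-! ### Intermediate coverings -/

/-- A covering `base : N → M` together with an identification of `N` with the orbit space of the
universal covering under a group `Λ` of deck transformations. -/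
structure OrbitCover {E M : Type u} [TopologicalSpace E] [TopologicalSpace M] (p : C(E, M))
    (Λ : Subgroup (DeckGroup p)) (N : Type u) [TopologicalSpace N] where
  /-- The projection from the universal covering. -/
  proj : C(E, N)
  /-- The projection to the base. -/
  base : C(N, M)
  base_proj : ∀ x, base (proj x) = p x
  surjective_proj : Function.Surjective proj
  isOpenMap_proj : IsOpenMap proj
  proj_eq_iff : ∀ x y, proj x = proj y ↔ ∃ g ∈ Λ, g • x = y

namespace OrbitCover

variable {E M : Type u} [TopologicalSpace E] [TopologicalSpace M] {p : C(E, M)}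
  {Λ : Subgroup (DeckGroup p)} {N : Type u} [TopologicalSpace N] (C : OrbitCover p Λ N)
include C

theorem proj_smul {g : DeckGroup p} (hg : g ∈ Λ) (x : E) : C.proj (g • x) = C.proj x :=
  ((C.proj_eq_iff _ _).2 ⟨g, hg, rfl⟩).symm

/-- An open set on which `p` is injective meets none of its translates by nontrivial deck
transformations, so the action of `Λ` is properly discontinuous. -/
theorem isCoveringMap_proj [PreconnectedSpace E] (hp : IsCoveringMap p) : IsCoveringMap C.proj := by
  have : IsQuotientCoveringMap C.proj Λ :=
    { toIsQuotientMap := C.isOpenMap_proj.isQuotientMap C.proj.continuous C.surjective_proj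
      continuous_const_smul := fun g => continuous_const_smul (g : DeckGroup p)
      apply_eq_iff_mem_orbit := fun {x y} => by
        rw [eq_comm, C.proj_eq_iff]
        exact ⟨fun ⟨g, hg, h⟩ => ⟨⟨g, hg⟩, h⟩, fun ⟨g, h⟩ => ⟨g.1, g.2, h⟩⟩
      disjoint := fun x => by
        obtain ⟨U, hU, hxU, hinj⟩ := hp.isLocalHomeomorph.exists_isOpen_injOn x
        refine ⟨U, hU.mem_nhds hxU, fun g => ?_⟩
        rintro ⟨_, ⟨y, hy, rfl⟩, hgy⟩
        have : (g : DeckGroup p) • y = (1 : DeckGroup p) • y := by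
          rw [one_smul]
          exact hinj hgy hy (DeckGroup.apply_smul _ _)
        exact Subtype.ext (DeckGroup.eq_of_smul_eq hp this) }
  exact this.isCoveringMap

theorem isLocalHomeomorph_base [PreconnectedSpace E] (hp : IsCoveringMap p) :
    IsLocalHomeomorph C.base := by
  rw [isLocalHomeomorph_iff_isLocalHomeomorphOn_univ, ← C.surjective_proj.range_eq,
    ← Set.image_univ]
  refine IsLocalHomeomorphOn.of_comp_right ?_
    (C.isCoveringMap_proj hp).isLocalHomeomorph.isLocalHomeomorphOn
  have : C.base ∘ C.proj = p := funext C.base_proj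
  rw [this]
  exact hp.isLocalHomeomorph.isLocalHomeomorphOn

theorem exists_lift (y : N) : ∃ x, C.proj x = y := C.surjective_proj y

/-- Points with different images are separated in `M`. Two points over the same point of `M` lift to
`x` and `g • x`; images of `U` and `g • U` separate them when `p` is injective on `U`. -/
theorem t2Space [T2Space M] [SimplyConnectedSpace E] [LocallyPathConnectedSpace E]
    (hp : IsCoveringMap p) : T2Space N := by
  refine ⟨fun y y' hyy' => ?_⟩
  by_cases hb : C.base y = C.base y'
  · obtain ⟨x, rfl⟩ := C.exists_lift y
    obtain ⟨x', rfl⟩ := C.exists_lift y'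
    rw [C.base_proj, C.base_proj] at hb
    obtain ⟨g, rfl⟩ := DeckGroup.exists_smul_eq hp hb
    obtain ⟨U, hU, hxU, hinj⟩ := hp.isLocalHomeomorph.exists_isOpen_injOn x
    refine ⟨C.proj '' U, C.proj '' ((fun x => g • x) '' U), C.isOpenMap_proj _ hU,
      C.isOpenMap_proj _ ((isOpenMap_smul g) _ hU), ⟨x, hxU, rfl⟩, ⟨_, ⟨x, hxU, rfl⟩, rfl⟩, ?_⟩
    rw [Set.disjoint_left]
    rintro _ ⟨u, hu, rfl⟩ ⟨_, ⟨u', hu', rfl⟩, huu'⟩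
    obtain ⟨l, hl, hlu⟩ := (C.proj_eq_iff _ _).1 huu'.symm
    have : u = u' := hinj hu hu' (by
      rw [← DeckGroup.apply_smul l u, hlu]
      exact DeckGroup.apply_smul g u')
    subst this
    obtain rfl := DeckGroup.eq_of_smul_eq hp hlu
    exact hyy' (C.proj_smul hl x).symm
  · obtain ⟨U, V, hU, hV, hyU, hyV, hUV⟩ := t2_separation hb
    exact ⟨_, _, hU.preimage C.base.continuous, hV.preimage C.base.continuous, hyU, hyV,
      hUV.preimage _⟩

theorem connectedSpace [ConnectedSpace E] : ConnectedSpace N :=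
  C.surjective_proj.connectedSpace C.proj.continuous

/-- Local compactness upstairs gives a compact set `K` that surjects onto `M`; finitely many
translates of `K`, one for each coset, then cover the orbit space. -/
theorem compactSpace [CompactSpace M] [ConnectedSpace M] [SimplyConnectedSpace E] {n : ℕ}
    (hM : LocallyEuclidean n M) (hp : IsCoveringMap p) [Λ.FiniteIndex] : CompactSpace N := by
  have hE : LocallyEuclidean n E := hM.of_isLocalHomeomorph hp.isLocalHomeomorph
  have := hE.locallyPathConnectedSpace
  have hK : ∃ K : Set E, IsCompact K ∧ p '' K = Set.univ := by
    have hex : ∀ x : M, ∃ D : Set E, IsCompact D ∧ p '' D ∈ 𝓝 x := fun x => by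
      obtain ⟨e, rfl⟩ := hp.surjective_of_connectedSpace x
      obtain ⟨φ, hφ, rfl⟩ := hE e
      refine ⟨φ '' Metric.closedBall 0 1, (isCompact_closedBall _ _).image φ.continuous, ?_⟩
      exact hp.isOpenMap.image_mem_nhds
        (hφ.isOpenMap.image_mem_nhds (Metric.closedBall_mem_nhds 0 one_pos))
    choose D hD hDx using hex
    obtain ⟨t, ht⟩ := CompactSpace.elim_nhds_subcover (fun x => p '' D x) hDx
    refine ⟨⋃ x ∈ t, D x, t.finite_toSet.isCompact_biUnion fun x _ => hD x, ?_⟩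
    rw [Set.image_iUnion₂]
    exact Set.eq_univ_of_univ_subset (by simpa using ht.ge)
  obtain ⟨K, hK, hpK⟩ := hK
  have hfin : Finite (DeckGroup p ⧸ Λ) := inferInstance
  have hcover : (⋃ c : DeckGroup p ⧸ Λ, (fun x => C.proj ((Quotient.out c)⁻¹ • x)) '' K) =
      Set.univ := by
    refine Set.eq_univ_of_forall fun y => ?_
    obtain ⟨x, rfl⟩ := C.exists_lift y
    obtain ⟨k, hk, hkx⟩ := (Set.ext_iff.1 hpK (p x)).2 trivial
    obtain ⟨g, rfl⟩ := DeckGroup.exists_smul_eq hp hkx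
    refine Set.mem_iUnion.2 ⟨(g⁻¹ : DeckGroup p), k, hk, ?_⟩
    obtain ⟨l, hl⟩ := QuotientGroup.mk_out_eq_mul Λ g⁻¹
    change C.proj ((Quotient.out (QuotientGroup.mk g⁻¹ : DeckGroup p ⧸ Λ))⁻¹ • k) = _
    rw [hl, mul_inv_rev, inv_inv, mul_smul]
    exact C.proj_smul (Λ.inv_mem l.2) _
  rw [← isCompact_univ_iff, ← hcover]
  exact isCompact_iUnion fun c =>
    hK.image (C.proj.continuous.comp (continuous_const_smul _))

end OrbitCover

open SingularChain SimplexSpace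

/-! ### Fundamental cycles and boundaries -/

namespace SingularChain

variable {n : ℕ} {X : Type u} [TopologicalSpace X]

theorem boundaryFrom_boundary_eq_zero (d : SingularChain (n + 1) X) :
    boundaryFrom n (boundary n d) = 0 := by
  cases n with
  | zero => rfl
  | succ m => exact boundary_boundary _ d

theorem mem_relCycles_of_boundaryFrom_eq_zero {c : SingularChain n X} (hc : boundaryFrom n c = 0)
    (A : Set X) : c ∈ relCycles A n := by
  rw [mem_relCycles, hc]
  exact Submodule.zero_mem _

theorem boundary_mem_relBoundaries_of_eq (A : Set X) (d : SingularChain (n + 1) X) :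
    boundary n d ∈ relBoundaries A n :=
  mem_relBoundaries.2 ⟨d, 0, Submodule.zero_mem _, (add_zero _).symm⟩

end SingularChain

section FundamentalCycle

variable {n : ℕ} {X : Type u} [TopologicalSpace X] {o : HomologicalOrientation n X}
  {c : SingularChain n X}

theorem IsFundamentalCycle.add_boundary (hc : IsFundamentalCycle o c)
    (d : SingularChain (n + 1) X) : IsFundamentalCycle o (c + boundary n d) := by
  have h0 : boundaryFrom n (c + boundary n d) = 0 := by
    rw [map_add, hc.1, boundaryFrom_boundary_eq_zero, add_zero]
  refine ⟨h0, fun x => ⟨mem_relCycles_of_boundaryFrom_eq_zero h0 _, ?_⟩⟩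
  obtain ⟨hcx, h⟩ := hc.2 x
  rw [← h, relClass_eq_iff, add_sub_cancel_left]
  exact boundary_mem_relBoundaries_of_eq _ d

theorem IsFundamentalCycle.generates (hc : IsFundamentalCycle o c) (x : X) {b : SingularChain n X}
    (hb : b ∈ relCycles {x}ᶜ n) : ∃ a : ℤ, b - a • c ∈ relBoundaries {x}ᶜ n := by
  obtain ⟨hcx, h⟩ := hc.2 x
  have hmem : relClass b hb ∈ Submodule.span ℤ {o.localClass x} := by
    rw [o.generates]
    trivial
  obtain ⟨a, ha⟩ := Submodule.mem_span_singleton.1 hmem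
  refine ⟨a, ?_⟩
  rw [← h] at ha
  have : relClass (a • c) (Submodule.smul_mem _ a hcx) = relClass b hb := ha
  exact (relClass_eq_iff _ _).1 this.symm

/-- The orientation determined by a cycle that generates all local homology groups. -/
def HomologicalOrientation.ofCycle (c : SingularChain n X) (hc : boundaryFrom n c = 0)
    (h : ∀ x, ∀ b ∈ relCycles {x}ᶜ n, ∃ a : ℤ, b - a • c ∈ relBoundaries {x}ᶜ n) :
    HomologicalOrientation n X where
  localClass x := relClass c (mem_relCycles_of_boundaryFrom_eq_zero hc _)
  generates x := by
    refine eq_top_iff.2 fun y _ => ?_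
    obtain ⟨⟨b, hb⟩, rfl⟩ := Submodule.Quotient.mk_surjective _ y
    obtain ⟨a, ha⟩ := h x b hb
    refine Submodule.mem_span_singleton.2 ⟨a, ?_⟩
    exact ((relClass_eq_iff hb (Submodule.smul_mem _ a
      (mem_relCycles_of_boundaryFrom_eq_zero hc _))).2 ha).symm
  locallyConsistent x := ⟨Set.univ, univ_mem, c, mem_relCycles_of_boundaryFrom_eq_zero hc _,
    fun _ _ => ⟨mem_relCycles_of_boundaryFrom_eq_zero hc _, rfl⟩⟩

theorem HomologicalOrientation.isFundamentalCycle_ofCycle (c : SingularChain n X)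
    (hc : boundaryFrom n c = 0)
    (h : ∀ x, ∀ b ∈ relCycles {x}ᶜ n, ∃ a : ℤ, b - a • c ∈ relBoundaries {x}ᶜ n) :
    IsFundamentalCycle (HomologicalOrientation.ofCycle c hc h) c :=
  ⟨hc, fun _ => ⟨mem_relCycles_of_boundaryFrom_eq_zero hc _, rfl⟩⟩

theorem SingularChain.l1Norm_neg (c : SingularChain n X) : l1Norm (-c) = l1Norm c := by
  simp [l1Norm, Finsupp.sum_neg_index]

/-- The integral simplicial volume can be computed with any one cycle that generates all local
homology groups. -/
theorem integralSimplicialVolume_eq [CompactSpace X] [ConnectedSpace X] [T2Space X]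
    (hX : LocallyEuclidean n X) (hc : boundaryFrom n c = 0)
    (h : ∀ x, ∀ b ∈ relCycles {x}ᶜ n, ∃ a : ℤ, b - a • c ∈ relBoundaries {x}ᶜ n) :
    integralSimplicialVolume n X = ⨅ d : SingularChain (n + 1) X, l1Norm (c + boundary n d) := by
  refine le_antisymm (le_iInf fun d => ?_) (le_iInf fun o => le_iInf fun b => le_iInf fun hb => ?_)
  · exact iInf_le_of_le _ (iInf_le_of_le _ (iInf_le _
      ((HomologicalOrientation.isFundamentalCycle_ofCycle c hc h).add_boundary d)))
  · rcases exists_boundary_eq_sub_or_add hX hb.1 hc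
      (fun x => h x b (mem_relCycles_of_boundaryFrom_eq_zero hb.1 _))
      (fun x => hb.generates x (mem_relCycles_of_boundaryFrom_eq_zero hc _)) with
      ⟨d, hd⟩ | ⟨d, hd⟩
    · refine iInf_le_of_le d (le_of_eq ?_)
      rw [hd]
      congr 1
      abel
    -- Here `b` represents the opposite orientation; its negative has the same norm.
    · refine iInf_le_of_le (-d) (le_of_eq ?_)
      rw [map_neg, hd, ← l1Norm_neg b]
      congr 1
      abel

end FundamentalCycle

/-! ### The transfer -/

namespace OrbitCover

variable {E M : Type u} [TopologicalSpace E] [TopologicalSpace M] {p : C(E, M)}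
  {Λ : Subgroup (DeckGroup p)} {N : Type u} [TopologicalSpace N] (C : OrbitCover p Λ N)

/-- The maps `x ↦ proj (g⁻¹ • x)`, which depend on `g Λ` only. -/
def sheet (a : DeckGroup p ⧸ Λ) : C(E, N) := C.proj.comp (smulMap (Quotient.out a)⁻¹)

theorem sheet_mk (g : DeckGroup p) (x : E) :
    C.sheet (g : DeckGroup p ⧸ Λ) x = C.proj (g⁻¹ • x) := by
  obtain ⟨l, hl⟩ := QuotientGroup.mk_out_eq_mul Λ g
  change C.proj ((Quotient.out (QuotientGroup.mk g : DeckGroup p ⧸ Λ))⁻¹ • x) = _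
  rw [hl, mul_inv_rev, mul_smul]
  exact C.proj_smul (Λ.inv_mem l.2) _

theorem sheet_smul (a : DeckGroup p ⧸ Λ) (g : DeckGroup p) (x : E) :
    C.sheet a (g • x) = C.sheet (g⁻¹ • a) x := by
  induction a using QuotientGroup.induction_on with
  | H h =>
    change _ = C.sheet ((g⁻¹ * h : DeckGroup p) : DeckGroup p ⧸ Λ) x
    rw [sheet_mk, sheet_mk, mul_inv_rev, inv_inv, mul_smul]

theorem base_sheet (a : DeckGroup p ⧸ Λ) (x : E) : C.base (C.sheet a x) = p x :=
  (C.base_proj _).trans (DeckGroup.apply_smul _ _)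

theorem sheet_one (x : E) : C.sheet ((1 : DeckGroup p) : DeckGroup p ⧸ Λ) x = C.proj x := by
  rw [sheet_mk, inv_one, one_smul]

theorem sheet_injective_left [SimplyConnectedSpace E] (hp : IsCoveringMap p) {x : E}
    {a b : DeckGroup p ⧸ Λ} (h : C.sheet a x = C.sheet b x) : a = b := by
  induction a using QuotientGroup.induction_on with
  | H g =>
    induction b using QuotientGroup.induction_on with
    | H g' =>
      rw [sheet_mk, sheet_mk, C.proj_eq_iff] at h
      obtain ⟨l, hl, h⟩ := h
      rw [← mul_smul] at h
      have := DeckGroup.eq_of_smul_eq hp h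
      refine QuotientGroup.eq.2 ?_
      have h2 : g⁻¹ * g' = l⁻¹ := by
        rw [eq_inv_iff_mul_eq_one, eq_comm, mul_assoc]
        have h3 : g' * l = g := by
          have := congrArg (fun t => t⁻¹) this
          simp only [mul_inv_rev, inv_inv] at this
          rw [← this]
          group
        rw [h3]
        group
      rw [h2]
      exact Λ.inv_mem hl

variable [Λ.FiniteIndex]

/-- The sum of the chain maps induced by all `sheet a`. -/
def sheetSum (k : ℕ) : SingularChain k E →ₗ[ℤ] SingularChain k N :=
  letI := Λ.fintypeQuotientOfFiniteIndex
  ∑ a : DeckGroup p ⧸ Λ, map k (C.sheet a)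

theorem sheetSum_apply [Fintype (DeckGroup p ⧸ Λ)] (k : ℕ) (c : SingularChain k E) :
    C.sheetSum k c = ∑ a : DeckGroup p ⧸ Λ, map k (C.sheet a) c := by
  rw [sheetSum, LinearMap.sum_apply]
  congr!

/-- A deck transformation permutes the cosets. Thus the sum over all sheets depends only on the
projection of a chain to `M`. -/
theorem sheetSum_smul (k : ℕ) (g : DeckGroup p) (c : SingularChain k E) :
    C.sheetSum k (map k (smulMap g) c) = C.sheetSum k c := by
  let := Λ.fintypeQuotientOfFiniteIndex
  rw [sheetSum_apply, sheetSum_apply]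
  refine Fintype.sum_equiv (MulAction.toPerm g⁻¹) _ _ fun a => ?_
  rw [SingularChain.map_map]
  congr 2
  exact ContinuousMap.ext fun x => C.sheet_smul a g x

theorem boundary_sheetSum (k : ℕ) (c : SingularChain (k + 1) E) :
    boundary k (C.sheetSum (k + 1) c) = C.sheetSum k (boundary k c) := by
  let := Λ.fintypeQuotientOfFiniteIndex
  simp_rw [sheetSum_apply, map_sum, boundary_map]

omit [Λ.FiniteIndex] in
variable (p) in
open Classical in
/-- A choice of lifts of singular chains to the universal covering. -/
def _root_.SingularChain.liftChain (k : ℕ) : SingularChain k M →ₗ[ℤ] SingularChain k E :=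
  Finsupp.linearCombination ℤ fun σ : SingularSimplex k M =>
    if h : ∃ τ : SingularSimplex k E, p.comp τ = σ then Finsupp.single h.choose 1 else 0

omit [Λ.FiniteIndex] in
theorem _root_.SingularChain.liftChain_single {k : ℕ} (σ : SingularSimplex k E) :
    ∃ τ : SingularSimplex k E, p.comp τ = p.comp σ ∧
      liftChain p k (Finsupp.single (p.comp σ) 1) = Finsupp.single τ 1 := by
  have h : ∃ τ : SingularSimplex k E, p.comp τ = p.comp σ := ⟨σ, rfl⟩
  refine ⟨h.choose, h.choose_spec, ?_⟩
  rw [liftChain, Finsupp.linearCombination_single, one_smul, dif_pos h]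

theorem _root_.SingularChain.map_liftChain [ConnectedSpace M] [Nonempty E] (hp : IsCoveringMap p)
    {k : ℕ} (c : SingularChain k M) : map k p (liftChain p k c) = c := by
  refine LinearMap.congr_fun (f := map k p ∘ₗ liftChain p k) (g := LinearMap.id) ?_ c
  refine hom_ext fun σ => ?_
  obtain ⟨τ, rfl⟩ := exists_lift_simplex hp hp.surjective_of_connectedSpace σ
  obtain ⟨τ', h, h'⟩ := liftChain_single (p := p) τ
  rw [LinearMap.comp_apply, h', map_single, h]
  rfl

/-- The transfer homomorphism, which sends a simplex of the base to the sum of its lifts. -/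
def transfer (k : ℕ) : SingularChain k M →ₗ[ℤ] SingularChain k N :=
  C.sheetSum k ∘ₗ liftChain p k

/-- Two lifts of a simplex differ by a deck transformation, which `sheetSum` does not see; the
choice of lifts is irrelevant. -/
theorem transfer_map [SimplyConnectedSpace E] [LocallyPathConnectedSpace E] (hp : IsCoveringMap p)
    {k : ℕ} (c : SingularChain k E) : C.transfer k (map k p c) = C.sheetSum k c := by
  refine LinearMap.congr_fun (f := C.transfer k ∘ₗ map k p) (g := C.sheetSum k) ?_ c
  refine hom_ext fun σ => ?_
  obtain ⟨τ, h, h'⟩ := liftChain_single (p := p) σ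
  obtain ⟨g, rfl⟩ := DeckGroup.exists_smulMap_comp_eq hp h.symm
  rw [LinearMap.comp_apply, map_single, transfer, LinearMap.comp_apply, h', ← map_single,
    sheetSum_smul]

/-- The chosen lifts need not be compatible with faces, so the chain is first written as a
projection, where the transfer becomes `sheetSum`. -/
theorem boundary_transfer [SimplyConnectedSpace E] [LocallyPathConnectedSpace E]
    [ConnectedSpace M] (hp : IsCoveringMap p) {k : ℕ} (c : SingularChain (k + 1) M) :
    boundary k (C.transfer (k + 1) c) = C.transfer k (boundary k c) := by
  obtain ⟨c, rfl⟩ : ∃ b, map (k + 1) p b = c := ⟨_, map_liftChain hp c⟩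
  rw [transfer_map C hp, boundary_sheetSum, boundary_map, transfer_map C hp]

theorem transfer_mem_chainsIn [SimplyConnectedSpace E] [LocallyPathConnectedSpace E]
    [ConnectedSpace M] (hp : IsCoveringMap p) {k : ℕ} {A : Set M} {c : SingularChain k M}
    (hc : c ∈ chainsIn A k) : C.transfer k c ∈ chainsIn (C.base ⁻¹' A) k := by
  let := Λ.fintypeQuotientOfFiniteIndex
  refine Finsupp.apply_mem_of_mem_supported _ _ (fun σ hσ => ?_) hc
  obtain ⟨τ, rfl⟩ := exists_lift_simplex hp hp.surjective_of_connectedSpace σ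
  rw [← map_single, transfer_map C hp, sheetSum_apply]
  refine Submodule.sum_mem _ fun a _ => ?_
  rw [map_single]
  refine single_mem_chainsIn ?_ _
  rintro _ ⟨t, rfl⟩
  refine hσ ⟨t, ?_⟩
  exact (C.base_sheet a _).symm

theorem transfer_mem_relBoundaries [SimplyConnectedSpace E] [LocallyPathConnectedSpace E]
    [ConnectedSpace M] (hp : IsCoveringMap p) {k : ℕ} {A : Set M} {c : SingularChain k M}
    (hc : c ∈ relBoundaries A k) : C.transfer k c ∈ relBoundaries (C.base ⁻¹' A) k := by
  obtain ⟨d, w, hw, rfl⟩ := mem_relBoundaries.1 hc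
  refine mem_relBoundaries.2 ⟨C.transfer (k + 1) d, _, C.transfer_mem_chainsIn hp hw, ?_⟩
  rw [map_add, boundary_transfer C hp]

/-- Inside an evenly covered sheet, the transfer inverts the projection up to chains outside the
sheet. -/
theorem transfer_map_sub_mem_chainsIn [SimplyConnectedSpace E] [LocallyPathConnectedSpace E]
    [ConnectedSpace M] (hp : IsCoveringMap p) {k : ℕ} {V : Type u} [TopologicalSpace V]
    (ι : C(V, N)) (hinj : Set.InjOn C.base (Set.range ι)) (c : SingularChain k V) :
    C.transfer k (map k (C.base.comp ι) c) - map k ι c ∈ chainsIn (Set.range ι)ᶜ k := by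
  classical
  let := Λ.fintypeQuotientOfFiniteIndex
  refine Finsupp.apply_mem_of_mem_supported
    (C.transfer k ∘ₗ map k (C.base.comp ι) - map k ι) _ (s := Set.univ) (fun τ _ => ?_)
    (Finsupp.mem_supported _ _ |>.2 (Set.subset_univ _))
  obtain ⟨σ, hσ⟩ := exists_lift_simplex (C.isCoveringMap_proj hp) C.surjective_proj (ι.comp τ)
  have hσ' : (C.base.comp ι).comp τ = p.comp σ := by
    rw [ContinuousMap.comp_assoc, ← hσ]
    exact ContinuousMap.ext fun t => C.base_proj _
  rw [LinearMap.sub_apply, LinearMap.comp_apply, map_single, hσ', ← map_single, transfer_map C hp,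
    sheetSum_apply, ← Finset.add_sum_erase _ _ (Finset.mem_univ ((1 : DeckGroup p) :
      DeckGroup p ⧸ Λ))]
  have h1 : map k (C.sheet ((1 : DeckGroup p) : DeckGroup p ⧸ Λ)) (Finsupp.single σ 1) =
      map k ι (Finsupp.single τ 1) := by
    rw [map_single, map_single, ← hσ]
    congr 1
    exact ContinuousMap.ext fun t => C.sheet_one _
  rw [h1, add_sub_cancel_left]
  -- The other sheets of a simplex avoid the range of `ι`: `base` is injective there and distinct
  -- sheets differ at every point.
  refine Submodule.sum_mem _ fun a ha => ?_
  rw [map_single]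
  refine single_mem_chainsIn ?_ _
  rintro _ ⟨t, rfl⟩ hmem
  refine (Finset.ne_of_mem_erase ha) (C.sheet_injective_left hp (x := σ t) ?_)
  rw [sheet_one]
  have ht : C.proj (σ t) = ι (τ t) := DFunLike.congr_fun hσ t
  refine hinj hmem ⟨τ t, ht.symm⟩ ?_
  rw [base_proj]
  exact C.base_sheet _ _

/-- The transfer of a fundamental cycle generates all local homology groups. -/
theorem transfer_generates [SimplyConnectedSpace E] [LocallyPathConnectedSpace E]
    [ConnectedSpace M] [T1Space N] (hp : IsCoveringMap p) {n : ℕ} {o : HomologicalOrientation n M}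
    {z : SingularChain n M} (hz : IsFundamentalCycle o z) (y : N) (b : SingularChain n N)
    (hb : b ∈ relCycles {y}ᶜ n) :
    ∃ a : ℤ, b - a • C.transfer n z ∈ relBoundaries {y}ᶜ n := by
  -- Excise `b` into an open set on which `base` is injective, push it down to `M`, compare it with
  -- the fundamental cycle there, and transfer the comparison back.
  obtain ⟨V, hV, hyV, hinj⟩ := (C.isLocalHomeomorph_base hp).exists_isOpen_injOn y
  let ι : C(V, N) := ⟨Subtype.val, continuous_subtype_val⟩
  have hrange : Set.range ι = V := Subtype.range_val
  obtain ⟨b', hb', hbb'⟩ := exists_excision (φ := ι) hV.isOpenEmbedding_subtypeVal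
    isOpen_compl_singleton (by
      rw [hrange]
      refine Set.eq_univ_of_forall fun x => ?_
      by_cases hx : x = y
      · exact Or.inl (hx ▸ hyV)
      · exact Or.inr hx) hb
  have hmaps : Set.MapsTo (C.base.comp ι) (ι ⁻¹' {y}ᶜ) {C.base y}ᶜ :=
    fun x hx hxy => hx (hinj x.2 hyV hxy)
  have hcyc : map n (C.base.comp ι) b' ∈ relCycles {C.base y}ᶜ n :=
    map_mem_relCycles hmaps hb'
  obtain ⟨a, ha⟩ := hz.generates (C.base y) hcyc
  refine ⟨a, ?_⟩
  have h1 := C.transfer_mem_relBoundaries hp ha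
  rw [map_sub, map_smul] at h1
  have hsub : C.base ⁻¹' {C.base y}ᶜ ⊆ {y}ᶜ := by
    rintro x hx rfl
    exact hx rfl
  have h2 := chainsIn_le_relBoundaries (chainsIn_mono (B := {y}ᶜ) (by
    rw [hrange]
    rintro x hx rfl
    exact hx hyV) n (C.transfer_map_sub_mem_chainsIn hp ι (by rwa [hrange]) b'))
  convert Submodule.add_mem _ (Submodule.sub_mem _ hbb' h2) (relBoundaries_mono hsub h1) using 1
  abel

theorem boundaryFrom_transfer [SimplyConnectedSpace E] [LocallyPathConnectedSpace E]
    [ConnectedSpace M] (hp : IsCoveringMap p) {n : ℕ} {c : SingularChain n M}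
    (hc : boundaryFrom n c = 0) : boundaryFrom n (C.transfer n c) = 0 := by
  cases n with
  | zero => rfl
  | succ m =>
    change boundary m _ = 0
    rw [boundary_transfer C hp]
    exact (congrArg _ hc).trans (map_zero _)

/-- The transferred cycle generates all local homology groups, so it may serve as the reference
cycle on `N`. This form makes `‖N‖_ℤ` an infimum over boundaries only, which matches parametrised
fundamental cycles `1 ⊗ z + ∂b`. -/
theorem integralSimplicialVolume_eq [T2Space M] [CompactSpace M] [ConnectedSpace M]
    [SimplyConnectedSpace E] (hp : IsCoveringMap p) {n : ℕ} (hM : LocallyEuclidean n M)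
    {o : HomologicalOrientation n M} {z : SingularChain n E}
    (hz : IsFundamentalCycle o (map n p z)) :
    integralSimplicialVolume n N =
      ⨅ d : SingularChain (n + 1) N, l1Norm (C.sheetSum n z + boundary n d) := by
  have := (hM.of_isLocalHomeomorph hp.isLocalHomeomorph).locallyPathConnectedSpace
  have := C.t2Space hp
  have := C.compactSpace hM hp
  have := C.connectedSpace
  rw [← transfer_map C hp]
  exact _root_.integralSimplicialVolume_eq (hM.of_isLocalHomeomorph (C.isLocalHomeomorph_base hp))
    (C.boundaryFrom_transfer hp hz.1) (C.transfer_generates hp hz)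

end OrbitCover

open SingularChain SimplexSpace

/-! ### The `ℓ¹`-norm of integral and parametrised chains -/

theorem SingularChain.l1Norm_eq_tsum {n : ℕ} {X : Type u} [TopologicalSpace X]
    (c : SingularChain n X) : l1Norm c = ∑' σ, ((c σ).natAbs : ℝ≥0∞) := by
  rw [tsum_eq_sum (s := c.support) fun σ hσ => by simp [Finsupp.notMem_support_iff.1 hσ]]
  rfl

section Lp

variable {X : Type w} [MeasurableSpace X] {μ : Measure X}

/-- The `L¹`-norm of an essentially bounded integer valued function. -/
def intNorm (f : Lp ℤ ∞ μ) : ℝ≥0∞ := ∫⁻ x, ‖f x‖ₑ ∂μ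

theorem intNorm_zero : intNorm (0 : Lp ℤ ∞ μ) = 0 := by
  rw [intNorm, lintegral_congr_ae (g := fun _ => 0), lintegral_zero]
  filter_upwards [Lp.coeFn_zero ℤ ∞ μ] with x hx
  rw [hx, Pi.zero_apply, enorm_zero]

theorem intNorm_add_le (f g : Lp ℤ ∞ μ) : intNorm (f + g) ≤ intNorm f + intNorm g := by
  rw [intNorm, intNorm, intNorm, ← lintegral_add_left' (Lp.aestronglyMeasurable f).enorm]
  refine lintegral_mono_ae ?_
  filter_upwards [Lp.coeFn_add f g] with x hx
  rw [hx]
  exact enorm_add_le _ _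

theorem intNorm_neg (f : Lp ℤ ∞ μ) : intNorm (-f) = intNorm f := by
  refine lintegral_congr_ae ?_
  filter_upwards [Lp.coeFn_neg f] with x hx
  rw [hx, Pi.neg_apply, enorm_neg]

variable {Γ : Type u} [Group Γ] [MulAction Γ X] [MeasurableConstSMul Γ X]
  [SMulInvariantMeasure Γ X μ]

theorem rightTranslate_coeFn (g : Γ) (f : Lp ℤ ∞ μ) :
    rightTranslate Γ μ g f =ᵐ[μ] fun x => f (g • x) :=
  Lp.coeFn_compMeasurePreserving f (measurePreserving_smul g μ)

theorem intNorm_rightTranslate (g : Γ) (f : Lp ℤ ∞ μ) :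
    intNorm (rightTranslate Γ μ g f) = intNorm f := by
  rw [intNorm, lintegral_congr_ae (g := fun x => ‖f (g • x)‖ₑ)]
  · exact (measurePreserving_smul g μ).lintegral_comp_emb
      (measurableEmbedding_const_smul g) (fun x => ‖f x‖ₑ)
  · filter_upwards [rightTranslate_coeFn g f] with x hx
    rw [hx]

theorem rightTranslate_rightTranslate (g h : Γ) (f : Lp ℤ ∞ μ) :
    rightTranslate Γ μ h (rightTranslate Γ μ g f) = rightTranslate Γ μ (g * h) f := by
  refine Lp.ext ?_
  filter_upwards [rightTranslate_coeFn h (rightTranslate Γ μ g f),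
    rightTranslate_coeFn (g * h) f,
    (measurePreserving_smul h μ).quasiMeasurePreserving.ae (rightTranslate_coeFn g f)]
    with x h1 h2 h3
  rw [h1, h2, h3, mul_smul]

end Lp

section Norm

variable {X : Type w} [MeasurableSpace X] {μ : Measure X}

/-- The `ℓ¹`-norm of a finitely supported family of coefficients. -/
def coeffNorm {S : Type*} (s : S →₀ Lp ℤ ∞ μ) : ℝ≥0∞ := ∑' σ, intNorm (s σ)

theorem coeffNorm_eq_sum {S : Type*} (s : S →₀ Lp ℤ ∞ μ) :
    coeffNorm s = s.sum fun _ f => ∫⁻ x, ‖f x‖ₑ ∂μ :=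
  tsum_eq_sum (s := s.support) fun σ hσ => by
    rw [Finsupp.notMem_support_iff.1 hσ, intNorm_zero]

theorem coeffNorm_add_le {S : Type*} (s t : S →₀ Lp ℤ ∞ μ) :
    coeffNorm (s + t) ≤ coeffNorm s + coeffNorm t := by
  rw [coeffNorm, coeffNorm, coeffNorm, ← ENNReal.tsum_add]
  exact ENNReal.tsum_le_tsum fun σ => intNorm_add_le _ _

theorem coeffNorm_zero {S : Type*} : coeffNorm (0 : S →₀ Lp ℤ ∞ μ) = 0 := by
  simp [coeffNorm, intNorm_zero]

theorem coeffNorm_single {S : Type*} (σ : S) (f : Lp ℤ ∞ μ) :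
    coeffNorm (Finsupp.single σ f) = intNorm f := by
  rw [coeffNorm, tsum_eq_single σ fun τ hτ => by
    rw [Finsupp.single_eq_of_ne hτ, intNorm_zero], Finsupp.single_eq_same]

end Norm

/-! ### Orbit representatives of simplices. -/

namespace DeckGroup

variable {E M : Type u} [TopologicalSpace E] [TopologicalSpace M] (p : C(E, M))

/-- A choice of one simplex in every orbit of simplices of the universal covering. -/
def repr {k : ℕ} (σ : SingularSimplex k E) : SingularSimplex k E :=
  (Quotient.mk (Setoid.ker fun σ : SingularSimplex k E => p.comp σ) σ).out

theorem comp_repr {k : ℕ} (σ : SingularSimplex k E) : p.comp (repr p σ) = p.comp σ :=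
  Quotient.mk_out (s := Setoid.ker fun σ : SingularSimplex k E => p.comp σ) σ

variable {p}

theorem repr_eq_repr {k : ℕ} {σ τ : SingularSimplex k E} (h : p.comp σ = p.comp τ) :
    repr p σ = repr p τ :=
  congrArg Quotient.out
    (Quotient.sound (s := Setoid.ker fun σ : SingularSimplex k E => p.comp σ) h)

theorem smulMap_comp {k : ℕ} (g : DeckGroup p) (σ : SingularSimplex k E) :
    p.comp ((smulMap g).comp σ) = p.comp σ :=
  ContinuousMap.ext fun _ => apply_smul g _

variable (p) in
/-- The deck transformation that moves the chosen simplex to the given one. -/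
def position {k : ℕ} (σ : SingularSimplex k E) : DeckGroup p :=
  Classical.epsilon fun g => (smulMap g).comp (repr p σ) = σ

variable [SimplyConnectedSpace E] [LocallyPathConnectedSpace E]

theorem position_smul (hp : IsCoveringMap p) {k : ℕ} (σ : SingularSimplex k E) :
    (smulMap (position p σ)).comp (repr p σ) = σ :=
  Classical.epsilon_spec (p := fun g => (smulMap g).comp (repr p σ) = σ)
    (exists_smulMap_comp_eq hp (comp_repr p σ))

omit [SimplyConnectedSpace E] [LocallyPathConnectedSpace E] in
theorem smulMap_mul (g h : DeckGroup p) : smulMap (E := E) (g * h) = (smulMap g).comp (smulMap h) :=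
  ContinuousMap.ext fun x => mul_smul g h x

/-- The action on simplices is free, so the moving deck transformation is unique and hence
equivariant. -/
theorem position_smulMap_comp (hp : IsCoveringMap p) {k : ℕ} (g : DeckGroup p)
    (σ : SingularSimplex k E) : position p ((smulMap g).comp σ) = g * position p σ := by
  refine eq_of_smulMap_comp_eq hp (σ := repr p σ) ?_
  rw [smulMap_mul, ContinuousMap.comp_assoc, position_smul hp]
  have := position_smul hp ((smulMap g).comp σ)
  rwa [repr_eq_repr (smulMap_comp g σ)] at this

end DeckGroup

/-! ### Reduced coefficients of parametrised chains. -/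

namespace ParamChain

variable {E M : Type u} [TopologicalSpace E] [TopologicalSpace M] (p : C(E, M))
variable {X : Type w} [MeasurableSpace X] (μ : Measure X) [MulAction (DeckGroup p) X]
  [MeasurableConstSMul (DeckGroup p) X] [SMulInvariantMeasure (DeckGroup p) X μ]

/-- The coefficients of a chain with respect to the chosen simplices, before passing to the
quotient. -/
def reduceTensor (k : ℕ) :
    Lp ℤ ∞ μ ⊗[ℤ] SingularChain k E →ₗ[ℤ] SingularSimplex k E →₀ Lp ℤ ∞ μ :=
  (TensorProduct.lift (Finsupp.linearCombination ℤ fun σ : SingularSimplex k E =>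
    ((Finsupp.singleAddHom (DeckGroup.repr p σ)).comp
      (rightTranslate (DeckGroup p) μ (DeckGroup.position p σ))).toIntLinearMap).flip
    ).toAddMonoidHom.toIntLinearMap

theorem reduceTensor_tmul_single {k : ℕ} (f : Lp ℤ ∞ μ) (σ : SingularSimplex k E) :
    reduceTensor p μ k (f ⊗ₜ Finsupp.single σ 1) = Finsupp.single (DeckGroup.repr p σ)
      (rightTranslate (DeckGroup p) μ (DeckGroup.position p σ) f) := by
  refine (TensorProduct.lift.tmul _ _).trans ?_
  rw [LinearMap.flip_apply, Finsupp.linearCombination_single, one_smul]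
  rfl

variable {p μ}

theorem tmul_smul_eq {k : ℕ} (g : DeckGroup p) (f : Lp ℤ ∞ μ) (c : SingularChain k E) :
    tmul (DeckGroup p) f (map k (smulMap g) c) =
      tmul (DeckGroup p) (rightTranslate (DeckGroup p) μ g f) c :=
  ((Submodule.Quotient.eq (balancingRelations (DeckGroup p) E μ k)).2
    (Submodule.subset_span ⟨g, f, c, rfl⟩)).symm

theorem tmul_add {k : ℕ} (f : Lp ℤ ∞ μ) (c d : SingularChain k E) :
    tmul (DeckGroup p) f (c + d) = tmul (DeckGroup p) f c + tmul (DeckGroup p) f d :=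
  congrArg (Submodule.Quotient.mk (p := balancingRelations (DeckGroup p) E μ k))
    (TensorProduct.tmul_add f c d)

theorem add_tmul {k : ℕ} (f g : Lp ℤ ∞ μ) (c : SingularChain k E) :
    tmul (DeckGroup p) (f + g) c = tmul (DeckGroup p) f c + tmul (DeckGroup p) g c :=
  congrArg (Submodule.Quotient.mk (p := balancingRelations (DeckGroup p) E μ k))
    (TensorProduct.add_tmul f g c)

/-- `tmul` as a linear map in the second variable. -/
def tmulₗ (k : ℕ) (f : Lp ℤ ∞ μ) : SingularChain k E →ₗ[ℤ] ParamChain (DeckGroup p) E μ k :=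
  (AddMonoidHom.mk' (tmul (DeckGroup p) f) (tmul_add f)).toIntLinearMap

/-- `tmul` as a linear map in the first variable. -/
def tmulLeft {k : ℕ} (c : SingularChain k E) : Lp ℤ ∞ μ →ₗ[ℤ] ParamChain (DeckGroup p) E μ k :=
  (AddMonoidHom.mk' (fun f => tmul (DeckGroup p) f c) fun f g => add_tmul f g c).toIntLinearMap

theorem tmulₗ_apply {k : ℕ} (f : Lp ℤ ∞ μ) (c : SingularChain k E) :
    tmulₗ k f c = tmul (DeckGroup p) f c := rfl

theorem tmulLeft_apply {k : ℕ} (f : Lp ℤ ∞ μ) (c : SingularChain k E) :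
    tmulLeft c f = tmul (DeckGroup p) f c := rfl

theorem zero_tmul {k : ℕ} (c : SingularChain k E) :
    tmul (DeckGroup p) (0 : Lp ℤ ∞ μ) c = 0 := map_zero (tmulLeft c)

theorem tmul_zsmul {k : ℕ} (f : Lp ℤ ∞ μ) (m : ℤ) (c : SingularChain k E) :
    tmul (DeckGroup p) f (m • c) = tmul (DeckGroup p) (m • f) c :=
  (map_zsmul (tmulₗ k f) m c).trans (map_zsmul (tmulLeft c) m f).symm

theorem boundary_tmul {k : ℕ} (f : Lp ℤ ∞ μ) (c : SingularChain (k + 1) E) :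
    boundary (DeckGroup p) E μ k (tmul (DeckGroup p) f c) =
      tmul (DeckGroup p) f (SingularChain.boundary k c) := rfl

theorem induction_tmul_single {k : ℕ} {P : ParamChain (DeckGroup p) E μ k → Prop}
    (c : ParamChain (DeckGroup p) E μ k) (zero : P 0) (add : ∀ a b, P a → P b → P (a + b))
    (single : ∀ f σ, P (tmul (DeckGroup p) f (Finsupp.single σ 1))) : P c := by
  obtain ⟨t, rfl⟩ := Submodule.Quotient.mk_surjective _ c
  induction t with
  | zero => exact zero
  | add a b ha hb => exact add _ _ ha hb
  | tmul f c =>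
    change P (tmulₗ k f c)
    induction c using Finsupp.induction_linear with
    | zero => rwa [map_zero]
    | add a b ha hb => rw [map_add]; exact add _ _ ha hb
    | single σ m =>
      have : Finsupp.single σ m = m • Finsupp.single σ (1 : ℤ) := by simp
      rw [this, tmulₗ_apply, tmul_zsmul]
      exact single _ _

variable [SimplyConnectedSpace E] [LocallyPathConnectedSpace E]

/-- A simplex and its translate by `g` have the same representative, and their positions differ by
the factor `g`, which is what translating the coefficient by `g` compensates. -/
theorem balancingRelations_le_ker (hp : IsCoveringMap p) (k : ℕ) :
    balancingRelations (DeckGroup p) E μ k ≤ LinearMap.ker (reduceTensor p μ k) := by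
  refine Submodule.span_le.2 ?_
  rintro _ ⟨g, f, c, rfl⟩
  rw [SetLike.mem_coe, LinearMap.mem_ker, map_sub, sub_eq_zero]
  change reduceTensor p μ k (rightTranslate (DeckGroup p) μ g f ⊗ₜ c) =
    reduceTensor p μ k (f ⊗ₜ map k (smulMap g) c)
  induction c using Finsupp.induction_linear with
  | zero => rw [map_zero, TensorProduct.tmul_zero, TensorProduct.tmul_zero]
  | add a b ha hb =>
    rw [map_add, TensorProduct.tmul_add, TensorProduct.tmul_add, map_add, map_add, ha, hb]
  | single σ m =>
    have : Finsupp.single σ m = m • Finsupp.single σ (1 : ℤ) := by simp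
    rw [this, map_zsmul, TensorProduct.tmul_smul, TensorProduct.tmul_smul]
    refine (map_zsmul (reduceTensor p μ k) m _).trans (Eq.trans ?_
      (map_zsmul (reduceTensor p μ k) m _).symm)
    rw [map_single, reduceTensor_tmul_single, reduceTensor_tmul_single,
      rightTranslate_rightTranslate, DeckGroup.position_smulMap_comp hp,
      DeckGroup.repr_eq_repr (DeckGroup.smulMap_comp g σ)]

/-- The coefficients of a chain with respect to the chosen simplices. -/
def reduce (hp : IsCoveringMap p) (k : ℕ) :
    ParamChain (DeckGroup p) E μ k →ₗ[ℤ] SingularSimplex k E →₀ Lp ℤ ∞ μ :=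
  Submodule.liftQ _ (reduceTensor p μ k) (balancingRelations_le_ker hp k)

theorem reduce_tmul_single (hp : IsCoveringMap p) {k : ℕ} (f : Lp ℤ ∞ μ)
    (σ : SingularSimplex k E) :
    reduce hp k (tmul (DeckGroup p) f (Finsupp.single σ 1)) = Finsupp.single (DeckGroup.repr p σ)
      (rightTranslate (DeckGroup p) μ (DeckGroup.position p σ) f) :=
  reduceTensor_tmul_single p μ f σ

omit [SimplyConnectedSpace E] [LocallyPathConnectedSpace E] in
theorem ofFinsupp_add {k : ℕ} (s t : SingularSimplex k E →₀ Lp ℤ ∞ μ) :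
    ofFinsupp (DeckGroup p) (s + t) = ofFinsupp (DeckGroup p) s + ofFinsupp (DeckGroup p) t :=
  Finsupp.sum_add_index' (fun σ => by rw [zero_tmul])
    fun σ f g => add_tmul f g _

omit [SimplyConnectedSpace E] [LocallyPathConnectedSpace E] in
theorem ofFinsupp_single {k : ℕ} (σ : SingularSimplex k E) (f : Lp ℤ ∞ μ) :
    ofFinsupp (DeckGroup p) (Finsupp.single σ f) = tmul (DeckGroup p) f (Finsupp.single σ 1) :=
  Finsupp.sum_single_index (by rw [zero_tmul])

theorem ofFinsupp_reduce (hp : IsCoveringMap p) {k : ℕ} (c : ParamChain (DeckGroup p) E μ k) :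
    ofFinsupp (DeckGroup p) (reduce hp k c) = c := by
  induction c using induction_tmul_single with
  | zero => rw [map_zero]; exact Finsupp.sum_zero_index
  | add a b ha hb => rw [map_add, ofFinsupp_add, ha, hb]
  | single f σ =>
    rw [reduce_tmul_single, ofFinsupp_single, ← tmul_smul_eq, map_single,
      DeckGroup.position_smul hp]

theorem reduce_apply_of_repr_ne (hp : IsCoveringMap p) {k : ℕ}
    (c : ParamChain (DeckGroup p) E μ k) {σ : SingularSimplex k E} (hσ : DeckGroup.repr p σ ≠ σ) :
    reduce hp k c σ = 0 := by
  induction c using induction_tmul_single with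
  | zero => rw [map_zero, Finsupp.zero_apply]
  | add a b ha hb => rw [map_add, Finsupp.add_apply, ha, hb, add_zero]
  | single f τ =>
    rw [reduce_tmul_single, Finsupp.single_eq_of_ne]
    rintro rfl
    exact hσ (DeckGroup.repr_eq_repr (DeckGroup.comp_repr p τ))

theorem isReducedForm_reduce (hp : IsCoveringMap p) {k : ℕ}
    (c : ParamChain (DeckGroup p) E μ k) : IsReducedForm p (reduce hp k c) := by
  intro σ hσ τ hτ h
  have key : ∀ σ ∈ (reduce hp k c).support, DeckGroup.repr p σ = σ := fun σ hσ => by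
    by_contra hne
    exact Finsupp.mem_support_iff.1 hσ (reduce_apply_of_repr_ne hp c hne)
  rw [← key σ hσ, ← key τ hτ]
  exact DeckGroup.repr_eq_repr (DFunLike.coe_injective h)

/-- The norm of a chain is the norm of its coefficients with respect to the chosen simplices. -/
theorem l1Norm_eq (hp : IsCoveringMap p) {k : ℕ} (c : ParamChain (DeckGroup p) E μ k) :
    l1Norm (DeckGroup p) p c = coeffNorm (reduce hp k c) := by
  refine le_antisymm ?_ (le_iInf fun s => le_iInf fun _ => le_iInf fun hs => ?_)
  · rw [coeffNorm_eq_sum]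
    exact iInf_le_of_le _ (iInf_le_of_le (isReducedForm_reduce hp c)
      (iInf_le _ (ofFinsupp_reduce hp c)))
  · rw [← coeffNorm_eq_sum, ← hs, ofFinsupp, map_finsuppSum, coeffNorm_eq_sum s]
    -- Passing to the chosen representatives translates coefficients, which preserves their norm,
    -- and merges terms, which cannot increase it.
    have : ∀ t : Finset (SingularSimplex k E), coeffNorm (∑ σ ∈ t,
        reduce hp k (tmul (DeckGroup p) (s σ) (Finsupp.single σ 1))) ≤
          ∑ σ ∈ t, intNorm (s σ) := fun t => by
      refine (Finset.le_sum_of_subadditive _ coeffNorm_zero.le coeffNorm_add_le _ _).trans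
        (Finset.sum_le_sum fun σ _ => ?_)
      rw [reduce_tmul_single, coeffNorm_single, intNorm_rightTranslate]
    exact this _

theorem l1Norm_add_le (hp : IsCoveringMap p) {k : ℕ} (a b : ParamChain (DeckGroup p) E μ k) :
    l1Norm (DeckGroup p) p (a + b) ≤ l1Norm (DeckGroup p) p a + l1Norm (DeckGroup p) p b := by
  simp only [l1Norm_eq hp, map_add]
  exact coeffNorm_add_le _ _

theorem l1Norm_zero (hp : IsCoveringMap p) (k : ℕ) :
    l1Norm (DeckGroup p) p (0 : ParamChain (DeckGroup p) E μ k) = 0 := by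
  rw [l1Norm_eq hp, map_zero, coeffNorm_zero]

theorem l1Norm_tmul_single_le (hp : IsCoveringMap p) {k : ℕ} (f : Lp ℤ ∞ μ) (i : ℕ)
    (σ : SingularSimplex k E) :
    l1Norm (DeckGroup p) p (tmul (DeckGroup p) f (Finsupp.single σ ((-1 : ℤ) ^ i))) ≤
      intNorm f := by
  have : Finsupp.single σ ((-1 : ℤ) ^ i) = (-1 : ℤ) ^ i • Finsupp.single σ (1 : ℤ) := by simp
  rw [this, tmul_zsmul, l1Norm_eq hp, reduce_tmul_single, coeffNorm_single,
    intNorm_rightTranslate]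
  rcases neg_one_pow_eq_or ℤ i with h | h <;> simp [h, intNorm_neg]

theorem l1Norm_boundary_tmul_le (hp : IsCoveringMap p) {k : ℕ} (f : Lp ℤ ∞ μ)
    (σ : SingularSimplex (k + 1) E) :
    l1Norm (DeckGroup p) p (boundary (DeckGroup p) E μ k
      (tmul (DeckGroup p) f (Finsupp.single σ 1))) ≤ (k + 2 : ℕ) * intNorm f := by
  rw [boundary_tmul, SingularChain.boundary, Finsupp.linearCombination_single, one_smul,
    ← tmulₗ_apply, map_sum]
  refine (Finset.le_sum_of_subadditive _ (l1Norm_zero hp k).le (l1Norm_add_le hp) _ _).trans ?_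
  refine (Finset.sum_le_sum fun (i : Fin (k + 2)) _ =>
    l1Norm_tmul_single_le hp f (i : ℕ) (face i σ)).trans ?_
  simp

end ParamChain

open SingularChain SimplexSpace

/-! ### Step functions that factor through a coset space -/

theorem Int.enorm_eq_natAbs (m : ℤ) : ‖m‖ₑ = (m.natAbs : ℝ≥0∞) := by
  rw [enorm_eq_nnnorm, ← NNReal.natCast_natAbs, ENNReal.coe_natCast]

/-- An equivariant map from a `Γ`-space to `Γ / Λ` that pushes the measure forward to the
normalised counting measure. -/
structure CosetFactor {Γ : Type u} [Group Γ] {X : Type w} [MeasurableSpace X] [MulAction Γ X]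
    (μ : Measure X) (Λ : Subgroup Γ) where
  /-- The underlying map. -/
  toFun : X → Γ ⧸ Λ
  measurableSet_preimage : ∀ A, MeasurableSet (toFun ⁻¹' A)
  map_smul : ∀ (g : Γ) (x : X), toFun (g • x) = g • toFun x
  measure_fiber : ∀ a, μ (toFun ⁻¹' {a}) = (Λ.index : ℝ≥0∞)⁻¹

namespace CosetFactor

variable {Γ : Type u} [Group Γ] {X : Type w} [MeasurableSpace X] [MulAction Γ X]
  {μ : Measure X} {Λ : Subgroup Γ} (π : CosetFactor μ Λ) [Λ.FiniteIndex]

include π in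
theorem memLp (φ : Γ ⧸ Λ → ℤ) : MemLp (φ ∘ π.toFun) ∞ μ := by
  have hmeas : Measurable (φ ∘ π.toFun) := fun B _ => π.measurableSet_preimage (φ ⁻¹' B)
  obtain ⟨C, hC⟩ := (Set.finite_range fun a => ‖φ a‖).bddAbove
  exact memLp_top_of_bound hmeas.aestronglyMeasurable C
    (Eventually.of_forall fun x => hC ⟨π.toFun x, rfl⟩)

/-- The element of `L^∞` given by a function on the coset space. -/
def step : (Γ ⧸ Λ → ℤ) →+ Lp ℤ ∞ μ :=
  AddMonoidHom.mk' (fun φ => (π.memLp φ).toLp _) fun φ ψ =>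
    MemLp.toLp_add (π.memLp φ) (π.memLp ψ)

theorem step_coeFn (φ : Γ ⧸ Λ → ℤ) : π.step φ =ᵐ[μ] φ ∘ π.toFun := MemLp.coeFn_toLp (π.memLp φ)

theorem intNorm_step [Fintype (Γ ⧸ Λ)] (φ : Γ ⧸ Λ → ℤ) :
    intNorm (π.step φ) = (∑ a, ((φ a).natAbs : ℝ≥0∞)) / Λ.index := by
  classical
  rw [intNorm, lintegral_congr_ae (g := fun x => ∑ a : Γ ⧸ Λ,
    (π.toFun ⁻¹' {a}).indicator (fun _ => ((φ a).natAbs : ℝ≥0∞)) x)]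
  · rw [lintegral_finsetSum _ fun a _ =>
      measurable_const.indicator (π.measurableSet_preimage _), ENNReal.div_eq_inv_mul,
      Finset.mul_sum]
    refine Finset.sum_congr rfl fun a _ => ?_
    rw [lintegral_indicator_const (π.measurableSet_preimage _), π.measure_fiber, mul_comm]
  · filter_upwards [π.step_coeFn φ] with x hx
    rw [hx, Finset.sum_eq_single (π.toFun x)]
    · rw [Set.indicator_of_mem (show x ∈ π.toFun ⁻¹' {π.toFun x} from rfl)]
      exact Int.enorm_eq_natAbs _
    · intro a _ ha
      exact Set.indicator_of_notMem (show x ∉ π.toFun ⁻¹' {a} from fun h => ha (Eq.symm h)) _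
    · exact fun h => (h (Finset.mem_univ _)).elim

theorem step_one [IsFiniteMeasure μ] : π.step (fun _ => 1) = Lp.const ∞ μ 1 := by
  refine Lp.ext ?_
  filter_upwards [π.step_coeFn fun _ => 1, Lp.coeFn_const (p := ∞) (μ := μ) (1 : ℤ)] with x h1 h2
  rw [h1, h2]
  rfl

theorem rightTranslate_step [MeasurableConstSMul Γ X] [SMulInvariantMeasure Γ X μ] (g : Γ)
    (φ : Γ ⧸ Λ → ℤ) : rightTranslate Γ μ g (π.step φ) = π.step fun a => φ (g • a) := by
  refine Lp.ext ?_
  filter_upwards [rightTranslate_coeFn g (π.step φ), π.step_coeFn fun a => φ (g • a),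
    (measurePreserving_smul g μ).quasiMeasurePreserving.ae (π.step_coeFn φ)] with x h1 h2 h3
  rw [h1, h2, h3]
  exact congrArg φ (π.map_smul g x)

end CosetFactor

/-! ### Chains of an intermediate covering as parametrised chains -/

namespace OrbitCover

variable {E M : Type u} [TopologicalSpace E] [TopologicalSpace M] {p : C(E, M)}
  {Λ : Subgroup (DeckGroup p)} {N : Type u} [TopologicalSpace N] (C : OrbitCover p Λ N)
variable {X : Type w} [MeasurableSpace X] {μ : Measure X} [MulAction (DeckGroup p) X]
  [MeasurableConstSMul (DeckGroup p) X] [SMulInvariantMeasure (DeckGroup p) X μ]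
  (π : CosetFactor μ Λ) [Λ.FiniteIndex]

open Classical in
/-- The homomorphism that sends a simplex of the covering to a lift, with coefficient the
characteristic function of the fibre over the trivial coset. -/
def toParam (k : ℕ) : SingularChain k N →ₗ[ℤ] ParamChain (DeckGroup p) E μ k :=
  ParamChain.tmulₗ k (π.step (Pi.single ((1 : DeckGroup p) : DeckGroup p ⧸ Λ) 1)) ∘ₗ
    liftChain C.proj k

variable (hp : IsCoveringMap p)
include hp

omit [Λ.FiniteIndex] in
theorem exists_smulMap_comp_eq {k : ℕ} {σ τ : SingularSimplex k E}
    (h : C.proj.comp σ = C.proj.comp τ) : ∃ g ∈ Λ, (smulMap g).comp σ = τ := by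
  obtain ⟨g, hg, hgx⟩ := (C.proj_eq_iff _ _).1 (DFunLike.congr_fun h (stdSimplex.vertex 0))
  refine ⟨g, hg, DFunLike.coe_injective (hp.eq_of_comp_eq (map_continuous _) (map_continuous _)
    (funext fun t => ?_) (stdSimplex.vertex 0) hgx)⟩
  change p (g • σ t) = p (τ t)
  rw [DeckGroup.apply_smul, ← C.base_proj, ← C.base_proj (τ t)]
  exact congrArg C.base (DFunLike.congr_fun h t)

-- A lift of `sheet g ∘ σ` is the translate of `σ` by `l * g⁻¹` with `l ∈ Λ`. Moving the translation
-- to the coefficient turns the indicator function of the trivial coset into that of the coset of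
-- `g`.
open Classical in
theorem toParam_map_sheet {k : ℕ} (a : DeckGroup p ⧸ Λ) (c : SingularChain k E) :
    C.toParam π k (map k (C.sheet a) c) =
      ParamChain.tmul (DeckGroup p) (π.step (Pi.single a 1)) c := by
  induction a using QuotientGroup.induction_on with
  | H g =>
    refine LinearMap.congr_fun (f := C.toParam π k ∘ₗ map k (C.sheet (g : DeckGroup p ⧸ Λ)))
      (g := ParamChain.tmulₗ k (π.step (Pi.single (g : DeckGroup p ⧸ Λ) 1)))
      (SingularChain.hom_ext fun σ => ?_) c
    have hsheet : (C.sheet (g : DeckGroup p ⧸ Λ)).comp σ =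
        C.proj.comp ((smulMap g⁻¹).comp σ) := ContinuousMap.ext fun t => C.sheet_mk g _
    rw [LinearMap.comp_apply, map_single, hsheet]
    obtain ⟨τ, h, h'⟩ := liftChain_single (p := C.proj) ((smulMap g⁻¹).comp σ)
    obtain ⟨l, hl, rfl⟩ := C.exists_smulMap_comp_eq hp h.symm
    rw [toParam, LinearMap.comp_apply, h', ParamChain.tmulₗ_apply, ParamChain.tmulₗ_apply,
      ← ContinuousMap.comp_assoc, ← DeckGroup.smulMap_mul, ← map_single, ParamChain.tmul_smul_eq,
      π.rightTranslate_step]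
    congr 2
    funext a
    simp only [Pi.single_apply]
    congr 1
    rw [mul_smul, smul_eq_iff_eq_inv_smul, eq_iff_iff, inv_smul_eq_iff]
    have h1 : l⁻¹ • ((1 : DeckGroup p) : DeckGroup p ⧸ Λ) =
        ((1 : DeckGroup p) : DeckGroup p ⧸ Λ) := by
      refine QuotientGroup.eq.2 ?_
      simpa using hl
    rw [h1]
    have h2 : g • ((1 : DeckGroup p) : DeckGroup p ⧸ Λ) = (g : DeckGroup p ⧸ Λ) := by
      change ((g * 1 : DeckGroup p) : DeckGroup p ⧸ Λ) = _
      rw [mul_one]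
    rw [h2]

open Classical in
theorem toParam_map_proj {k : ℕ} (c : SingularChain k E) :
    C.toParam π k (map k C.proj c) = ParamChain.tmul (DeckGroup p)
      (π.step (Pi.single ((1 : DeckGroup p) : DeckGroup p ⧸ Λ) 1)) c := by
  rw [← C.toParam_map_sheet π hp]
  congr 3
  exact ContinuousMap.ext fun x => (C.sheet_one x).symm

/-- The indicator functions of the cosets add up to `1`. So the transfer of a cycle of `M`
corresponds to its image with constant coefficients. -/
theorem toParam_sheetSum [IsFiniteMeasure μ] {k : ℕ} (c : SingularChain k E) :
    C.toParam π k (C.sheetSum k c) = ParamChain.tmul (DeckGroup p) (Lp.const ∞ μ 1) c := by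
  classical
  let := Λ.fintypeQuotientOfFiniteIndex
  rw [sheetSum_apply, map_sum]
  simp_rw [C.toParam_map_sheet π hp, ← ParamChain.tmulLeft_apply]
  rw [← map_sum, ← map_sum, ← π.step_one]
  congr 2
  funext a
  simp [Finset.sum_apply, Pi.single_apply]

/-- A step function is an integral combination of indicator functions of cosets, each of which comes
from one sheet. -/
theorem exists_toParam_eq {k : ℕ} (φ : DeckGroup p ⧸ Λ → ℤ) (c : SingularChain k E) :
    ∃ d, C.toParam π k d = ParamChain.tmul (DeckGroup p) (π.step φ) c := by
  classical
  let := Λ.fintypeQuotientOfFiniteIndex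
  refine ⟨∑ a, φ a • map k (C.sheet a) c, ?_⟩
  rw [map_sum]
  simp_rw [map_zsmul, C.toParam_map_sheet π hp, ← ParamChain.tmulLeft_apply, ← map_zsmul]
  rw [← map_sum, ← map_sum]
  congr 2
  funext a
  simp [Finset.sum_apply, Pi.single_apply]

variable [SimplyConnectedSpace E]

/-- As for the transfer, the chosen lifts do not commute with faces; the formula for projected
chains, valid for any lift, does. -/
theorem boundary_toParam {k : ℕ} (c : SingularChain (k + 1) N) :
    ParamChain.boundary (DeckGroup p) E μ k (C.toParam π (k + 1) c) =
      C.toParam π k (boundary k c) := by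
  have := C.connectedSpace
  obtain ⟨c, rfl⟩ : ∃ b, map (k + 1) C.proj b = c := ⟨_, map_liftChain (C.isCoveringMap_proj hp) c⟩
  rw [C.toParam_map_proj π hp, boundary_map, C.toParam_map_proj π hp, ParamChain.boundary_tmul]

variable [LocallyPathConnectedSpace E]

/-- The simplices of the covering over the orbit of `ρ` are the `sheet a ∘ ρ`. Their coefficients in
`c` become the values of one step function on `Γ/Λ`. -/
theorem reduce_toParam_apply {k : ℕ} (c : SingularChain k N) {ρ : SingularSimplex k E}
    (hρ : DeckGroup.repr p ρ = ρ) : ParamChain.reduce hp k (C.toParam π k c) ρ =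
      π.step fun a => c ((C.sheet a).comp ρ) := by
  classical
  induction c using Finsupp.induction_linear with
  | zero =>
    rw [map_zero, map_zero]
    exact (map_zero π.step).symm
  | add c d hc hd =>
    rw [map_add, map_add, Finsupp.add_apply, hc, hd, ← map_add]
    rfl
  | single σ m =>
    obtain ⟨τ, rfl⟩ := exists_lift_simplex (C.isCoveringMap_proj hp) C.surjective_proj σ
    have hm : Finsupp.single (C.proj.comp τ) m = m • Finsupp.single (C.proj.comp τ) (1 : ℤ) := by
      simp
    rw [hm, map_zsmul, map_zsmul, ← map_single, C.toParam_map_proj π hp,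
      ParamChain.reduce_tmul_single, π.rightTranslate_step, Finsupp.smul_apply]
    have hφ : (fun a => (m • map k C.proj (Finsupp.single τ 1)) ((C.sheet a).comp ρ)) =
        m • fun a => (Finsupp.single (C.proj.comp τ) (1 : ℤ)) ((C.sheet a).comp ρ) := by
      rw [map_single]
      rfl
    rw [hφ, map_zsmul]
    congr 1
    by_cases h : DeckGroup.repr p τ = ρ
    · rw [h, Finsupp.single_eq_same]
      congr 1
      funext a
      rw [Pi.single_apply, Finsupp.single_apply]
      congr 1
      rw [eq_iff_iff]
      have hτ := DeckGroup.position_smul hp τ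
      rw [h] at hτ
      -- Since `position τ` moves `ρ` to `τ`, the projection of `τ` is the sheet of `ρ` indexed by
      -- the inverse of that position.
      have key : C.proj.comp τ =
          (C.sheet (((DeckGroup.position p τ)⁻¹ : DeckGroup p) : DeckGroup p ⧸ Λ)).comp ρ := by
        conv_lhs => rw [← hτ]
        refine ContinuousMap.ext fun t => ?_
        refine Eq.trans ?_ (C.sheet_mk _ _).symm
        rw [inv_inv]
        rfl
      have h1 : DeckGroup.position p τ • a = ((1 : DeckGroup p) : DeckGroup p ⧸ Λ) ↔
          (((DeckGroup.position p τ)⁻¹ : DeckGroup p) : DeckGroup p ⧸ Λ) = a := by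
        rw [smul_eq_iff_eq_inv_smul, eq_comm]
        change ((((DeckGroup.position p τ)⁻¹ * 1 : DeckGroup p)) : DeckGroup p ⧸ Λ) = a ↔ _
        rw [mul_one]
      rw [h1, key]
      constructor
      · rintro rfl
        rfl
      · intro h2
        exact C.sheet_injective_left hp (DFunLike.congr_fun h2 (stdSimplex.vertex 0))
    · rw [Finsupp.single_eq_of_ne (Ne.symm h)]
      refine (map_zero π.step).symm.trans (congrArg _ (funext fun a => ?_))
      rw [Finsupp.single_eq_of_ne, Pi.zero_apply]
      intro h2
      refine h (Eq.trans (DeckGroup.repr_eq_repr ?_) hρ)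
      refine ContinuousMap.ext fun t => ?_
      have := congrArg C.base (DFunLike.congr_fun h2 t)
      refine (C.base_proj _).symm.trans (this.symm.trans ?_)
      exact C.base_sheet _ _

/-- The chosen simplices and the cosets parametrise the simplices of the covering. -/
def simplexEquiv (k : ℕ) :
    {ρ : SingularSimplex k E // DeckGroup.repr p ρ = ρ} × (DeckGroup p ⧸ Λ) ≃
      SingularSimplex k N :=
  Equiv.ofBijective (fun x => (C.sheet x.2).comp x.1.1) <| by
    constructor
    · rintro ⟨⟨ρ, hρ⟩, a⟩ ⟨⟨ρ', hρ'⟩, b⟩ h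
      have hρρ' : ρ = ρ' := by
        rw [← hρ, ← hρ']
        refine DeckGroup.repr_eq_repr (ContinuousMap.ext fun t => ?_)
        have := congrArg C.base (DFunLike.congr_fun h t)
        exact (C.base_sheet _ _).symm.trans (this.trans (C.base_sheet _ _))
      subst hρρ'
      obtain rfl := C.sheet_injective_left hp (DFunLike.congr_fun h (stdSimplex.vertex 0))
      rfl
    · intro σ
      obtain ⟨τ, rfl⟩ := exists_lift_simplex (C.isCoveringMap_proj hp) C.surjective_proj σ
      refine ⟨⟨⟨DeckGroup.repr p τ, DeckGroup.repr_eq_repr (DeckGroup.comp_repr p τ)⟩,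
        (((DeckGroup.position p τ)⁻¹ : DeckGroup p) : DeckGroup p ⧸ Λ)⟩, ?_⟩
      refine ContinuousMap.ext fun t => (C.sheet_mk _ _).trans ?_
      rw [inv_inv]
      exact congrArg C.proj (DFunLike.congr_fun (DeckGroup.position_smul hp τ) t)

/-- Each value of the step function over `ρ` is taken on a set of measure `1 / Λ.index`, and by
`simplexEquiv` the pairs of a chosen simplex and a coset exhaust the simplices of the covering. -/
theorem l1Norm_toParam {k : ℕ} (c : SingularChain k N) :
    ParamChain.l1Norm (DeckGroup p) p (C.toParam π k c) = l1Norm c / Λ.index := by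
  let := Λ.fintypeQuotientOfFiniteIndex
  rw [ParamChain.l1Norm_eq hp, coeffNorm, l1Norm_eq_tsum,
    ← (C.simplexEquiv hp k).tsum_eq fun σ => ((c σ).natAbs : ℝ≥0∞),
    ENNReal.tsum_prod (f := fun ρ a => ((c (C.simplexEquiv hp k (ρ, a))).natAbs : ℝ≥0∞)),
    ENNReal.div_eq_inv_mul, ← ENNReal.tsum_mul_left,
    ← tsum_subtype_eq_of_support_subset (s := {ρ | DeckGroup.repr p ρ = ρ})]
  · refine tsum_congr fun ρ => ?_
    rw [C.reduce_toParam_apply π hp c ρ.2, π.intNorm_step, tsum_fintype, ENNReal.div_eq_inv_mul]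
    rfl
  · intro ρ hρ
    by_contra hne
    refine hρ ?_
    change intNorm _ = 0
    rw [ParamChain.reduce_apply_of_repr_ne hp _ hne, intNorm_zero]

omit [LocallyPathConnectedSpace E] in
theorem boundaryFrom_toParam {n : ℕ} {c : SingularChain n N} (hc : boundaryFrom n c = 0) :
    ParamChain.boundaryFrom (DeckGroup p) E μ n (C.toParam π n c) = 0 := by
  cases n with
  | zero => rfl
  | succ m =>
    refine (C.boundary_toParam π hp c).trans ?_
    exact (congrArg _ hc).trans (map_zero _)

include C π in
omit [LocallyPathConnectedSpace E] in
/-- A factor map to `Γ / Λ` bounds the parametrised simplicial volume by the normalised integral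
simplicial volume of the covering associated with `Λ`. -/
theorem paramSimplicialVolume_le [T2Space M] [CompactSpace M] [ConnectedSpace M]
    [IsProbabilityMeasure μ] {n : ℕ} (hM : LocallyEuclidean n M)
    (o : HomologicalOrientation n M) :
    paramSimplicialVolume o p μ ≤ integralSimplicialVolume n N / Λ.index := by
  have := (hM.of_isLocalHomeomorph hp.isLocalHomeomorph).locallyPathConnectedSpace
  obtain ⟨z, hz⟩ := exists_isFundamentalCycle hM o
  rw [← map_liftChain hp z] at hz
  rw [C.integralSimplicialVolume_eq hp hM hz, ENNReal.div_eq_inv_mul, ENNReal.mul_iInf_of_ne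
    (by simp) (by simp [Subgroup.FiniteIndex.index_ne_zero])]
  refine le_iInf fun d => ?_
  rw [← ENNReal.div_eq_inv_mul, ← C.l1Norm_toParam π hp]
  -- The cycle is the image of the transfer plus `∂d`; it differs from `1 ⊗ z` by the boundary of
  -- the image of `d`.
  refine iInf_le_of_le _ (iInf_le _ ⟨?_, _, hz, ?_⟩)
  · refine C.boundaryFrom_toParam π hp ?_
    rw [map_add, boundaryFrom_boundary_eq_zero, add_zero, ← C.transfer_map hp]
    exact C.boundaryFrom_transfer hp hz.1
  · rw [map_add, C.toParam_sheetSum π hp, add_sub_cancel_left, ← C.boundary_toParam π hp]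
    exact ⟨_, rfl⟩

end OrbitCover

open SingularChain SimplexSpace

/-! ### Approximation by step functions on inverse limits of coset spaces -/

namespace CosetLimit

variable {Γ : Type u} [Group Γ] {ι : Type v} {S : ι → Subgroup Γ} [∀ i, (S i).FiniteIndex]
  (μ : Measure (CosetLimit S)) [IsProbabilityMeasure μ] [SMulInvariantMeasure Γ (CosetLimit S) μ]

/-- The projection of an inverse limit to one of the coset spaces. -/
def factor (i : ι) : CosetFactor μ (S i) where
  toFun x := x.coord i
  measurableSet_preimage A := measurableSet_coord S i A
  map_smul _ _ := rfl
  measure_fiber a := measure_coord S μ i a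

theorem exists_factor_step_eq {i k : ι} (h : S k ≤ S i) (φ : Γ ⧸ S i → ℤ) :
    ∃ ψ : Γ ⧸ S k → ℤ, ψ ∘ (factor μ k).toFun = φ ∘ (factor μ i).toFun :=
  ⟨fun a => φ (Subgroup.quotientMapOfLE h a), funext fun x => congrArg φ (x.compatible i k h)⟩

-- Directedness allows two cylinder sets to be written over a common coset space, which yields
-- closure under unions.
omit [∀ i, (S i).FiniteIndex] in
theorem isSetAlgebra_cylinder [Nonempty ι] (hS : ∀ i j, ∃ k, S k ≤ S i ∧ S k ≤ S j) :
    IsSetAlgebra {D : Set (CosetLimit S) | ∃ i, ∃ A : Set (Γ ⧸ S i), D = {x | x.coord i ∈ A}} where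
  empty_mem := ⟨Classical.arbitrary ι, ∅, rfl⟩
  compl_mem := by
    rintro _ ⟨i, A, rfl⟩
    exact ⟨i, Aᶜ, rfl⟩
  union_mem := by
    rintro _ _ ⟨i, A, rfl⟩ ⟨j, B, rfl⟩
    obtain ⟨k, hi, hj⟩ := hS i j
    refine ⟨k, Subgroup.quotientMapOfLE hi ⁻¹' A ∪ Subgroup.quotientMapOfLE hj ⁻¹' B, ?_⟩
    ext x
    change x.coord i ∈ A ∨ x.coord j ∈ B ↔ Subgroup.quotientMapOfLE hi (x.coord k) ∈ A ∨
      Subgroup.quotientMapOfLE hj (x.coord k) ∈ B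
    rw [x.compatible, x.compatible]

omit [∀ i, (S i).FiniteIndex] in
theorem generateFrom_cylinder : (instMeasurableSpace S) = MeasurableSpace.generateFrom
    {D : Set (CosetLimit S) | ∃ i, ∃ A : Set (Γ ⧸ S i), D = {x | x.coord i ∈ A}} := by
  refine le_antisymm (iSup_le fun i => ?_) (MeasurableSpace.generateFrom_le ?_)
  · rintro _ ⟨A, -, rfl⟩
    exact MeasurableSpace.measurableSet_generateFrom ⟨i, A, rfl⟩
  · rintro _ ⟨i, A, rfl⟩
    exact measurableSet_coord S i A

/-- Bounded integer valued functions on a directed inverse limit are approximated in `L¹` by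
functions that factor through one of the coset spaces. -/
theorem exists_intNorm_step_sub_le [Nonempty ι] (hS : ∀ i j, ∃ k, S k ≤ S i ∧ S k ≤ S j)
    (f : Lp ℤ ∞ μ) {ε : ℝ≥0∞} (hε : ε ≠ 0) :
    ∃ i, ∀ k, S k ≤ S i → ∃ φ, intNorm ((factor μ k).step φ - f) ≤ ε := by
  -- For a finite measure, measurable sets are approximated in measure by sets of a generating
  -- algebra; indicator functions, and then all integrable functions, follow.
  have hdense := Measure.MeasureDense.of_generateFrom_isSetAlgebra_finite (μ := μ)
    (isSetAlgebra_cylinder hS) generateFrom_cylinder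
  have key : ∃ g : CosetLimit S → ℤ, eLpNorm (⇑f - g) 1 μ ≤ ε ∧
      ∃ i, ∃ φ : Γ ⧸ S i → ℤ, g = φ ∘ (factor μ i).toFun := by
    refine ((Lp.memLp f).mono_exponent (p := 1) le_top).induction_dense
      ENNReal.one_ne_top _ ?_ ?_ ?_ hε
    · intro c s hs hμs δ hδ
      -- The error of the indicator function with height `c` is `‖c‖ₑ` times the measure of the
      -- symmetric difference.
      obtain ⟨η, hη, hηδ⟩ : ∃ η : ℝ, 0 < η ∧ ‖c‖ₑ * ENNReal.ofReal η ≤ δ := by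
        have hpos : 0 < δ / ‖c‖ₑ := ENNReal.div_pos hδ enorm_ne_top
        obtain ⟨r, hr, hrδ⟩ := ENNReal.lt_iff_exists_nnreal_btwn.1 hpos
        refine ⟨r, by exact_mod_cast hr, ?_⟩
        rw [ENNReal.ofReal_coe_nnreal]
        exact (mul_le_mul_right hrδ.le _).trans ENNReal.mul_div_le
      obtain ⟨_, ⟨i, A, rfl⟩, hA⟩ := hdense.approx s hs hμs.ne η hη
      classical
      refine ⟨_, ?_, i, A.indicator fun _ => c, rfl⟩
      refine le_trans ?_ hηδ
      refine le_trans ?_ (mul_le_mul_right hA.le _)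
      have hm : MeasurableSet (symmDiff s {x : CosetLimit S | x.coord i ∈ A}) :=
        hs.symmDiff (measurableSet_coord S i A)
      rw [eLpNorm_one_eq_lintegral_enorm, ← lintegral_indicator_const hm]
      refine lintegral_mono fun x => ?_
      rw [Pi.sub_apply, Function.comp_apply]
      change ‖A.indicator (fun _ => c) (x.coord i) - _‖ₑ ≤ _
      by_cases h1 : x ∈ s <;> by_cases h2 : x.coord i ∈ A <;>
        simp [Set.mem_symmDiff, h1, h2]
    · rintro _ _ ⟨i, φ, rfl⟩ ⟨j, ψ, rfl⟩
      obtain ⟨k, hi, hj⟩ := hS i j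
      obtain ⟨φ', hφ'⟩ := exists_factor_step_eq μ hi φ
      obtain ⟨ψ', hψ'⟩ := exists_factor_step_eq μ hj ψ
      exact ⟨k, φ' + ψ', by rw [← hφ', ← hψ']; rfl⟩
    · rintro _ ⟨i, φ, rfl⟩
      exact ((factor μ i).memLp φ).aestronglyMeasurable
  obtain ⟨g, hg, i, φ, rfl⟩ := key
  refine ⟨i, fun k hk => ?_⟩
  obtain ⟨ψ, hψ⟩ := exists_factor_step_eq μ hk φ
  refine ⟨ψ, le_of_eq_of_le ?_ hg⟩
  rw [eLpNorm_one_eq_lintegral_enorm, intNorm]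
  refine lintegral_congr_ae ?_
  filter_upwards [Lp.coeFn_sub ((factor μ k).step ψ) f, (factor μ k).step_coeFn ψ] with x h1 h2
  rw [h1, Pi.sub_apply, h2, hψ, Pi.sub_apply, ← enorm_neg, neg_sub]

end CosetLimit

/-! ### Parametrised simplicial volume of inverse limits -/

section ParamVolume

variable {E M : Type u} [TopologicalSpace E] [TopologicalSpace M] {p : C(E, M)}
  {ι : Type v} {S : ι → Subgroup (DeckGroup p)} [∀ i, (S i).FiniteIndex]
  (μ : Measure (CosetLimit S)) [IsProbabilityMeasure μ]
  [SMulInvariantMeasure (DeckGroup p) (CosetLimit S) μ]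
  {N : ι → Type u} [∀ i, TopologicalSpace (N i)] (C : ∀ i, OrbitCover p (S i) (N i))
  [SimplyConnectedSpace E] [Nonempty ι] (hp : IsCoveringMap p)
  (hS : ∀ i j, ∃ k, S k ≤ S i ∧ S k ≤ S j)
include hp hS

/-- Approximate each coefficient by a step function. The statement holds for all sufficiently small
`S k` so that the finitely many terms can share one coset space and a lower bound along a cofinal
family remains usable. -/
theorem exists_l1Norm_boundary_toParam_sub_le [LocallyPathConnectedSpace E] {n : ℕ}
    (b : ParamChain (DeckGroup p) E μ (n + 1)) {ε : ℝ≥0∞} (hε : ε ≠ 0) :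
    ∃ i, ∀ k, S k ≤ S i → ∃ d, ParamChain.l1Norm (DeckGroup p) p (ParamChain.boundary
      (DeckGroup p) E μ n ((C k).toParam (CosetLimit.factor μ k) (n + 1) d - b)) ≤ ε := by
  induction b using ParamChain.induction_tmul_single generalizing ε with
  | zero =>
    refine ⟨Classical.arbitrary ι, fun k _ => ⟨0, ?_⟩⟩
    rw [map_zero, sub_zero, map_zero, ParamChain.l1Norm_zero hp]
    exact zero_le
  | add a b ha hb =>
    obtain ⟨i, hi⟩ := ha (ENNReal.half_pos hε).ne'
    obtain ⟨j, hj⟩ := hb (ENNReal.half_pos hε).ne'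
    obtain ⟨l, hli, hlj⟩ := hS i j
    refine ⟨l, fun k hk => ?_⟩
    obtain ⟨d, hd⟩ := hi k (hk.trans hli)
    obtain ⟨e, he⟩ := hj k (hk.trans hlj)
    refine ⟨d + e, ?_⟩
    rw [map_add, add_sub_add_comm, map_add, ← ENNReal.add_halves ε]
    exact (ParamChain.l1Norm_add_le hp _ _).trans (add_le_add hd he)
  | single f σ =>
    -- The boundary of an `(n + 1)`-simplex has `n + 2` faces, which bounds the norm of the boundary
    -- operator.
    have hδ : ε / (n + 2 : ℕ) ≠ 0 := (ENNReal.div_pos hε (ENNReal.natCast_ne_top _)).ne'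
    obtain ⟨i, hi⟩ := CosetLimit.exists_intNorm_step_sub_le μ hS f hδ
    refine ⟨i, fun k hk => ?_⟩
    obtain ⟨φ, hφ⟩ := hi k hk
    obtain ⟨d, hd⟩ := (C k).exists_toParam_eq (CosetLimit.factor μ k) hp φ (Finsupp.single σ 1)
    refine ⟨d, ?_⟩
    rw [hd, ← ParamChain.tmulLeft_apply, ← ParamChain.tmulLeft_apply, ← map_sub,
      ParamChain.tmulLeft_apply]
    exact (ParamChain.l1Norm_boundary_tmul_le hp _ _).trans
      ((mul_le_mul_right hφ _).trans ENNReal.mul_div_le)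

include C in
/-- A lower bound for the normalised integral simplicial volumes of cofinally many of the
associated coverings bounds the parametrised simplicial volume of the inverse limit. -/
theorem le_paramSimplicialVolume_cosetLimit [T2Space M] [CompactSpace M] [ConnectedSpace M]
    {n : ℕ} (hM : LocallyEuclidean n M) (o : HomologicalOrientation n M) {B : ℝ≥0∞}
    (hB : ∀ i, ∃ k, S k ≤ S i ∧ B ≤ integralSimplicialVolume n (N k) / ((S k).index : ℝ≥0∞)) :
    B ≤ paramSimplicialVolume o p μ := by
  have := (hM.of_isLocalHomeomorph hp.isLocalHomeomorph).locallyPathConnectedSpace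
  refine le_iInf fun c => le_iInf fun hc => ?_
  obtain ⟨-, z, hz, b, hb⟩ := hc
  refine ENNReal.le_of_forall_pos_le_add fun ε hε _ => ?_
  obtain ⟨i, hi⟩ := exists_l1Norm_boundary_toParam_sub_le μ C hp hS b
    (ENNReal.coe_ne_zero.2 hε.ne')
  obtain ⟨k, hk, hBk⟩ := hB i
  obtain ⟨d, hd⟩ := hi k hk
  have hle : integralSimplicialVolume n (N k) ≤
      l1Norm ((C k).sheetSum n z + SingularChain.boundary n d) := by
    rw [(C k).integralSimplicialVolume_eq hp hM hz]
    exact iInf_le _ d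
  refine hBk.trans ((ENNReal.div_le_div_right hle _).trans ?_)
  rw [← (C k).l1Norm_toParam (CosetLimit.factor μ k) hp]
  -- The integral cycle on `N k` corresponds to `c` plus the boundary of the approximation error of
  -- `b`.
  have heq : (C k).toParam (CosetLimit.factor μ k) n
      ((C k).sheetSum n z + SingularChain.boundary n d) = c + ParamChain.boundary
      (DeckGroup p) E μ n ((C k).toParam (CosetLimit.factor μ k) (n + 1) d - b) := by
    rw [map_add, (C k).toParam_sheetSum _ hp, ← (C k).boundary_toParam _ hp, map_sub, hb]
    abel
  rw [heq]
  exact (ParamChain.l1Norm_add_le hp _ _).trans (add_le_add le_rfl hd)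

include C in
/-- The parametrised simplicial volume of an inverse limit of finite coset spaces is the infimum of
the normalised integral simplicial volumes of the associated coverings. -/
theorem paramSimplicialVolume_cosetLimit_eq [T2Space M] [CompactSpace M] [ConnectedSpace M]
    {n : ℕ} (hM : LocallyEuclidean n M) (o : HomologicalOrientation n M) :
    paramSimplicialVolume o p μ =
      ⨅ i, integralSimplicialVolume n (N i) / ((S i).index : ℝ≥0∞) :=
  le_antisymm
    (le_iInf fun i => (C i).paramSimplicialVolume_le (CosetLimit.factor μ i) hp hM o)
    (le_paramSimplicialVolume_cosetLimit μ C hp hS hM o fun i => ⟨i, le_rfl, iInf_le _ i⟩)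

end ParamVolume

open SingularChain SimplexSpace

/-! ### Finite coverings and finite index subgroups -/

namespace OrbitCover

variable {E M : Type u} [TopologicalSpace E] [TopologicalSpace M] {p : C(E, M)}

/-- The orbit space of the universal covering under a group of deck transformations. -/
def quotient (p : C(E, M)) (Λ : Subgroup (DeckGroup p)) :
    OrbitCover p Λ (MulAction.orbitRel.Quotient Λ E) where
  proj := ⟨Quotient.mk (MulAction.orbitRel Λ E), continuous_quotient_mk'⟩
  base := ⟨Quotient.lift p (by
      rintro x y ⟨g, rfl⟩
      exact DeckGroup.apply_smul g.1 y), p.continuous.quotient_lift _⟩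
  base_proj _ := rfl
  surjective_proj := Quotient.mk_surjective
  isOpenMap_proj := by
    have : ContinuousConstSMul Λ E := ⟨fun g => continuous_const_smul g.1⟩
    exact MulAction.isOpenQuotientMap_quotientMk.isOpenMap
  proj_eq_iff x y := by
    refine Quotient.eq (r := MulAction.orbitRel Λ E).trans ⟨?_, ?_⟩
    · rintro ⟨g, rfl⟩
      exact ⟨g⁻¹, Λ.inv_mem g.2, inv_smul_smul g.1 y⟩
    · rintro ⟨g, hg, rfl⟩
      exact ⟨⟨g⁻¹, Λ.inv_mem hg⟩, inv_smul_smul g x⟩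

variable {Λ : Subgroup (DeckGroup p)} {N : Type u} [TopologicalSpace N] (C : OrbitCover p Λ N)
include C

theorem card_fibre [SimplyConnectedSpace E] [LocallyPathConnectedSpace E] (hp : IsCoveringMap p)
    (x : E) : Nat.card (C.base ⁻¹' {p x}) = Λ.index := by
  refine (Nat.card_congr (Equiv.ofBijective (fun a : DeckGroup p ⧸ Λ =>
    (⟨C.sheet a x, C.base_sheet a x⟩ : C.base ⁻¹' {p x})) ⟨?_, ?_⟩)).symm
  · intro a b h
    exact C.sheet_injective_left hp (congrArg Subtype.val h)
  · rintro ⟨y, hy⟩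
    obtain ⟨y, rfl⟩ := C.exists_lift y
    rw [Set.mem_preimage, Set.mem_singleton_iff, C.base_proj] at hy
    obtain ⟨g, rfl⟩ := DeckGroup.exists_smul_eq hp hy.symm
    refine ⟨(g⁻¹ : DeckGroup p), Subtype.ext ?_⟩
    exact (C.sheet_mk _ _).trans (by rw [inv_inv])

/-- A local homeomorphism between compact Hausdorff spaces is a covering map. -/
theorem isCoveringMap_base [T2Space M] [CompactSpace M] [ConnectedSpace M]
    [SimplyConnectedSpace E] {n : ℕ} (hM : LocallyEuclidean n M) (hp : IsCoveringMap p)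
    [Λ.FiniteIndex] : IsCoveringMap C.base := by
  have := (hM.of_isLocalHomeomorph hp.isLocalHomeomorph).locallyPathConnectedSpace
  have := C.t2Space hp
  have := C.compactSpace hM hp
  exact isLocalHomeomorph_iff_isCoveringMap.1 (C.isLocalHomeomorph_base hp)

theorem stableIntegralSimplicialVolume_le [T2Space M] [CompactSpace M] [ConnectedSpace M]
    [SimplyConnectedSpace E] {n : ℕ} (hM : LocallyEuclidean n M) (hp : IsCoveringMap p)
    [Λ.FiniteIndex] :
    stableIntegralSimplicialVolume n M ≤ integralSimplicialVolume n N / Λ.index := by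
  have := (hM.of_isLocalHomeomorph hp.isLocalHomeomorph).locallyPathConnectedSpace
  refine iInf_le_of_le Λ.index (iInf_le_of_le
    (Nat.pos_of_ne_zero Subgroup.FiniteIndex.index_ne_zero) (iInf_le_of_le N
      (iInf_le_of_le inferInstance (iInf_le_of_le C.connectedSpace (iInf_le_of_le C.base
        (iInf_le_of_le (C.isCoveringMap_base hM hp) (iInf_le _ fun y => ?_)))))))
  obtain ⟨x, rfl⟩ := hp.surjective_of_connectedSpace y
  exact C.card_fibre hp x

omit C

/-- Every connected covering of `M` is an orbit space of the universal covering. -/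
theorem exists_of_isCoveringMap [SimplyConnectedSpace E] [LocallyPathConnectedSpace E]
    [ConnectedSpace M] (hp : IsCoveringMap p) {n : ℕ} (hM : LocallyEuclidean n M)
    [ConnectedSpace N] {q : N → M} (hq : IsCoveringMap q) :
    ∃ (Λ : Subgroup (DeckGroup p)) (C : OrbitCover p Λ N), ⇑C.base = q := by
  obtain ⟨x₀⟩ : Nonempty E := inferInstance
  have : LocallyPathConnectedSpace N :=
    (hM.of_isLocalHomeomorph hq.isLocalHomeomorph).locallyPathConnectedSpace
  obtain ⟨y₀, hy₀⟩ := hq.surjective_of_connectedSpace (p x₀)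
  -- Simple connectedness lifts `p` through `q`; the subgroup sought consists of the deck
  -- transformations that preserve this lift.
  obtain ⟨f, ⟨hf₀, hqf⟩, -⟩ := hq.existsUnique_continuousMap_lifts p x₀ y₀ hy₀
  have hqf' : ∀ x, q (f x) = p x := congrFun hqf
  have hf : IsLocalHomeomorph f := IsLocalHomeomorph.of_comp (g := q)
    (hqf ▸ hp.isLocalHomeomorph) hq.isLocalHomeomorph f.continuous
  let Λ : Subgroup (DeckGroup p) :=
    { carrier := {g | ∀ x, f (g • x) = f x}
      one_mem' := fun _ => rfl
      mul_mem' := fun {g h} hg hh x => by rw [mul_smul, hg, hh]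
      inv_mem' := fun {g} hg x => by
        have := hg (g⁻¹ • x)
        rw [smul_inv_smul] at this
        exact this.symm }
  refine ⟨Λ, ⟨f, ⟨q, hq.continuous⟩, hqf', ?_, hf.isOpenMap, fun x y => ⟨fun h => ?_, ?_⟩⟩, rfl⟩
  -- Surjectivity: project a path from `y₀` to `y`, lift it upstairs, and compare its image with the
  -- original path by uniqueness of lifts.
  · intro y
    have : PathConnectedSpace N := pathConnectedSpace_iff_connectedSpace.2 inferInstance
    obtain ⟨γ⟩ := PathConnectedSpace.joined y₀ y
    let γq : C(unitInterval, M) := ⟨q ∘ γ, hq.continuous.comp γ.continuous⟩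
    obtain ⟨δ, hδ, hδ₀⟩ := hp.exists_path_lifts γq x₀ (by simp [γq, hy₀])
    refine ⟨δ 1, ?_⟩
    have h : f ∘ δ = γ := hq.eq_of_comp_eq (f.continuous.comp δ.continuous) γ.continuous
      (by rw [← Function.comp_assoc, hqf, hδ]; rfl) 0 (by simp [hδ₀, hf₀])
    exact (congrFun h 1).trans γ.target
  -- `f ∘ g` and `f` both lift `p` through `q` and agree at `x`, hence everywhere.
  · obtain ⟨g, rfl⟩ := DeckGroup.exists_smul_eq hp (x := x) (y := y)
      (by rw [← hqf', ← hqf', h])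
    refine ⟨g, fun z => ?_, rfl⟩
    have : (fun z => f (g • z)) = f := hq.eq_of_comp_eq
      (f.continuous.comp (continuous_const_smul g)) f.continuous
      (funext fun z => by
        change q (f (g • z)) = q (f z)
        rw [hqf', hqf', DeckGroup.apply_smul]) x h.symm
    exact congrFun this z
  · rintro ⟨g, hg, rfl⟩
    exact (hg x).symm

end OrbitCover

/-! ### Finite permutation actions as standard spaces -/

/-- The coset space is its own factor. It is transported to `Fin Λ.index` because the infimum
defining the integral foliated simplicial volume runs over spaces in `Type`. -/
theorem exists_cosetFactor_fin {Γ : Type u} [Group Γ] (Λ : Subgroup Γ) [Λ.FiniteIndex] :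
    ∃ (X : Type) (_ : MeasurableSpace X) (_ : StandardBorelSpace X) (μ : Measure X)
      (_ : IsProbabilityMeasure μ) (_ : MulAction Γ X) (_ : MeasurableConstSMul Γ X)
      (_ : SMulInvariantMeasure Γ X μ), Nonempty (CosetFactor μ Λ) := by
  have hd : Λ.index ≠ 0 := Subgroup.FiniteIndex.index_ne_zero
  let e : Fin Λ.index ≃ Γ ⧸ Λ := (Finite.equivFin (Γ ⧸ Λ)).symm
  let _ : MulAction Γ (Fin Λ.index) := e.mulAction Γ
  let μ : Measure (Fin Λ.index) := (Λ.index : ℝ≥0∞)⁻¹ • Measure.count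
  have hprob : IsProbabilityMeasure μ := ⟨by
    change (Λ.index : ℝ≥0∞)⁻¹ * Measure.count Set.univ = 1
    rw [Measure.count_apply MeasurableSet.univ, Set.encard_univ, ENat.card_eq_coe_fintype_card,
      Fintype.card_fin]
    exact ENNReal.inv_mul_cancel (by exact_mod_cast hd) (by simp)⟩
  have hmeas : MeasurableConstSMul Γ (Fin Λ.index) := ⟨fun g => measurable_of_finite _⟩
  have hinv : SMulInvariantMeasure Γ (Fin Λ.index) μ := ⟨fun g s _ => by
    change (Λ.index : ℝ≥0∞)⁻¹ * Measure.count _ = (Λ.index : ℝ≥0∞)⁻¹ * Measure.count _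
    rw [Measure.count_apply (Set.toFinite _).measurableSet,
      Measure.count_apply (Set.toFinite _).measurableSet, Set.preimage_smul, Set.encard_smul_set]⟩
  refine ⟨Fin Λ.index, inferInstance, inferInstance, μ, hprob, inferInstance, hmeas, hinv,
    ⟨⟨e, fun A => (Set.toFinite _).measurableSet, fun g x => e.apply_symm_apply _, fun a => ?_⟩⟩⟩
  have : e ⁻¹' {a} = {e.symm a} := by
    ext x
    exact e.eq_symm_apply.symm
  rw [this]
  change (Λ.index : ℝ≥0∞)⁻¹ * Measure.count _ = _
  rw [Measure.count_singleton, mul_one]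

/-! ### Comparison of the simplicial volumes. -/

section Main

variable {E M : Type u} [TopologicalSpace E] [TopologicalSpace M] [T2Space M] [CompactSpace M]
  [ConnectedSpace M] [SimplyConnectedSpace E] {p : C(E, M)} (hp : IsCoveringMap p) {n : ℕ}
  (hM : LocallyEuclidean n M) (o : HomologicalOrientation n M)
include hp hM o

theorem integralFoliatedSimplicialVolume_le {Λ : Subgroup (DeckGroup p)} [Λ.FiniteIndex]
    {N : Type u} [TopologicalSpace N] (C : OrbitCover p Λ N) :
    integralFoliatedSimplicialVolume o p ≤ integralSimplicialVolume n N / Λ.index := by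
  obtain ⟨X, hX, hX', μ, hμ, hΓ, hm, hinv, ⟨π⟩⟩ := exists_cosetFactor_fin Λ
  exact iInf_le_of_le X (iInf_le_of_le hX (iInf_le_of_le hX' (iInf_le_of_le μ (iInf_le_of_le hμ
    (iInf_le_of_le hΓ (iInf_le_of_le hm (iInf_le_of_le hinv
      (C.paramSimplicialVolume_le π hp hM o))))))))

/-- Apply both estimates to the system consisting of `Λ` and `Λ'`. Its smallest member is `Λ'`,
which gives the lower bound for the parametrised volume, while the factor map to `Γ/Λ` gives the
upper bound. -/
theorem integralSimplicialVolume_div_index_le {Λ Λ' : Subgroup (DeckGroup p)} [Λ.FiniteIndex]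
    [Λ'.FiniteIndex] (h : Λ' ≤ Λ) {N : Type u} [TopologicalSpace N] (C : OrbitCover p Λ N) :
    integralSimplicialVolume n (MulAction.orbitRel.Quotient Λ' E) / (Λ'.index : ℝ≥0∞) ≤
      integralSimplicialVolume n N / Λ.index := by
  let S : Bool → Subgroup (DeckGroup p) := fun b => bif b then Λ' else Λ
  have hfin : ∀ b, (S b).FiniteIndex := by rintro (_ | _) <;> assumption
  have hmin : ∀ b, S true ≤ S b := by
    rintro (_ | _)
    · exact h
    · exact le_rfl
  refine le_trans ?_ (C.paramSimplicialVolume_le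
    (CosetLimit.factor (CosetLimit.measure S) false) hp hM o)
  exact le_paramSimplicialVolume_cosetLimit (CosetLimit.measure S)
    (N := fun b => MulAction.orbitRel.Quotient (S b) E) (fun b => .quotient p (S b)) hp
    (fun i j => ⟨true, hmin i, hmin j⟩) hM o fun i => ⟨true, hmin i, le_rfl⟩

-- The identity is a one-sheeted covering, and a fundamental cycle is a finite chain.
omit [SimplyConnectedSpace E] hp in
theorem stableIntegralSimplicialVolume_ne_top : stableIntegralSimplicialVolume n M ≠ ∞ := by
  obtain ⟨c, hc⟩ := exists_isFundamentalCycle hM o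
  have h1 : stableIntegralSimplicialVolume n M ≤ integralSimplicialVolume n M / (1 : ℕ) :=
    iInf_le_of_le 1 (iInf_le_of_le one_pos (iInf_le_of_le M (iInf_le_of_le inferInstance
      (iInf_le_of_le inferInstance (iInf_le_of_le id (iInf_le_of_le
        (isLocalHomeomorph_iff_isCoveringMap.1 (Homeomorph.refl M).isLocalHomeomorph)
        (iInf_le _ fun x => by simp)))))))
  have h2 : integralSimplicialVolume n M ≤ l1Norm c :=
    iInf_le_of_le o (iInf_le_of_le c (iInf_le _ hc))
  refine ne_top_of_le_ne_top ?_ (h1.trans (ENNReal.div_le_div_right h2 _))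
  rw [Nat.cast_one, div_one]
  exact ENNReal.sum_ne_top.2 fun _ _ => ENNReal.natCast_ne_top _

theorem paramSimplicialVolume_profiniteCompletion_eq :
    paramSimplicialVolume o p (CosetLimit.measure (finiteIndexSubgroups (DeckGroup p))) =
      ⨅ Λ : {Λ : Subgroup (DeckGroup p) // Λ.FiniteIndex},
        integralSimplicialVolume n (MulAction.orbitRel.Quotient Λ.1 E) / (Λ.1.index : ℝ≥0∞) := by
  have : Nonempty {Λ : Subgroup (DeckGroup p) // Λ.FiniteIndex} := ⟨⟨⊤, inferInstance⟩⟩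
  exact paramSimplicialVolume_cosetLimit_eq (S := finiteIndexSubgroups (DeckGroup p)) _
    (N := fun Λ => MulAction.orbitRel.Quotient Λ.1 E) (fun Λ => .quotient p Λ.1) hp
    (fun Λ Λ' => by
      have := Λ.2
      have := Λ'.2
      exact ⟨⟨Λ.1 ⊓ Λ'.1, inferInstance⟩, inf_le_left, inf_le_right⟩) hM o

theorem paramSimplicialVolume_profiniteCompletion_eq_stable :
    paramSimplicialVolume o p (CosetLimit.measure (finiteIndexSubgroups (DeckGroup p))) =
      stableIntegralSimplicialVolume n M := by
  have := (hM.of_isLocalHomeomorph hp.isLocalHomeomorph).locallyPathConnectedSpace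
  refine le_antisymm ?_ ?_
  · refine le_iInf fun d => le_iInf fun hd => le_iInf fun N => le_iInf fun _ => le_iInf fun _ =>
      le_iInf fun q => le_iInf fun hq => le_iInf fun hcard => ?_
    obtain ⟨Λ, C, rfl⟩ := OrbitCover.exists_of_isCoveringMap hp hM hq
    obtain ⟨x⟩ : Nonempty E := inferInstance
    obtain rfl : Λ.index = d := (C.card_fibre hp x).symm.trans (hcard _)
    have : Λ.FiniteIndex := ⟨hd.ne'⟩
    exact C.paramSimplicialVolume_le
      (CosetLimit.factor (S := finiteIndexSubgroups (DeckGroup p)) _ ⟨Λ, this⟩) hp hM o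
  · rw [paramSimplicialVolume_profiniteCompletion_eq hp hM]
    refine le_iInf fun Λ => ?_
    have := Λ.2
    exact (OrbitCover.quotient p Λ.1).stableIntegralSimplicialVolume_le hM hp

/-- The normalised volumes decrease along the sequence, so they converge to their infimum, which is
the parametrised volume of the limit. -/
theorem tendsto_integralSimplicialVolume_div_index (S : ℕ → Subgroup (DeckGroup p))
    [∀ i, (S i).FiniteIndex] (hS : Antitone S) :
    Tendsto (fun i => integralSimplicialVolume n (MulAction.orbitRel.Quotient (S i) E) /
      ((S i).index : ℝ≥0∞)) atTop (𝓝 (paramSimplicialVolume o p (CosetLimit.measure S))) := by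
  rw [paramSimplicialVolume_cosetLimit_eq (CosetLimit.measure S)
    (N := fun i => MulAction.orbitRel.Quotient (S i) E) (fun i => .quotient p (S i)) hp
    (fun i j => ⟨max i j, hS (le_max_left i j), hS (le_max_right i j)⟩) hM o]
  exact tendsto_atTop_iInf fun i j hij => integralSimplicialVolume_div_index_le hp hM o (hS hij)
    (.quotient p (S i))

end Main

end

/-- `M` is an oriented closed connected `n`-manifold with universal covering `p : E → M`, and
`Γ = DeckGroup p` is its fundamental group, acting by deck transformations.  The covering
associated with a subgroup `Γ i` is the orbit space of `E` under `Γ i`. -/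
theorem theorem2p5 {n : ℕ} {M E : Type u}
    [TopologicalSpace M] [T2Space M] [CompactSpace M] [ConnectedSpace M]
    [ChartedSpace (EuclideanSpace ℝ (Fin n)) M] (o : HomologicalOrientation n M)
    [TopologicalSpace E] [SimplyConnectedSpace E] (p : C(E, M)) (hp : IsCoveringMap p) :
    (integralFoliatedSimplicialVolume o p ≤
        paramSimplicialVolume o p
          (CosetLimit.measure (finiteIndexSubgroups (DeckGroup p))) ∧
      paramSimplicialVolume o p
          (CosetLimit.measure (finiteIndexSubgroups (DeckGroup p))) =
        stableIntegralSimplicialVolume n M ∧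
      stableIntegralSimplicialVolume n M ≠ ∞) ∧
    ∀ (S : ℕ → Subgroup (DeckGroup p)) [∀ i, (S i).FiniteIndex], S 0 = ⊤ → Antitone S →
      Tendsto
        (fun i => integralSimplicialVolume n (MulAction.orbitRel.Quotient (S i) E) /
          ((S i).index : ℝ≥0∞))
        atTop (𝓝 (paramSimplicialVolume o p (CosetLimit.measure S))) := by
  have hM : LocallyEuclidean n M := locallyEuclidean_of_chartedSpace
  refine ⟨⟨?_, paramSimplicialVolume_profiniteCompletion_eq_stable hp hM o,
    stableIntegralSimplicialVolume_ne_top hM o⟩,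
    fun S _ _ hS => tendsto_integralSimplicialVolume_div_index hp hM o S hS⟩
  -- The comparison passes through the infimum over finite index subgroups: each term is already an
  -- upper bound realised by a finite `Γ`-space, so the inverse limit need not be shown to be
  -- standard Borel.
  rw [paramSimplicialVolume_profiniteCompletion_eq hp hM o]
  refine le_iInf fun Λ => ?_
  have := Λ.2
  exact integralFoliatedSimplicialVolume_le hp hM o (.quotient p Λ.1)
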